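/- Let $N\ge 3$, $2^*=2N/(N-2)$, and let $\Omega\subset\mathbb{R}^N$ be a domain (a nonempty, open, connected set). Let $\mathcal D^{1,2}(\mathbb{R}^N,\mathbb{R}^N)$ be the completion of $C_0^\infty(\mathbb{R}^N,\mathbb{R}^N)$ in the norm $|\nabla\cdot|_2$, regarded as a space of functions in $L^{2^*}(\mathbb{R}^N,\mathbb{R}^N)$, and let $\mathcal V$ be a closed subspace of it. Put $$\mathcal W=\{w\in L^{2^*}(\Omega,\mathbb{R}^N):\ \partial_k w_l-\partial_l w_k=0 \text{ in } \mathcal D'(\Omega) \text{ for all } k,l\},$$ let $Z$ be a finite-dimensional subspace of $L^{2^*}(\Omega,\mathbb{R}^N)$ with $Z\cap\mathcal W=\{0\}$, and put $\widetilde{\mathcal W}=\mathcal W\oplus Z$. Let $F:\Omega\times\mathbb{R}^N\to\mathbb{R}$ satisfy: (F1) for a.e. $x\in\Omega$, $F(x,\cdot)$ is differentiable and $F(x,0)=0$; the function $f=\partial_uF$ is a Carathéodory function, i.e. $f(\cdot,u)$ is measurable for every $u\in\mathbb{R}^N$ and $f(x,\cdot)$ is continuous for a.e. $x\in\Omega$;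 (F2) for every compact $A\subset(\mathbb{R}^N\times\mathbb{R}^N)\setminus\{(u,u):u\in\mathbb{R}^N\}$, $$\inf_{x\in\Omega,\ (u_1,u_2)\in A}\Big(\tfrac12\big(F(x,u_1)+F(x,u_2)\big)-F\big(x,\tfrac{u_1+u_2}2\big)\Big)>0;$$ (F3) there are $c_1,c_2>0$ and $a\in L^{N/2}(\Omega)$, $a\ge0$, such that $c_1|u|^{2^*}\le F(x,u)$ and $|f(x,u)|\le a(x)|u|+c_2|u|^{2^*-1}$ for every $u\in\mathbb{R}^N$ and a.e. $x\in\Omega$. Then for every $v\in\mathcal V$ there is a unique $\widetilde w_\Omega(v)\in\widetilde{\mathcal W}$ such that $$\int_\Omega F(x,v+\widetilde w_\Omega(v))\,dx\le\int_\Omega F(x,v+\widetilde w)\,dx\quad\text{for all }\widetilde w\in\widetilde{\mathcal W}.$$ Moreover, suppose that $v_n,v_0\in\mathcal V$, $v_n\rightharpoonup v_0$ weakly in $\mathcal V$, $v_n\to v_0$ a.e. in $\mathbb{R}^N$, and $|\nabla v_n|^2\,dx\rightharpoonup\mu$ and $|v_n|^{2^*}dx\rightharpoonup\rho$, where $\mu,\rho$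 are finite measures on $\mathbb{R}^N$ and the convergence is tested with functions in $C_0(\mathbb{R}^N)$, the continuous functions vanishing at infinity. Then there are an at most countable set $I\subset\mathbb{R}^N$ and nonnegative weights $(\mu_x)_{x\in I}$, $(\rho_x)_{x\in I}$ such that $$\mu\ge|\nabla v_0|^2\,dx+\sum_{x\in I}\mu_x\delta_x,\qquad \rho=|v_0|^{2^*}dx+\sum_{x\in I}\rho_x\delta_x,$$ and there is a subsequence along which $\widetilde w_\Omega(v_n)\rightharpoonup\widetilde w_\Omega(v_0)$ weakly in $\widetilde{\mathcal W}$ (with the norm of $L^{2^*}$), $\widetilde w_\Omega(v_n)\to\widetilde w_\Omega(v_0)$ a.e. in $\Omega$, and, for all $1\le p<2^*$, $\widetilde w_\Omega(v_n)\to\widetilde w_\Omega(v_0)$ in $L^p_{\mathrm{loc}}(\Omega)$, i.e. in $L^p(K)$ for every compact $K\subset\Omega$. -/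

import Mathlib

open MeasureTheory Filter Topology
open scoped ENNReal NNReal ContDiff ZeroAtInfty

noncomputable section

/-- `ℝ^N` with the Euclidean norm. -/
abbrev Vec (N : ℕ) : Type := EuclideanSpace ℝ (Fin N)

/-- Real `N × N` matrices with the Euclidean (Frobenius) norm, `|G|² = ∑ |G_{ij}|²`. -/
abbrev Mat (N : ℕ) : Type := EuclideanSpace ℝ (Fin N × Fin N)

/-- The critical Sobolev exponent `2* = 2N / (N - 2)`, as a real number. -/
def critExp (N : ℕ) : ℝ := 2 * N / (N - 2)

/-- The critical Sobolev exponent `2*` as an `L^p` exponent. -/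
def twoStar (N : ℕ) : ℝ≥0∞ := ENNReal.ofReal (critExp N)

instance one_le_twoStar (N : ℕ) [hN : Fact (3 ≤ N)] : Fact (1 ≤ twoStar N) := by
  refine ⟨?_⟩
  have h : (3 : ℝ) ≤ N := by exact_mod_cast hN.out
  rw [twoStar, ENNReal.one_le_ofReal, critExp, le_div_iff₀ (by linarith)]
  linarith

/-- The `i`-th standard basis vector of `ℝ^N`. -/
def basisVec {N : ℕ} (i : Fin N) : Vec N := EuclideanSpace.single i 1

/-- The matrix of a linear map; for a derivative its `(i, j)` entry is `∂_i φ_j`. -/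
def linMat (N : ℕ) : (Vec N →L[ℝ] Vec N) →ₗ[ℝ] Mat N where
  toFun L := WithLp.toLp 2 fun ij => L (basisVec ij.1) ij.2
  map_add' L M := by ext ij; simp
  map_smul' c L := by ext ij; simp

/-- The gradient matrix `∇φ = (∂_i φ_j)` of a differentiable vector field. -/
def jac {N : ℕ} (φ : Vec N → Vec N) (x : Vec N) : Mat N := linMat N (fderiv ℝ φ x)

/-- `φ ∈ C_0^∞(ℝ^N, ℝ^N)`: smooth with compact support. -/
def IsTestField {N : ℕ} (φ : Vec N → Vec N) : Prop := ContDiff ℝ ∞ φ ∧ HasCompactSupport φ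

/-- The pairs `(φ, ∇φ)`, `φ ∈ C_0^∞(ℝ^N, ℝ^N)`, inside `L^{2*} × L²`. -/
def testPairs (N : ℕ) [Fact (3 ≤ N)] :
    Submodule ℝ (Lp (Vec N) (twoStar N) (volume : Measure (Vec N)) ×
      Lp (Mat N) 2 (volume : Measure (Vec N))) where
  carrier := {p | ∃ φ : Vec N → Vec N, IsTestField φ ∧
    p.1 =ᵐ[volume] φ ∧ p.2 =ᵐ[volume] jac φ}
  zero_mem' := by
    refine ⟨0, ⟨contDiff_const, HasCompactSupport.zero⟩, Lp.coeFn_zero _ _ _, ?_⟩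
    refine (Lp.coeFn_zero _ _ _).trans (ae_of_all _ fun x => ?_)
    simp [jac]
  add_mem' := by
    rintro p q ⟨φ, hφ, h1, h2⟩ ⟨ψ, hψ, k1, k2⟩
    refine ⟨φ + ψ, ⟨hφ.1.add hψ.1, hφ.2.add hψ.2⟩,
      (Lp.coeFn_add _ _).trans (h1.add k1), (Lp.coeFn_add _ _).trans ((h2.add k2).trans ?_)⟩
    refine ae_of_all _ fun x => ?_
    simp only [jac, Pi.add_apply]
    rw [fderiv_add (hφ.1.differentiable (by simp) x) (hψ.1.differentiable (by simp) x), map_add]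
  smul_mem' := by
    rintro c p ⟨φ, hφ, h1, h2⟩
    refine ⟨c • φ, ⟨hφ.1.const_smul c, hφ.2.smul_left (f := fun _ => c)⟩,
      (Lp.coeFn_smul _ _).trans (h1.const_smul c),
      (Lp.coeFn_smul _ _).trans ((h2.const_smul c).trans ?_)⟩
    refine ae_of_all _ fun x => ?_
    simp only [jac, Pi.smul_apply]
    rw [fderiv_const_smul (hφ.1.differentiable (by simp) x), map_smul]

/-- The space `D^{1,2}(ℝ^N, ℝ^N)`: the completion of `C_0^∞(ℝ^N, ℝ^N)` in the norm `|∇·|₂`,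
realised as a space of functions. Its elements are the pairs `(v, ∇v)` for which there are
`φ_k ∈ C_0^∞` with `∇φ_k → ∇v` in `L²` and `φ_k → v` in `L^{2*}`. By the Sobolev inequality
the second convergence (to some `v`, which is then unique) follows from the first one. -/
def D12 (N : ℕ) [Fact (3 ≤ N)] : Type := ↥((testPairs N).topologicalClosure)

namespace D12

variable {N : ℕ} [Fact (3 ≤ N)]

instance : AddCommGroup (D12 N) :=
  inferInstanceAs (AddCommGroup ↥((testPairs N).topologicalClosure))

instance : Module ℝ (D12 N) :=
  inferInstanceAs (Module ℝ ↥((testPairs N).topologicalClosure))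

/-- The function in `L^{2*}(ℝ^N, ℝ^N)` given by an element of `D^{1,2}`. -/
def fn : D12 N →ₗ[ℝ] Lp (Vec N) (twoStar N) (volume : Measure (Vec N)) :=
  (LinearMap.fst ℝ _ _).comp (testPairs N).topologicalClosure.subtype

/-- The gradient in `L²(ℝ^N, ℝ^{N×N})` of an element of `D^{1,2}`. -/
def grad : D12 N →ₗ[ℝ] Lp (Mat N) 2 (volume : Measure (Vec N)) :=
  (LinearMap.snd ℝ _ _).comp (testPairs N).topologicalClosure.subtype

theorem linMat_injective (N : ℕ) : Function.Injective (linMat N) := by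
  intro L M h
  refine ContinuousLinearMap.coe_injective
    ((EuclideanSpace.basisFun (Fin N) ℝ).toBasis.ext fun i => ?_)
  ext j
  have := congrArg (fun G : Mat N => G (i, j)) h
  simpa [linMat, basisVec] using this

/-- The Sobolev inequality on `D^{1,2}`. -/
theorem sobolev : ∃ C : ℝ≥0, ∀ v : D12 N, ‖fn v‖ₑ ≤ C * ‖grad v‖ₑ := by
  have hN : 3 ≤ N := Fact.out
  have hNR : (3 : ℝ) ≤ N := by exact_mod_cast hN
  obtain ⟨K, -, hK⟩ := (linMat N).exists_antilipschitzWith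
    (LinearMap.ker_eq_bot.2 (linMat_injective N))
  have hK' : ∀ L : Vec N →L[ℝ] Vec N, ‖L‖ ≤ K * ‖linMat N L‖ := fun L => by
    simpa using hK.le_mul_dist L 0
  set S := eLpNormLESNormFDerivOfEqInnerConst (volume : Measure (Vec N)) ((2 : ℝ≥0) : ℝ)
  refine ⟨S * K, ?_⟩
  suffices h : (((testPairs N).topologicalClosure : Submodule ℝ _) : Set _) ⊆
      {p : Lp (Vec N) (twoStar N) (volume : Measure (Vec N)) ×
        Lp (Mat N) 2 (volume : Measure (Vec N)) |
          ‖p.1‖ₑ ≤ ((S * K : ℝ≥0) : ℝ≥0∞) * ‖p.2‖ₑ} from fun v => h v.2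
  rw [Submodule.topologicalClosure_coe]
  refine closure_minimal ?_ (isClosed_le continuous_fst.enorm
    ((ENNReal.continuous_const_mul ENNReal.coe_ne_top).comp continuous_snd.enorm))
  rintro p ⟨φ, hφ, h1, h2⟩
  rw [Set.mem_ofPred_eq, Lp.enorm_def, Lp.enorm_def, eLpNorm_congr_ae h1, eLpNorm_congr_ae h2]
  have key := eLpNorm_le_eLpNorm_fderiv_of_eq_inner (volume : Measure (Vec N))
    (u := φ) (hφ.1.of_le (by simp)) hφ.2 (p := 2) (p' := (critExp N).toNNReal)
    (by norm_num) (by simp; lia) (by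
      have h0 : 0 ≤ critExp N := by
        rw [critExp]; exact div_nonneg (by linarith) (by linarith)
      have : (N : ℝ) - 2 ≠ 0 := by linarith
      have : (N : ℝ) ≠ 0 := by linarith
      rw [Real.coe_toNNReal _ h0, critExp]
      simp
      field_simp)
  refine key.trans ?_
  rw [ENNReal.coe_mul, mul_assoc]
  gcongr
  have := eLpNorm_le_nnreal_smul_eLpNorm_of_ae_le_mul (μ := (volume : Measure (Vec N)))
    (f := fderiv ℝ φ) (g := jac φ) (c := K) (ae_of_all _ fun x => hK' _) 2
  rwa [ENNReal.smul_def, smul_eq_mul] at this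

theorem grad_injective : Function.Injective (grad : D12 N →ₗ[ℝ] _) := by
  obtain ⟨C, hC⟩ := sobolev (N := N)
  rw [← LinearMap.ker_eq_bot, LinearMap.ker_eq_bot']
  intro v hv
  have h := hC v
  rw [hv] at h
  have h' : fn v = 0 := by simpa using h
  exact Subtype.ext (Prod.ext h' hv)

/-- The norm of `D^{1,2}` is `‖v‖ = |∇v|₂`. -/
instance : NormedAddCommGroup (D12 N) :=
  NormedAddCommGroup.induced (D12 N) (Lp (Mat N) 2 (volume : Measure (Vec N))) grad grad_injective

instance : NormedSpace ℝ (D12 N) :=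
  NormedSpace.induced ℝ (D12 N) (Lp (Mat N) 2 (volume : Measure (Vec N))) grad

end D12

/-- Weak convergence of a sequence in a normed space. -/
def WeakTendsto {X : Type*} [NormedAddCommGroup X] [NormedSpace ℝ X] (u : ℕ → X) (u₀ : X) : Prop :=
  Tendsto (fun n => toWeakSpace ℝ X (u n)) atTop (𝓝 (toWeakSpace ℝ X u₀))

/-- `h_n ⇀ μ` in the space `M(ℝ^N)` of finite measures, the dual of `C_0(ℝ^N)`, where the
function `h_n` stands for the measure `h_n dx`. -/
def MeasTendsto {N : ℕ} (h : ℕ → Vec N → ℝ) (μ : Measure (Vec N)) : Prop :=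
  ∀ φ : C₀(Vec N, ℝ), Tendsto (fun n => ∫ x, φ x * h n x) atTop (𝓝 (∫ x, φ x ∂μ))

/-- The space `L^{2*}(Ω, ℝ^N)`. -/
abbrev LCrit (N : ℕ) (Ω : Set (Vec N)) : Type :=
  Lp (Vec N) (twoStar N) (volume.restrict Ω)

/-- `ψ ∈ C_0^∞(Ω)`. -/
def IsTestFunction {N : ℕ} (Ω : Set (Vec N)) (ψ : Vec N → ℝ) : Prop :=
  ContDiff ℝ ∞ ψ ∧ HasCompactSupport ψ ∧ tsupport ψ ⊆ Ω

/-- The partial derivative `∂_k ψ`. -/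
def partialDeriv {N : ℕ} (k : Fin N) (ψ : Vec N → ℝ) (x : Vec N) : ℝ := fderiv ℝ ψ x (basisVec k)

/-- The pairing of the distribution `∂_k w_l` with the test function `ψ`. -/
def distDeriv {N : ℕ} {Ω : Set (Vec N)} (w : LCrit N Ω) (k l : Fin N) (ψ : Vec N → ℝ) : ℝ :=
  - ∫ x in Ω, w x l * partialDeriv k ψ x

theorem integrable_mul_partialDeriv {N : ℕ} [Fact (3 ≤ N)] {Ω : Set (Vec N)} (w : LCrit N Ω)
    (k l : Fin N) {ψ : Vec N → ℝ} (hψ : IsTestFunction Ω ψ) :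
    IntegrableOn (fun x => w x l * partialDeriv k ψ x) Ω := by
  have hc : Continuous (partialDeriv k ψ) :=
    (hψ.1.continuous_fderiv (by simp)).clm_apply continuous_const
  have hs : HasCompactSupport (partialDeriv k ψ) :=
    (hψ.2.1.fderiv ℝ).comp_left (g := fun L : Vec N →L[ℝ] ℝ => L (basisVec k)) rfl
  have hw : LocallyIntegrable (fun x => w x l) (volume.restrict Ω) := by
    have h1 : MemLp (fun x => w x l) (twoStar N) (volume.restrict Ω) :=
      (EuclideanSpace.proj l : Vec N →L[ℝ] ℝ).comp_memLp' (Lp.memLp w)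
    exact h1.locallyIntegrable (one_le_twoStar N).out
  simpa [IntegrableOn, mul_comm] using hw.integrable_smul_left_of_hasCompactSupport hc hs

/-- The space `W` of the `w ∈ L^{2*}(Ω, ℝ^N)` with `∇ × w = 0`, that is,
`∂_k w_l - ∂_l w_k = 0` in the sense of distributions on `Ω` for all `k`, `l`. -/
def curlFree (N : ℕ) [Fact (3 ≤ N)] (Ω : Set (Vec N)) : Submodule ℝ (LCrit N Ω) where
  carrier := {w | ∀ k l : Fin N, ∀ ψ : Vec N → ℝ, IsTestFunction Ω ψ →
    distDeriv w k l ψ - distDeriv w l k ψ = 0}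
  zero_mem' := by
    intro k l ψ _
    have h : ∀ i j : Fin N, distDeriv (0 : LCrit N Ω) i j ψ = 0 := fun i j => by
      rw [distDeriv, integral_eq_zero_of_ae, neg_zero]
      filter_upwards [Lp.coeFn_zero (Vec N) (twoStar N) (volume.restrict Ω)] with x hx
      rw [hx]
      simp
    simp [h]
  add_mem' := by
    intro v w hv hw k l ψ hψ
    have h : ∀ i j : Fin N, distDeriv (v + w) i j ψ = distDeriv v i j ψ + distDeriv w i j ψ :=
      fun i j => by
        rw [distDeriv, distDeriv, distDeriv, ← neg_add, ← integral_add
          (integrable_mul_partialDeriv v i j hψ) (integrable_mul_partialDeriv w i j hψ)]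
        congr 1
        refine integral_congr_ae ?_
        filter_upwards [Lp.coeFn_add v w] with x hx
        rw [hx]
        simp [add_mul]
    rw [h, h]
    linarith [hv k l ψ hψ, hw k l ψ hψ]
  smul_mem' := by
    intro c w hw k l ψ hψ
    have h : ∀ i j : Fin N, distDeriv (c • w) i j ψ = c * distDeriv w i j ψ := fun i j => by
      rw [distDeriv, distDeriv, mul_neg, ← integral_const_mul]
      congr 1
      refine integral_congr_ae ?_
      filter_upwards [Lp.coeFn_smul c w] with x hx
      rw [hx]
      simp [mul_assoc]
    rw [h, h, ← mul_sub, hw k l ψ hψ, mul_zero]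

/-- `f = ∂_u F`. -/
def uGrad {N : ℕ} (F : Vec N → Vec N → ℝ) (x u : Vec N) : Vec N := gradient (F x) u

/-- `F(x, ·)` is differentiable for a.e. `x ∈ Ω`, `F(x, 0) = 0`, and `f = ∂_u F` is a
Carathéodory function. -/
structure CondF1 {N : ℕ} (Ω : Set (Vec N)) (F : Vec N → Vec N → ℝ) : Prop where
  differentiable : ∀ᵐ x ∂volume.restrict Ω, Differentiable ℝ (F x)
  zero : ∀ᵐ x ∂volume.restrict Ω, F x 0 = 0
  measurable : ∀ u, AEMeasurable (fun x => uGrad F x u) (volume.restrict Ω)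
  continuous : ∀ᵐ x ∂volume.restrict Ω, Continuous (uGrad F x)

/-- Uniform strict convexity in `u`: the infimum over `x ∈ Ω` and `(u₁, u₂) ∈ A` of the midpoint
convexity gap is positive, for each compact `A` that does not meet the diagonal. -/
def CondF2 {N : ℕ} (Ω : Set (Vec N)) (F : Vec N → Vec N → ℝ) : Prop :=
  ∀ A : Set (Vec N × Vec N), IsCompact A → (∀ u, (u, u) ∉ A) →
    ∃ m : ℝ, 0 < m ∧ ∀ x ∈ Ω, ∀ u₁ u₂ : Vec N, (u₁, u₂) ∈ A →
      m ≤ (1 / 2 : ℝ) * (F x u₁ + F x u₂) - F x ((1 / 2 : ℝ) • (u₁ + u₂))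

/-- Critical growth. -/
def CondF3 {N : ℕ} (Ω : Set (Vec N)) (F : Vec N → Vec N → ℝ) : Prop :=
  ∃ c₁ c₂ : ℝ, 0 < c₁ ∧ 0 < c₂ ∧ ∃ a : Vec N → ℝ,
    MemLp a (ENNReal.ofReal ((N : ℝ) / 2)) (volume.restrict Ω) ∧
    (∀ᵐ x ∂volume.restrict Ω, 0 ≤ a x) ∧
    ∀ᵐ x ∂volume.restrict Ω, ∀ u : Vec N,
      c₁ * ‖u‖ ^ critExp N ≤ F x u ∧
      ‖uGrad F x u‖ ≤ a x * ‖u‖ + c₂ * ‖u‖ ^ (critExp N - 1)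

/-- `w ∈ S` minimises `∫_Ω F(x, v + w) dx` over the subspace `S` of `L^{2*}(Ω, ℝ^N)`. -/
def IsCorrector {N : ℕ} [Fact (3 ≤ N)] (Ω : Set (Vec N)) (F : Vec N → Vec N → ℝ)
    (S : Submodule ℝ (LCrit N Ω)) (v : D12 N) (w : S) : Prop :=
  ∀ w' : S, ∫ x in Ω, F x (v.fn x + w.1 x) ≤ ∫ x in Ω, F x (v.fn x + w'.1 x)

/-- The minimiser `w̃_Ω(v)` of `∫_Ω F(x, v + w) dx` over `w ∈ S`. It is used only when there is
exactly one minimiser. -/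
def corrector {N : ℕ} [Fact (3 ≤ N)] (Ω : Set (Vec N)) (F : Vec N → Vec N → ℝ)
    (S : Submodule ℝ (LCrit N Ω)) (v : D12 N) : S :=
  Classical.epsilon (IsCorrector Ω F S v)

end

/-! Write p = 2* and u = v + w. The hypotheses on F enter through a few properties
(`UniformlyConvexIntegrand`): F is convex in u, F ≥ c|u|^p, the increments satisfy |F(x,u+r) -
F(x,u)| ≤ ε(b(x) + |u|^p) + C_ε|r|^p with b in L¹, and the midpoint convexity gap is bounded below
on bounded sets away from the diagonal. By Chebyshev's inequality, two fields with bounded L^p norms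
and a small integrated gap are close in measure (`exists_measure_le_of_integral_gap_le`).

Existence and uniqueness. The midpoint of two competitors is a competitor, so their integrated gap
is at most their mean energy minus the infimum. A minimising sequence is therefore Cauchy in measure
and has an a.e. convergent subsequence. Bounded a.e. convergent sequences in L^p converge weakly
(`Lp.tendsto_apply_of_tendsto_ae`), hence the limit stays in the closed subspace, and Fatou's lemma
makes it a minimiser. Two minimisers have gap zero and coincide.

Limit measures. The Sobolev inequality for φ(v_n - v₀) gives, for every a > 1 and with b depending
on a alone, ∫φ^p dρ ≤ a∫φ^p|v₀|^p + b(∫φ² dγ)^(p/2), where γ = μ + |∇v₀|² dx. Since p/2 > 1, cutting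
a set free of atoms of γ into pieces of small γ-measure removes the last term. Thus ρ and |v₀|^p dx
agree off the countable set D of atoms of γ (`D12.exists_countable_concentration`).

Correctors. The obstruction is that v_n need not converge strongly in L^p, and that multiplying a
curl-free field by a cutoff φ destroys curl-freeness. A cutoff that vanishes on a compact part of D
carrying most of the mass of ρ on D makes φ(v_n - v₀) small in L^p, and such a φ can equal 1 on a
ball up to a set of small measure. If curl-free fields y_k tend weakly to 0, then locally y_k is
nearly ∇ξ_k with ξ_k → 0 strongly after subtracting means, so φ y_k is nearly ∇(φξ_k), which is
curl-free (`exists_curlFree_tendsto_integral_sub`). The Z-components converge strongly because Z is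
finite-dimensional. Hence, for u_n = v_n + w_n with w_n the corrector of v_n, the field φ(u_n - u_m)
is close in L^p to some g in W. Comparing u_n with u_n - g/2 and u_m with u_m + g/2, both
admissible, bounds the integral of φ times the gap of u_n and u_m (`integral_mul_midpointGap_le`).
So u_n is Cauchy in measure on balls in Ω and converges a.e. along a subsequence. The limit
minimises for v₀, and uniqueness identifies it; weak and L^p_loc convergence follow from a.e.
convergence and boundedness. -/

/-! ### Convergence theorems and inequalities in L^p -/

section MeasureLemmas

variable {α : Type*} [MeasurableSpace α] {μ : Measure α}

/-- A Vitali type convergence theorem: almost everywhere convergence implies convergence in mean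
if the functions are bounded by `ε G_n + H_ε`, where `G_n` is bounded in `L¹`. -/
theorem tendsto_integral_abs_sub_of_le_mul_add {ψ G : ℕ → α → ℝ} {ψ₀ : α → ℝ} {M : ℝ}
    (hψ : ∀ n, AEStronglyMeasurable (ψ n) μ) (hψ₀ : Integrable ψ₀ μ)
    (hlim : ∀ᵐ x ∂μ, Tendsto (fun n => ψ n x) atTop (𝓝 (ψ₀ x)))
    (hG : ∀ n, Integrable (G n) μ) (hG0 : ∀ n, ∀ᵐ x ∂μ, 0 ≤ G n x)
    (hM : ∀ n, ∫ x, G n x ∂μ ≤ M)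
    (h : ∀ ε > 0, ∃ H : α → ℝ, Integrable H μ ∧ ∀ n, ∀ᵐ x ∂μ, |ψ n x| ≤ ε * G n x + H x) :
    Tendsto (fun n => ∫ x, |ψ n x - ψ₀ x| ∂μ) atTop (𝓝 0) := by
  have hint : ∀ n, Integrable (ψ n) μ := fun n => by
    obtain ⟨H, hH, hb⟩ := h 1 one_pos
    refine (((hG n).const_mul 1).add hH).mono' (hψ n) ?_
    filter_upwards [hb n] with x hx using hx
  have hM0 : 0 ≤ M := (integral_nonneg_of_ae (hG0 0)).trans (hM 0)
  rw [Metric.tendsto_atTop]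
  intro ε hε
  set δ := ε / (2 * (M + 1)) with hδ
  have hδ0 : 0 < δ := by positivity
  obtain ⟨H, hH, hb⟩ := h δ hδ0
  -- The excess over `δ * G n` is dominated by `|H| + |ψ₀|`, independently of `n`, so dominated
  -- convergence applies to it. The part cut off has integral at most `δ * M < ε / 2`.
  set D : ℕ → α → ℝ := fun n x => max (|ψ n x - ψ₀ x| - δ * G n x) 0 with hD
  have hDm : ∀ n, AEStronglyMeasurable (D n) μ := fun n =>
    (((hint n).sub hψ₀).abs.sub ((hG n).const_mul δ)).aestronglyMeasurable.sup
      aestronglyMeasurable_const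
  have hDb : ∀ n, ∀ᵐ x ∂μ, ‖D n x‖ ≤ |H x| + |ψ₀ x| := fun n => by
    filter_upwards [hb n] with x hx
    rw [Real.norm_of_nonneg (le_max_right _ _)]
    refine max_le ?_ (by positivity)
    have := abs_sub (ψ n x) (ψ₀ x)
    have := le_abs_self (H x)
    linarith
  have hDl : ∀ᵐ x ∂μ, Tendsto (fun n => D n x) atTop (𝓝 0) := by
    filter_upwards [hlim, ae_all_iff.2 hG0] with x hx hg
    have h1 : Tendsto (fun n => |ψ n x - ψ₀ x|) atTop (𝓝 0) := by
      have := (hx.sub_const (ψ₀ x)).abs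
      simpa using this
    refine squeeze_zero (fun n => le_max_right _ _) (fun n => max_le ?_ (abs_nonneg _)) h1
    have := mul_nonneg hδ0.le (hg n)
    linarith
  have hDt := tendsto_integral_of_dominated_convergence _ hDm (hH.abs.add hψ₀.abs) hDb hDl
  rw [integral_zero, Metric.tendsto_atTop] at hDt
  obtain ⟨n₀, hn₀⟩ := hDt (ε / 2) (by positivity)
  refine ⟨n₀, fun n hn => ?_⟩
  have hDi : Integrable (D n) μ := (hH.abs.add hψ₀.abs).mono' (hDm n) (hDb n)
  have h1 : ∫ x, |ψ n x - ψ₀ x| ∂μ ≤ ∫ x, (D n x + δ * G n x) ∂μ := by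
    refine integral_mono ((hint n).sub hψ₀).abs (hDi.add ((hG n).const_mul δ)) fun x => ?_
    have := le_max_left (|ψ n x - ψ₀ x| - δ * G n x) 0
    simp only [hD]
    linarith
  rw [integral_add hDi ((hG n).const_mul δ), integral_const_mul] at h1
  have h2 := hn₀ n hn
  rw [Real.dist_eq, sub_zero] at h2 ⊢
  rw [abs_of_nonneg (integral_nonneg fun x => abs_nonneg _)]
  have h3 : δ * ∫ x, G n x ∂μ ≤ δ * M := mul_le_mul_of_nonneg_left (hM n) hδ0.le
  have h4 : δ * M < ε / 2 := by
    rw [hδ, div_mul_eq_mul_div, div_lt_div_iff₀ (by positivity) (by positivity)]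
    nlinarith
  have h5 := le_abs_self (∫ x, D n x ∂μ)
  linarith

theorem tendsto_integral_of_le_mul_add {ψ G : ℕ → α → ℝ} {ψ₀ : α → ℝ} {M : ℝ}
    (hψ : ∀ n, AEStronglyMeasurable (ψ n) μ) (hψ₀ : Integrable ψ₀ μ)
    (hlim : ∀ᵐ x ∂μ, Tendsto (fun n => ψ n x) atTop (𝓝 (ψ₀ x)))
    (hG : ∀ n, Integrable (G n) μ) (hG0 : ∀ n, ∀ᵐ x ∂μ, 0 ≤ G n x)
    (hM : ∀ n, ∫ x, G n x ∂μ ≤ M)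
    (h : ∀ ε > 0, ∃ H : α → ℝ, Integrable H μ ∧ ∀ n, ∀ᵐ x ∂μ, |ψ n x| ≤ ε * G n x + H x) :
    Tendsto (fun n => ∫ x, ψ n x ∂μ) atTop (𝓝 (∫ x, ψ₀ x ∂μ)) := by
  have hint : ∀ n, Integrable (ψ n) μ := fun n => by
    obtain ⟨H, hH, hb⟩ := h 1 one_pos
    refine (((hG n).const_mul 1).add hH).mono' (hψ n) ?_
    filter_upwards [hb n] with x hx using hx
  rw [tendsto_iff_dist_tendsto_zero]
  refine squeeze_zero (fun _ => dist_nonneg) (fun n => ?_)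
    (tendsto_integral_abs_sub_of_le_mul_add hψ hψ₀ hlim hG hG0 hM h)
  rw [Real.dist_eq, ← integral_sub (hint n) hψ₀]
  exact abs_integral_le_integral_abs

/-- Fatou's lemma for real integrals, with an integrable limit. -/
theorem eventually_integral_sub_le_of_tendsto_ae {f : ℕ → α → ℝ} {g : α → ℝ}
    (hf : ∀ n, Integrable (f n) μ) (hf0 : ∀ n, ∀ᵐ x ∂μ, 0 ≤ f n x) (hg : Integrable g μ)
    (hlim : ∀ᵐ x ∂μ, Tendsto (fun n => f n x) atTop (𝓝 (g x))) {ε : ℝ} (hε : 0 < ε) :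
    ∀ᶠ n in atTop, ∫ x, g x ∂μ - ε ≤ ∫ x, f n x ∂μ := by
  -- Truncation at the limit `g` supplies the majorant `|g|` and only decreases the integrals.
  have hi : ∀ n, Integrable (fun x => min (f n x) (g x)) μ := fun n => (hf n).inf hg
  have ht : Tendsto (fun n => ∫ x, min (f n x) (g x) ∂μ) atTop (𝓝 (∫ x, g x ∂μ)) := by
    refine tendsto_integral_of_dominated_convergence (fun x => |g x|)
      (fun n => (hi n).aestronglyMeasurable) hg.abs (fun n => ?_) ?_
    · filter_upwards [hf0 n] with x hx
      rw [Real.norm_eq_abs, abs_le]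
      constructor
      · rcases min_choice (f n x) (g x) with h | h <;> rw [h]
        · have := abs_nonneg (g x); linarith
        · exact neg_abs_le _
      · exact (min_le_right _ _).trans (le_abs_self _)
    · filter_upwards [hlim] with x hx
      simpa using hx.min (tendsto_const_nhds (x := g x))
  filter_upwards [ht.eventually (lt_mem_nhds (sub_lt_self _ hε))] with n hn
  exact hn.le.trans (integral_mono (hi n) (hf n) fun x => min_le_left _ _)

variable {E : Type*} [NormedAddCommGroup E]

theorem MemLp.integrable_norm_rpow_ofReal {p : ℝ} (hp : 1 ≤ p) {f : α → E}
    (hf : MemLp f (ENNReal.ofReal p) μ) : Integrable (fun x => ‖f x‖ ^ p) μ := by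
  have := hf.integrable_norm_rpow (by simpa using by linarith) ENNReal.ofReal_ne_top
  rwa [ENNReal.toReal_ofReal (by linarith)] at this

theorem eLpNorm_ofReal_eq {p : ℝ} (hp : 1 ≤ p) {f : α → E}
    (hf : MemLp f (ENNReal.ofReal p) μ) :
    eLpNorm f (ENNReal.ofReal p) μ = ENNReal.ofReal ((∫ x, ‖f x‖ ^ p ∂μ) ^ p⁻¹) := by
  rw [hf.eLpNorm_eq_integral_rpow_norm (by simpa using by linarith) ENNReal.ofReal_ne_top,
    ENNReal.toReal_ofReal (by linarith)]

theorem Lp.norm_rpow_eq_integral {p : ℝ} (hp : 1 ≤ p) (f : Lp E (ENNReal.ofReal p) μ) :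
    ‖f‖ ^ p = ∫ x, ‖f x‖ ^ p ∂μ := by
  have h0 : 0 ≤ ∫ x, ‖f x‖ ^ p ∂μ := integral_nonneg fun x => by positivity
  rw [Lp.norm_def, eLpNorm_ofReal_eq hp (Lp.memLp f), ENNReal.toReal_ofReal (by positivity),
    ← Real.rpow_mul h0, inv_mul_cancel₀ (by linarith), Real.rpow_one]

/-- An almost everywhere limit of a bounded sequence in `L^p` lies in `L^p`. -/
theorem Lp.exists_eq_of_tendsto_ae {p : ℝ≥0∞} {u : ℕ → Lp E p μ} {M : ℝ≥0}
    (hM : ∀ n, ‖u n‖ ≤ M) {g : α → E}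
    (hlim : ∀ᵐ x ∂μ, Tendsto (fun n => u n x) atTop (𝓝 (g x))) :
    ∃ w : Lp E p μ, w =ᵐ[μ] g ∧ ‖w‖ ≤ M := by
  have hgm : AEStronglyMeasurable g μ :=
    aestronglyMeasurable_of_tendsto_ae atTop (fun n => Lp.aestronglyMeasurable (u n)) hlim
  have hle : eLpNorm g p μ ≤ M := by
    refine (Lp.eLpNorm_lim_le_liminf_eLpNorm (fun n => Lp.aestronglyMeasurable (u n)) g hlim).trans
      (liminf_le_of_le (by isBoundedDefault) fun b hb => ?_)
    obtain ⟨n, hn⟩ := hb.exists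
    refine hn.trans ?_
    rw [← Lp.enorm_def]
    exact enorm_le_coe.2 (hM n)
  have hg : MemLp g p μ := ⟨hgm, hle.trans_lt ENNReal.coe_lt_top⟩
  refine ⟨hg.toLp g, hg.coeFn_toLp, ?_⟩
  rw [Lp.norm_toLp]
  exact ENNReal.toReal_le_of_le_ofReal M.2 (by simpa using hle)

theorem norm_add_rpow_le {p : ℝ} (hp : 1 ≤ p) (a b : E) :
    ‖a + b‖ ^ p ≤ 2 ^ (p - 1) * (‖a‖ ^ p + ‖b‖ ^ p) := by
  refine (Real.rpow_le_rpow (norm_nonneg _) (norm_add_le a b) (by linarith)).trans ?_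
  have := NNReal.rpow_add_le_mul_rpow_add_rpow ‖a‖₊ ‖b‖₊ hp
  exact_mod_cast this

theorem norm_sub_rpow_le {p : ℝ} (hp : 1 ≤ p) (a b : E) :
    ‖a - b‖ ^ p ≤ 2 ^ (p - 1) * (‖a‖ ^ p + ‖b‖ ^ p) := by
  simpa [sub_eq_add_neg] using norm_add_rpow_le hp a (-b)

/-- If `h_n → h` almost everywhere and `limsup |h_n|_p^p ≤ A`, then `limsup |h_n - h|_p^p` is at
most `2^{p-1} (A - |h|_p^p)`. -/
theorem eventually_integral_norm_sub_rpow_le {p : ℝ} (hp : 1 ≤ p) {u : ℕ → α → E} {v : α → E}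
    (hu : ∀ n, MemLp (u n) (ENNReal.ofReal p) μ) (hv : MemLp v (ENNReal.ofReal p) μ)
    (hlim : ∀ᵐ x ∂μ, Tendsto (fun n => u n x) atTop (𝓝 (v x))) {A : ℝ}
    (hA : ∀ᶠ n in atTop, ∫ x, ‖u n x‖ ^ p ∂μ ≤ A) {ε : ℝ} (hε : 0 < ε) :
    ∀ᶠ n in atTop, ∫ x, ‖u n x - v x‖ ^ p ∂μ ≤ 2 ^ (p - 1) * (A - ∫ x, ‖v x‖ ^ p ∂μ) + ε := by
  have hui n := MemLp.integrable_norm_rpow_ofReal hp (hu n)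
  have hvi := MemLp.integrable_norm_rpow_ofReal hp hv
  have hdi : ∀ n, Integrable (fun x => ‖u n x - v x‖ ^ p) μ := fun n =>
    MemLp.integrable_norm_rpow_ofReal hp ((hu n).sub hv)
  -- Fatou's lemma for the nonnegative functions `2^(p-1) (|u_n|^p + |v|^p) - |u_n - v|^p`, whose
  -- a.e. limit is `2^(p-1) · 2|v|^p`.
  have key := eventually_integral_sub_le_of_tendsto_ae (μ := μ)
    (f := fun n x => 2 ^ (p - 1) * (‖u n x‖ ^ p + ‖v x‖ ^ p) - ‖u n x - v x‖ ^ p)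
    (g := fun x => 2 ^ (p - 1) * (‖v x‖ ^ p + ‖v x‖ ^ p))
    (fun n => (((hui n).add hvi).const_mul _).sub (hdi n))
    (fun n => ae_of_all _ fun x => sub_nonneg.2 (norm_sub_rpow_le hp _ _))
    ((hvi.add hvi).const_mul _) ?_ hε
  · filter_upwards [key, hA] with n hn hAn
    have hs : ∫ x, (2 ^ (p - 1) * (‖u n x‖ ^ p + ‖v x‖ ^ p) - ‖u n x - v x‖ ^ p) ∂μ =
        2 ^ (p - 1) * (∫ x, ‖u n x‖ ^ p ∂μ + ∫ x, ‖v x‖ ^ p ∂μ) - ∫ x, ‖u n x - v x‖ ^ p ∂μ := by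
      rw [← integral_add (hui n) hvi, ← integral_const_mul, ← integral_sub _ (hdi n)]
      exact ((hui n).add hvi).const_mul _
    rw [integral_const_mul, integral_add hvi hvi, hs] at hn
    have : (2 : ℝ) ^ (p - 1) * ∫ x, ‖u n x‖ ^ p ∂μ ≤ 2 ^ (p - 1) * A := by gcongr
    linarith
  · filter_upwards [hlim] with x hx
    have h1 := (hx.norm.rpow_const (p := p) (Or.inr (by linarith)))
    have h2 := ((hx.sub_const (v x)).norm.rpow_const (p := p) (Or.inr (by linarith)))
    have h3 := ((h1.add_const (‖v x‖ ^ p)).const_mul ((2 : ℝ) ^ (p - 1))).sub h2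
    simpa [Real.zero_rpow (by linarith : p ≠ 0)] using h3

end MeasureLemmas

/-! ### Almost everywhere convergence and weak convergence in L^p -/

section WeakConvergence

variable {α : Type*} [MeasurableSpace α] {μ : Measure α} {E : Type*} [NormedAddCommGroup E]

/-- A crude form of the Brezis–Lieb lemma: the part of `|g + h_n|^p` exceeding `2^(p-1) |h_n|^p` is
dominated by `2^(p-1) |g|^p` and tends to `|g|^p`. What matters is that the increment allowed on the
right does not depend on `g`; the summand 1 absorbs the error of the limit. -/
theorem Lp.eventually_norm_add_rpow_le {p : ℝ} (hp : 1 ≤ p) [Fact (1 ≤ ENNReal.ofReal p)]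
    {h : ℕ → Lp E (ENNReal.ofReal p) μ}
    {M : ℝ} (hM : ∀ n, ‖h n‖ ≤ M) (hlim : ∀ᵐ x ∂μ, Tendsto (fun n => h n x) atTop (𝓝 0))
    (g : Lp E (ENNReal.ofReal p) μ) :
    ∀ᶠ n in atTop, ‖g + h n‖ ^ p ≤ ‖g‖ ^ p + (2 ^ (p - 1) * M ^ p + 1) := by
  have hgi := MemLp.integrable_norm_rpow_ofReal hp (Lp.memLp g)
  have hhi n := MemLp.integrable_norm_rpow_ofReal hp (Lp.memLp (h n))
  have hsi : ∀ n, Integrable (fun x => ‖g x + h n x‖ ^ p) μ := fun n =>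
    MemLp.integrable_norm_rpow_ofReal hp ((Lp.memLp g).add (Lp.memLp (h n)))
  set D : ℕ → α → ℝ := fun n x => max (‖g x + h n x‖ ^ p - 2 ^ (p - 1) * ‖h n x‖ ^ p) 0 with hD
  have hDi : ∀ n, Integrable (D n) μ := fun n =>
    ((hsi n).sub ((hhi n).const_mul _)).sup (integrable_zero _ _ _)
  have ht : Tendsto (fun n => ∫ x, D n x ∂μ) atTop (𝓝 (∫ x, ‖g x‖ ^ p ∂μ)) := by
    refine tendsto_integral_of_dominated_convergence (fun x => 2 ^ (p - 1) * ‖g x‖ ^ p)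
      (fun n => (hDi n).aestronglyMeasurable) (hgi.const_mul _) (fun n => ?_) ?_
    · refine ae_of_all _ fun x => ?_
      rw [Real.norm_of_nonneg (le_max_right _ _)]
      refine max_le ?_ (by positivity)
      have := norm_add_rpow_le hp (g x) (h n x)
      linarith
    · filter_upwards [hlim] with x hx
      have h1 := ((hx.const_add (g x)).norm.rpow_const (p := p) (Or.inr (by linarith)))
      have h2 := (hx.norm.rpow_const (p := p) (Or.inr (by linarith)))
      have h3 := (h1.sub (h2.const_mul ((2 : ℝ) ^ (p - 1)))).max (tendsto_const_nhds (x := (0 : ℝ)))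
      have h4 : max (‖g x‖ ^ p) 0 = ‖g x‖ ^ p := max_eq_left (by positivity)
      simpa [Real.zero_rpow (by linarith : p ≠ 0), h4] using h3
  filter_upwards [ht.eventually (gt_mem_nhds (lt_add_one _))] with n hn
  have h1 : ∫ x, ‖(g + h n) x‖ ^ p ∂μ ≤ ∫ x, (D n x + 2 ^ (p - 1) * ‖h n x‖ ^ p) ∂μ := by
    refine integral_mono_ae (MemLp.integrable_norm_rpow_ofReal hp (Lp.memLp (g + h n)))
      ((hDi n).add ((hhi n).const_mul _)) ?_
    filter_upwards [Lp.coeFn_add g (h n)] with x hx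
    have := le_max_left (‖g x + h n x‖ ^ p - 2 ^ (p - 1) * ‖h n x‖ ^ p) 0
    rw [hx, Pi.add_apply]
    simp only [hD]
    linarith
  rw [integral_add (hDi n) ((hhi n).const_mul _), integral_const_mul,
    ← Lp.norm_rpow_eq_integral hp, ← Lp.norm_rpow_eq_integral hp] at h1
  rw [← Lp.norm_rpow_eq_integral hp] at hn
  have h2 : (2 : ℝ) ^ (p - 1) * ‖h n‖ ^ p ≤ 2 ^ (p - 1) * M ^ p := by
    have := Real.rpow_le_rpow (norm_nonneg (h n)) (hM n) (by linarith : 0 ≤ p)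
    gcongr
  linarith

variable [NormedSpace ℝ E]

/-- A gliding hump argument, which needs no description of the dual of L^p. If `|ℓ (h n)| ≥ δ`
infinitely often, then suitably signed sums S of m terms, each chosen late enough relative to the
preceding sum, satisfy `ℓ S ≥ m δ` but `‖S‖^p ≤ m C`. Hence `m^(p-1)` is bounded in m, which is
absurd for p > 1. -/
theorem Lp.tendsto_apply_zero_of_tendsto_ae {p : ℝ} (hp : 1 < p) [Fact (1 ≤ ENNReal.ofReal p)]
    {h : ℕ → Lp E (ENNReal.ofReal p) μ} {M : ℝ} (hM : ∀ n, ‖h n‖ ≤ M)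
    (hlim : ∀ᵐ x ∂μ, Tendsto (fun n => h n x) atTop (𝓝 0))
    (ℓ : Lp E (ENNReal.ofReal p) μ →L[ℝ] ℝ) :
    Tendsto (fun n => ℓ (h n)) atTop (𝓝 0) := by
  by_contra hcon
  have hfreq : ∃ δ > 0, ∃ᶠ n in atTop, δ ≤ |ℓ (h n)| := by
    rw [Metric.tendsto_nhds] at hcon
    push Not at hcon
    obtain ⟨δ, hδ, hf⟩ := hcon
    refine ⟨δ, hδ, hf.mono fun n hn => ?_⟩
    simpa [Real.dist_eq] using hn
  obtain ⟨δ, hδ, hf⟩ := hfreq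
  -- The signs make all contributions `ℓ (k n) = |ℓ (h n)|` add up without cancellation.
  set σ : ℕ → ℝ := fun n => SignType.sign (ℓ (h n)) with hσ
  have hσ1 : ∀ n, |σ n| ≤ 1 := fun n => by
    simp only [hσ]
    rcases SignType.trichotomy (SignType.sign (ℓ (h n))) with h | h | h <;> simp [h]
  set k : ℕ → Lp E (ENNReal.ofReal p) μ := fun n => σ n • h n with hk
  have hkM : ∀ n, ‖k n‖ ≤ M := fun n => by
    rw [hk, norm_smul, Real.norm_eq_abs]
    exact (mul_le_of_le_one_left (norm_nonneg _) (hσ1 n)).trans (hM n)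
  have hkl : ∀ n, ℓ (k n) = |ℓ (h n)| := fun n => by
    simp only [hk, map_smul, smul_eq_mul, hσ, sign_mul_self]
  have hklim : ∀ᵐ x ∂μ, Tendsto (fun n => k n x) atTop (𝓝 0) := by
    filter_upwards [hlim, ae_all_iff.2 fun n => Lp.coeFn_smul (σ n) (h n)] with x hx hs
    rw [tendsto_zero_iff_norm_tendsto_zero] at hx ⊢
    refine squeeze_zero (fun n => norm_nonneg _) (fun n => ?_) hx
    simp only [hk]
    rw [hs n, Pi.smul_apply, norm_smul, Real.norm_eq_abs]
    exact mul_le_of_le_one_left (norm_nonneg _) (hσ1 n)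
  have hM0 : 0 ≤ M := (norm_nonneg _).trans (hM 0)
  set C : ℝ := 2 ^ (p - 1) * M ^ p + 1 with hC
  have hC0 : 0 < C := by positivity
  have key : ∀ m : ℕ, ∃ S : Lp E (ENNReal.ofReal p) μ, ‖S‖ ^ p ≤ m * C ∧ m * δ ≤ ℓ S := by
    intro m
    induction m with
    | zero => exact ⟨0, by simp [Real.zero_rpow (by linarith : p ≠ 0)], by simp⟩
    | succ m ih =>
      obtain ⟨S, hS1, hS2⟩ := ih
      obtain ⟨n, hn1, hn2⟩ :=
        (hf.and_eventually (Lp.eventually_norm_add_rpow_le hp.le hkM hklim S)).exists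
      refine ⟨S + k n, ?_, ?_⟩
      · push_cast
        linarith
      · rw [map_add, hkl]
        push_cast
        linarith
  have hbd : ∀ m : ℕ, 0 < m → (m : ℝ) ^ (p - 1) ≤ ‖ℓ‖ ^ p * C / δ ^ p := by
    intro m hm
    obtain ⟨S, hS1, hS2⟩ := key m
    have hm' : (0 : ℝ) < m := by exact_mod_cast hm
    have h1 : m * δ ≤ ‖ℓ‖ * ‖S‖ := hS2.trans ((le_abs_self _).trans (ℓ.le_opNorm S))
    have h2 : (m * δ) ^ p ≤ (‖ℓ‖ * ‖S‖) ^ p :=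
      Real.rpow_le_rpow (by positivity) h1 (by linarith)
    rw [Real.mul_rpow hm'.le hδ.le, Real.mul_rpow (norm_nonneg _) (norm_nonneg _)] at h2
    have h3 : ‖ℓ‖ ^ p * ‖S‖ ^ p ≤ ‖ℓ‖ ^ p * (m * C) := by gcongr
    rw [le_div_iff₀ (by positivity)]
    have h4 : (m : ℝ) ^ p = m ^ (p - 1) * m := by
      rw [← Real.rpow_add_one hm'.ne']; ring_nf
    rw [h4] at h2
    refine le_of_mul_le_mul_right ?_ hm'
    nlinarith
  have htop := (tendsto_rpow_atTop (by linarith : 0 < p - 1)).comp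
    (tendsto_natCast_atTop_atTop (R := ℝ))
  obtain ⟨m, hm1, hm2⟩ := ((htop.eventually_gt_atTop (‖ℓ‖ ^ p * C / δ ^ p)).and
    (eventually_gt_atTop 0)).exists
  exact absurd (hbd m hm2) (not_le.2 hm1)

/-- A bounded sequence in `L^p`, `p > 1`, which converges almost everywhere converges weakly. -/
theorem Lp.tendsto_apply_of_tendsto_ae {p : ℝ} (hp : 1 < p) [Fact (1 ≤ ENNReal.ofReal p)]
    {u : ℕ → Lp E (ENNReal.ofReal p) μ} {u₀ : Lp E (ENNReal.ofReal p) μ} {M : ℝ}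
    (hM : ∀ n, ‖u n‖ ≤ M) (hlim : ∀ᵐ x ∂μ, Tendsto (fun n => u n x) atTop (𝓝 (u₀ x)))
    (ℓ : Lp E (ENNReal.ofReal p) μ →L[ℝ] ℝ) :
    Tendsto (fun n => ℓ (u n)) atTop (𝓝 (ℓ u₀)) := by
  have := Lp.tendsto_apply_zero_of_tendsto_ae hp (h := fun n => u n - u₀) (M := M + ‖u₀‖)
    (fun n => (norm_sub_le _ _).trans (by gcongr; exact hM n)) ?_ ℓ
  · simpa using this.add_const (ℓ u₀)
  · filter_upwards [hlim, ae_all_iff.2 fun n => Lp.coeFn_sub (u n) u₀] with x hx hs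
    simp only [hs, Pi.sub_apply]
    simpa using hx.sub_const (u₀ x)

/-- A closed subspace of `L^p`, `p > 1`, is closed under almost everywhere limits of bounded
sequences. -/
theorem Lp.mem_of_tendsto_ae {p : ℝ} (hp : 1 < p) [Fact (1 ≤ ENNReal.ofReal p)]
    {S : Submodule ℝ (Lp E (ENNReal.ofReal p) μ)}
    (hS : IsClosed (S : Set (Lp E (ENNReal.ofReal p) μ)))
    {u : ℕ → Lp E (ENNReal.ofReal p) μ} {u₀ : Lp E (ENNReal.ofReal p) μ} {M : ℝ}
    (hM : ∀ n, ‖u n‖ ≤ M) (hlim : ∀ᵐ x ∂μ, Tendsto (fun n => u n x) atTop (𝓝 (u₀ x)))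
    (hu : ∀ n, u n ∈ S) : u₀ ∈ S := by
  by_contra hcon
  obtain ⟨f, c, hf1, hf2⟩ := geometric_hahn_banach_closed_point S.convex hS hcon
  have hf0 : ∀ w ∈ S, f w = 0 := by
    intro w hw
    by_contra hne
    -- The multiple is chosen so that `f` takes the value `c` on it, against the strict bound `f <
    -- c` on `S`.
    have h1 := hf1 ((c / f w) • w) (S.smul_mem _ hw)
    rw [map_smul, smul_eq_mul, div_mul_cancel₀ _ hne] at h1
    exact lt_irrefl _ h1
  have h0 := hf1 0 S.zero_mem
  rw [map_zero] at h0
  have := Lp.tendsto_apply_of_tendsto_ae hp hM hlim f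
  simp only [hf0 _ (hu _)] at this
  have := tendsto_nhds_unique this tendsto_const_nhds
  linarith

end WeakConvergence

/-! ### Subsequences of sequences that are Cauchy in measure -/

section CauchyInMeasure

variable {α : Type*} [MeasurableSpace α] {μ : Measure α} {E : Type*} [NormedAddCommGroup E]
  [CompleteSpace E]

/-- A sequence which is Cauchy in measure on each of the sets `A i` has a subsequence which
converges almost everywhere on each of them. -/
theorem exists_seq_tendsto_ae_of_cauchy_in_measure {A : ℕ → Set α} {f : ℕ → α → E}
    (h : ∀ i, ∀ ε > 0, ∃ n₀, ∀ n ≥ n₀, ∀ m ≥ n₀,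
      μ (A i ∩ {x | ε ≤ dist (f n x) (f m x)}) ≤ ENNReal.ofReal ε) :
    ∃ s : ℕ → ℕ, StrictMono s ∧
      ∀ᵐ x ∂μ, ∀ i, x ∈ A i → ∃ y, Tendsto (fun n => f (s n) x) atTop (𝓝 y) := by
  have hP : ∀ j : ℕ, ∀ᶠ k in atTop, ∀ i ≤ j, ∀ n ≥ k,
      μ (A i ∩ {x | (1 / 2 : ℝ) ^ j ≤ dist (f k x) (f n x)}) ≤ ENNReal.ofReal ((1 / 2) ^ j) := by
    intro j
    refine (Set.finite_Iic j).eventually_all.2 fun i _ => ?_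
    obtain ⟨n₀, hn₀⟩ := h i ((1 / 2) ^ j) (by positivity)
    filter_upwards [eventually_ge_atTop n₀] with k hk n hn
    exact hn₀ k hk n (hk.trans hn)
  obtain ⟨s, hs, hsP⟩ := extraction_forall_of_eventually hP
  refine ⟨s, hs, ?_⟩
  rw [ae_all_iff]
  intro i
  -- The index is shifted by `i` because the choice of `s j` controls only the sets `A i` with `i ≤
  -- j`. The measures of the `B j` are summable, so Borel–Cantelli leaves a geometric bound on
  -- consecutive distances.
  set B : ℕ → Set α := fun j =>
    A i ∩ {x | (1 / 2 : ℝ) ^ (j + i) ≤ dist (f (s (j + i)) x) (f (s (j + i + 1)) x)} with hB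
  have hBs : ∑' j, μ (B j) ≠ ⊤ := by
    refine ne_top_of_le_ne_top ?_ (ENNReal.tsum_le_tsum fun j =>
      (hsP (j + i) i (by lia) _ (hs.monotone (Nat.le_succ _))).trans
        (ENNReal.ofReal_le_ofReal (pow_le_pow_of_le_one (by norm_num) (by norm_num)
          (Nat.le_add_right j i))))
    rw [← ENNReal.ofReal_tsum_of_nonneg (fun n => by positivity)
      (summable_geometric_of_lt_one (by norm_num) (by norm_num))]
    exact ENNReal.ofReal_ne_top
  filter_upwards [ae_eventually_notMem hBs] with x hx hxA
  obtain ⟨j₀, hj₀⟩ := eventually_atTop.1 hx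
  have hd : ∀ j, dist (f (s (j + (j₀ + i))) x) (f (s (j + 1 + (j₀ + i))) x) ≤ 1 * (1 / 2) ^ j := by
    intro j
    have h1 := hj₀ (j + j₀) (by lia)
    simp only [hB, Set.mem_inter_iff, hxA, true_and, Set.mem_ofPred_eq, not_le] at h1
    rw [one_mul]
    have e1 : j + (j₀ + i) = j + j₀ + i := by ring
    have e2 : j + 1 + (j₀ + i) = j + j₀ + i + 1 := by ring
    rw [e1, e2]
    exact h1.le.trans (pow_le_pow_of_le_one (by norm_num) (by norm_num) (by lia))
  obtain ⟨y, hy⟩ := cauchySeq_tendsto_of_complete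
    (cauchySeq_of_le_geometric (1 / 2) 1 (by norm_num) hd)
  exact ⟨y, (tendsto_add_atTop_iff_nat (f := fun n => f (s n) x) (j₀ + i)).1 hy⟩

end CauchyInMeasure

/-! ### Measurability of superpositions -/

section Caratheodory

variable {α : Type*} [MeasurableSpace α] {μ : Measure α}

/-- Superposition of a Carathéodory function with a measurable function is measurable. -/
theorem AEMeasurable.comp_of_caratheodory {E G : Type*} [NormedAddCommGroup E]
    [MeasurableSpace E] [BorelSpace E]
    [NormedAddCommGroup G] [MeasurableSpace G] [BorelSpace G] {g : α → E → G}
    (hg : ∀ u, AEMeasurable (fun x => g x u) μ) (hc : ∀ᵐ x ∂μ, Continuous (g x))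
    {u : α → E} (hu : AEStronglyMeasurable u μ) : AEMeasurable (fun x => g x (u x)) μ := by
  have hsimple : ∀ s : SimpleFunc α E, AEMeasurable (fun x => g x (s x)) μ := by
    intro s
    have hcov : (⋃ v : s.range, s ⁻¹' {(v : E)}) = Set.univ := by
      refine Set.eq_univ_of_forall fun x => Set.mem_iUnion.2 ⟨⟨s x, s.mem_range_self x⟩, rfl⟩
    rw [← Measure.restrict_univ (μ := μ), ← hcov, aemeasurable_iUnion_iff]
    intro v
    refine ((hg v).restrict (s := s ⁻¹' {(v : E)})).congr ?_
    filter_upwards [ae_restrict_mem (s.measurableSet_fiber v)] with x hx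
    rw [Set.mem_preimage, Set.mem_singleton_iff] at hx
    rw [hx]
  obtain ⟨u', hu', he⟩ := hu
  have hlim : AEMeasurable (fun x => g x (u' x)) μ := by
    refine aemeasurable_of_tendsto_metrizable_ae atTop (fun n => hsimple (hu'.approx n)) ?_
    filter_upwards [hc] with x hx
    exact (hx.tendsto _).comp (hu'.tendsto_approx x)
  refine hlim.congr ?_
  filter_upwards [he] with x hx
  rw [hx]

/-- A function with measurable gradient is itself a Carathéodory function, and so its
superposition with a measurable function is measurable. -/
theorem aestronglyMeasurable_comp_of_gradient [SFinite μ] {E : Type*} [NormedAddCommGroup E]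
    [InnerProductSpace ℝ E] [CompleteSpace E] [MeasurableSpace E] [BorelSpace E]
    [SecondCountableTopology E] {F : α → E → ℝ}
    (hd : ∀ᵐ x ∂μ, Differentiable ℝ (F x)) (h0 : ∀ᵐ x ∂μ, F x 0 = 0)
    (hm : ∀ u, AEMeasurable (fun x => gradient (F x) u) μ)
    (hc : ∀ᵐ x ∂μ, Continuous (gradient (F x)))
    {u : α → E} (hu : AEStronglyMeasurable u μ) :
    AEStronglyMeasurable (fun x => F x (u x)) μ := by
  -- Since F(x,0) = 0, F(x,u) is the integral over t in (0,1] of ⟨∂_uF(x,tu), u⟩. The integrand is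
  -- jointly measurable in (x,t), hence the integral is measurable in x.
  set ν : Measure ℝ := volume.restrict (Set.Ioc 0 1)
  have hq : Measure.QuasiMeasurePreserving (Prod.fst : α × ℝ → α) (μ.prod ν) μ :=
    Measure.quasiMeasurePreserving_fst
  have hu1 : AEStronglyMeasurable (fun z : α × ℝ => u z.1) (μ.prod ν) :=
    hu.comp_quasiMeasurePreserving hq
  have hu2 : AEStronglyMeasurable (fun z : α × ℝ => z.2 • u z.1) (μ.prod ν) :=
    measurable_snd.aestronglyMeasurable.smul hu1
  have h1 : AEMeasurable (fun z : α × ℝ => gradient (F z.1) (z.2 • u z.1)) (μ.prod ν) := by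
    refine AEMeasurable.comp_of_caratheodory (g := fun z : α × ℝ => gradient (F z.1))
      (fun v => (hm v).comp_quasiMeasurePreserving hq) (hq.ae hc) hu2
  have h2 : AEStronglyMeasurable
      (fun z : α × ℝ => inner ℝ (gradient (F z.1) (z.2 • u z.1)) (u z.1)) (μ.prod ν) :=
    h1.aestronglyMeasurable.inner hu1
  refine h2.integral_prod_right'.congr ?_
  filter_upwards [hd, h0, hc] with x hdx h0x hcx
  have hder : ∀ t : ℝ, HasDerivAt (fun t : ℝ => F x (t • u x))
      (inner ℝ (gradient (F x) (t • u x)) (u x)) t := by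
    intro t
    have hf := (hdx (t • u x)).hasGradientAt.hasFDerivAt
    have hs : HasDerivAt (fun t : ℝ => t • u x) (u x) t := by
      simpa using (hasDerivAt_id t).smul_const (u x)
    have := hf.comp_hasDerivAt t hs
    simpa [Function.comp_def] using this
  have hcont : Continuous fun t : ℝ => inner ℝ (gradient (F x) (t • u x)) (u x) :=
    (hcx.comp (continuous_id.smul continuous_const)).inner continuous_const
  have := intervalIntegral.integral_eq_sub_of_hasDerivAt (a := 0) (b := 1)
    (fun t _ => hder t) (hcont.intervalIntegrable 0 1)
  rw [intervalIntegral.integral_of_le zero_le_one] at this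
  simpa [h0x] using this

end Caratheodory

/-! ### Convexity from strict midpoint convexity -/

section Convexity

/-- A continuous function which is strictly convex at midpoints is convex. -/
theorem convexOn_univ_of_continuous_of_midpoint_lt {E : Type*} [NormedAddCommGroup E]
    [NormedSpace ℝ E] {f : E → ℝ} (hf : Continuous f)
    (h : ∀ u v, u ≠ v → f ((1 / 2 : ℝ) • (u + v)) < (1 / 2 : ℝ) * (f u + f v)) :
    ConvexOn ℝ Set.univ f := by
  refine ⟨convex_univ, fun u _ v _ a b ha hb hab => ?_⟩
  rcases eq_or_ne u v with rfl | huv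
  · rw [← add_smul, ← add_smul, hab, one_smul, one_smul]
  set γ : ℝ → E := fun t => u + t • (v - u) with hγ
  have hγc : Continuous γ := by fun_prop
  -- The difference of `f` and its chord. At an interior positive maximum `t`, the points `t - s`
  -- and `t + s` have smaller or equal values, which contradicts strict midpoint convexity at their
  -- midpoint `t`.
  set k : ℝ → ℝ := fun t => f (γ t) - ((1 - t) * f u + t * f v) with hk
  have hkc : Continuous k := by fun_prop
  obtain ⟨t, ht, hmax⟩ := isCompact_Icc.exists_isMaxOn (Set.nonempty_Icc.2 zero_le_one)
    (hkc.continuousOn (s := Set.Icc (0 : ℝ) 1))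
  have hbI : b ∈ Set.Icc (0 : ℝ) 1 := ⟨hb, by linarith⟩
  have hk0 : k 0 = 0 := by simp [hk, hγ]
  have hk1 : k 1 = 0 := by simp [hk, hγ]
  have hle : k b ≤ 0 := by
    by_contra! hpos
    have hkt : 0 < k t := hpos.trans_le (hmax hbI)
    have ht0 : 0 < t := lt_of_le_of_ne ht.1 fun h => by rw [← h, hk0] at hkt; exact lt_irrefl _ hkt
    have ht1 : t < 1 := lt_of_le_of_ne ht.2 fun h => by rw [h, hk1] at hkt; exact lt_irrefl _ hkt
    set s := min t (1 - t) with hs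
    have hs0 : 0 < s := lt_min ht0 (by linarith)
    have hs1 : s ≤ t := min_le_left _ _
    have hs2 : s ≤ 1 - t := min_le_right _ _
    have hm1 : k (t - s) ≤ k t := hmax ⟨by linarith, by linarith⟩
    have hm2 : k (t + s) ≤ k t := hmax ⟨by linarith, by linarith⟩
    have hne : γ (t - s) ≠ γ (t + s) := by
      simp only [hγ, ne_eq, add_right_inj]
      intro he
      have h2 : (2 * s) • (v - u) = 0 := by
        rw [← sub_eq_zero, ← sub_smul] at he
        have : t - s - (t + s) = -(2 * s) := by ring
        rwa [this, neg_smul, neg_eq_zero] at he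
      rcases smul_eq_zero.1 h2 with h3 | h3
      · linarith
      · exact huv (sub_eq_zero.1 h3).symm
    have hmid : (1 / 2 : ℝ) • (γ (t - s) + γ (t + s)) = γ t := by
      simp only [hγ]
      module
    have := h _ _ hne
    rw [hmid] at this
    simp only [hk] at hm1 hm2
    linarith
  have hγb : γ b = a • u + b • v := by
    simp only [hγ]
    have : a = 1 - b := eq_sub_of_add_eq hab
    rw [this]
    module
  simp only [hk, hγb] at hle
  have : a = 1 - b := eq_sub_of_add_eq hab
  simp only [smul_eq_mul]
  rw [← this] at hle
  linarith

end Convexity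

/-! ### Growth and structural properties of the integrand -/

section Growth

/-- With T = max(B, s) the bracket is at most (1 + c) T^(p-1), and Young's inequality for T^(p-1) r
follows by comparing r with δT. In the application B^(p-2) is the coefficient a(x), so that B^p =
a^(N/2) is integrable. -/
theorem mul_growth_le {p c B s r δ : ℝ} (hp : 2 < p) (hc : 0 ≤ c) (hB : 0 ≤ B) (hs : 0 ≤ s)
    (hr : 0 ≤ r) (hδ : 0 < δ) :
    (B ^ (p - 2) * s + c * s ^ (p - 1)) * r ≤
      (1 + c) * (δ * (B ^ p + s ^ p) + δ ^ (1 - p) * r ^ p) := by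
  set T := max B s with hT
  have hT0 : 0 ≤ T := le_max_of_le_left hB
  have hTp : T ^ p ≤ B ^ p + s ^ p := by
    have h1 : 0 ≤ B ^ p := by positivity
    have h2 : 0 ≤ s ^ p := by positivity
    rcases max_choice B s with h | h <;> rw [hT, h] <;> linarith
  have hX : B ^ (p - 2) * s + c * s ^ (p - 1) ≤ (1 + c) * T ^ (p - 1) := by
    have h1 : B ^ (p - 2) ≤ T ^ (p - 2) :=
      Real.rpow_le_rpow hB (le_max_left _ _) (by linarith)
    have h2 : s ≤ T := le_max_right _ _
    have h3 : s ^ (p - 1) ≤ T ^ (p - 1) := Real.rpow_le_rpow hs h2 (by linarith)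
    have h4 : T ^ (p - 2) * T = T ^ (p - 1) := by
      rcases hT0.eq_or_lt with h | h
      · rw [← h, Real.zero_rpow (by linarith), Real.zero_rpow (by linarith), zero_mul]
      · rw [← Real.rpow_add_one h.ne']; ring_nf
    calc B ^ (p - 2) * s + c * s ^ (p - 1) ≤ T ^ (p - 2) * T + c * T ^ (p - 1) := by gcongr
      _ = (1 + c) * T ^ (p - 1) := by rw [h4]; ring
  have hYoung : T ^ (p - 1) * r ≤ δ * T ^ p + δ ^ (1 - p) * r ^ p := by
    have e1 : 0 ≤ δ ^ (1 - p) * r ^ p := by positivity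
    have e2 : 0 ≤ δ * T ^ p := by positivity
    rcases hT0.eq_or_lt with h | h
    · rw [← h, Real.zero_rpow (by linarith), zero_mul, Real.zero_rpow (by linarith)]
      linarith
    rcases le_total r (δ * T) with h' | h'
    · have h4 : T ^ (p - 1) * T = T ^ p := by rw [← Real.rpow_add_one h.ne']; ring_nf
      calc T ^ (p - 1) * r ≤ T ^ (p - 1) * (δ * T) := by gcongr
        _ = δ * T ^ p := by rw [← h4]; ring
        _ ≤ _ := by linarith
    · have hr0 : 0 < r := (by positivity : 0 < δ * T).trans_le h'
      have hTr : T ≤ r / δ := by rw [le_div_iff₀ hδ]; linarith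
      have h4 : r ^ (p - 1) * r = r ^ p := by rw [← Real.rpow_add_one hr0.ne']; ring_nf
      calc T ^ (p - 1) * r ≤ (r / δ) ^ (p - 1) * r := by
            gcongr
            linarith
        _ = δ ^ (1 - p) * r ^ p := by
            rw [Real.div_rpow hr hδ.le, ← h4, show (1 - p) = -(p - 1) by ring,
              Real.rpow_neg hδ.le]
            field_simp
        _ ≤ _ := by linarith
  calc (B ^ (p - 2) * s + c * s ^ (p - 1)) * r ≤ (1 + c) * T ^ (p - 1) * r := by gcongr
    _ = (1 + c) * (T ^ (p - 1) * r) := by ring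
    _ ≤ (1 + c) * (δ * T ^ p + δ ^ (1 - p) * r ^ p) := by gcongr
    _ ≤ _ := by gcongr

end Growth

/-- The properties of the integrand `F` on which the minimisation of `∫ F(x, u(x)) dx` in `L^p`
depends: it is a convex Carathéodory function, bounded from below by `c |u|^p`, uniformly strictly
convex, and its increments are controlled by `ε (b + |u|^p) + C_ε |r|^p` with `b ∈ L¹`. -/
structure UniformlyConvexIntegrand {α : Type*} [MeasurableSpace α] (μ : Measure α) {E : Type*}
    [NormedAddCommGroup E] [NormedSpace ℝ E] (p : ℝ) (F : α → E → ℝ) (b : α → ℝ) (c : ℝ) :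
    Prop where
  aestronglyMeasurable_comp : ∀ u : α → E, AEStronglyMeasurable u μ →
    AEStronglyMeasurable (fun x => F x (u x)) μ
  integrable_bound : Integrable b μ
  bound_nonneg : ∀ x, 0 ≤ b x
  coercive_pos : 0 < c
  coercive : ∀ᵐ x ∂μ, ∀ u, c * ‖u‖ ^ p ≤ F x u
  zero : ∀ᵐ x ∂μ, F x 0 = 0
  abs_sub_le : ∀ ε > 0, ∃ C, 0 ≤ C ∧ ∀ᵐ x ∂μ, ∀ u r,
    |F x (u + r) - F x u| ≤ ε * (b x + ‖u‖ ^ p) + C * ‖r‖ ^ p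
  continuous : ∀ᵐ x ∂μ, Continuous (F x)
  convex : ∀ᵐ x ∂μ, ConvexOn ℝ Set.univ (F x)
  gap : ∀ R τ, 0 < τ → ∃ m > 0, ∀ᵐ x ∂μ, ∀ u v : E, ‖u‖ ≤ R → ‖v‖ ≤ R → τ ≤ ‖u - v‖ →
    m ≤ (1 / 2 : ℝ) * (F x u + F x v) - F x ((1 / 2 : ℝ) • (u + v))

theorem critExp_gt_two (N : ℕ) [hN : Fact (3 ≤ N)] : 2 < critExp N := by
  have h : (3 : ℝ) ≤ N := by exact_mod_cast hN.out
  rw [critExp, lt_div_iff₀ (by linarith)]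
  linarith

/-- The increment bound is the mean value inequality on the ball of radius |u| + |r| combined with
the growth of f; the exponent N/2 of a is exactly what makes the bound integrable. Convexity uses
(F2) for single pairs, and the gap uses it for the compact set of pairs in a ball whose distance is
at least τ. -/
theorem exists_uniformlyConvexIntegrand {N : ℕ} [hN : Fact (3 ≤ N)] {Ω : Set (Vec N)}
    (hΩ : MeasurableSet Ω) {F : Vec N → Vec N → ℝ} (hF1 : CondF1 Ω F) (hF2 : CondF2 Ω F)
    (hF3 : CondF3 Ω F) :
    ∃ b c, UniformlyConvexIntegrand (volume.restrict Ω) (critExp N) F b c := by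
  obtain ⟨c₁, c₂, hc₁, hc₂, a, ha, ha0, hF⟩ := hF3
  have hNR : (3 : ℝ) ≤ N := by exact_mod_cast hN.out
  have hp := critExp_gt_two N
  set p := critExp N with hpdef
  -- The identity p/(p - 2) = N/2, which ties the integrability of a to the critical exponent.
  have hexp : (N : ℝ) / 2 * p⁻¹ * (p - 2) = 1 := by
    have : (N : ℝ) - 2 ≠ 0 := by linarith
    rw [hpdef, critExp]
    field_simp
    ring
  refine ⟨fun x => ‖a x‖ ^ ((N : ℝ) / 2), c₁, ?_⟩
  refine
    { aestronglyMeasurable_comp := fun u hu => aestronglyMeasurable_comp_of_gradient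
        hF1.differentiable hF1.zero hF1.measurable hF1.continuous hu
      integrable_bound := MemLp.integrable_norm_rpow_ofReal (by linarith) ha
      bound_nonneg := fun x => by positivity
      coercive_pos := hc₁
      coercive := hF.mono fun x hx u => (hx u).1
      zero := hF1.zero
      continuous := hF1.differentiable.mono fun x hx => hx.continuous
      abs_sub_le := ?_
      convex := ?_
      gap := ?_ }
  · intro ε hε
    set K : ℝ := 2 ^ (p - 1) with hK
    have hK1 : 1 ≤ K := Real.one_le_rpow one_le_two (by linarith)
    -- Chosen so that `(1 + c₂) * δ * K = ε`, where `K` is the constant from splitting `(‖u‖ +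
    -- ‖r‖)^p`.
    set δ := ε / ((1 + c₂) * K) with hδ
    have hδ0 : 0 < δ := by positivity
    have hδε : (1 + c₂) * δ * K = ε := by rw [hδ]; field_simp
    refine ⟨(1 + c₂) * (δ * K + δ ^ (1 - p)), by positivity, ?_⟩
    filter_upwards [hF, hF1.differentiable, ha0] with x hx hdx hax u r
    set s := ‖u‖ + ‖r‖ with hs
    have hs0 : 0 ≤ s := by positivity
    set B := (‖a x‖ ^ ((N : ℝ) / 2)) ^ p⁻¹ with hB
    have hBp : B ^ p = ‖a x‖ ^ ((N : ℝ) / 2) := by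
      rw [hB, ← Real.rpow_mul (by positivity), inv_mul_cancel₀ (by linarith), Real.rpow_one]
    have hBa : B ^ (p - 2) = a x := by
      rw [hB, ← Real.rpow_mul (by positivity), ← Real.rpow_mul (by positivity), ← mul_assoc, hexp,
        Real.rpow_one, Real.norm_of_nonneg hax]
    have hmv : |F x (u + r) - F x u| ≤ (B ^ (p - 2) * s + c₂ * s ^ (p - 1)) * ‖r‖ := by
      have := (convex_closedBall (0 : Vec N) s).norm_image_sub_le_of_norm_fderiv_le (𝕜 := ℝ)
        (f := F x) (C := B ^ (p - 2) * s + c₂ * s ^ (p - 1)) (x := u) (y := u + r)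
        (fun y _ => hdx y) (fun y hy => ?_) ?_ ?_
      · simpa using this
      · have hy' : ‖y‖ ≤ s := by simpa using hy
        have h1 := (hx y).2
        have h2 : ‖uGrad F x y‖ = ‖fderiv ℝ (F x) y‖ := by
          simp [uGrad, gradient]
        rw [← h2, hBa]
        refine h1.trans ?_
        gcongr
        linarith
      · simp [hs]
      · simpa [hs] using norm_add_le u r
    have h1 := mul_growth_le hp hc₂.le (by positivity : 0 ≤ B) hs0 (norm_nonneg r) hδ0
    have h2 : s ^ p ≤ K * (‖u‖ ^ p + ‖r‖ ^ p) := by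
      have := NNReal.rpow_add_le_mul_rpow_add_rpow ‖u‖₊ ‖r‖₊ (by linarith : 1 ≤ p)
      exact_mod_cast this
    have h3 : (1 + c₂) * (δ * (B ^ p + s ^ p) + δ ^ (1 - p) * ‖r‖ ^ p) ≤
        (1 + c₂) * (δ * (K * B ^ p + K * (‖u‖ ^ p + ‖r‖ ^ p)) + δ ^ (1 - p) * ‖r‖ ^ p) := by
      have : B ^ p ≤ K * B ^ p := le_mul_of_one_le_left (by positivity) hK1
      gcongr
    refine hmv.trans (h1.trans (h3.trans (le_of_eq ?_)))
    rw [hBp, ← hδε]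
    ring
  · filter_upwards [hF1.differentiable, ae_restrict_mem hΩ] with x hdx hxΩ
    refine convexOn_univ_of_continuous_of_midpoint_lt hdx.continuous fun u v huv => ?_
    obtain ⟨m, hm, hgap⟩ := hF2 {(u, v)} isCompact_singleton (by
      rintro w hw
      simp only [Set.mem_singleton_iff, Prod.mk.injEq] at hw
      exact huv (hw.1.symm.trans hw.2))
    have := hgap x hxΩ u v rfl
    linarith
  · intro R τ hτ
    set A : Set (Vec N × Vec N) :=
      (Metric.closedBall 0 R ×ˢ Metric.closedBall 0 R) ∩ {z | τ ≤ ‖z.1 - z.2‖} with hA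
    have hAc : IsCompact A :=
      ((isCompact_closedBall _ _).prod (isCompact_closedBall _ _)).inter_right
        (isClosed_le continuous_const (by fun_prop))
    obtain ⟨m, hm, hgap⟩ := hF2 A hAc (by
      rintro u ⟨-, hu⟩
      simp only [Set.mem_ofPred_eq, sub_self, norm_zero] at hu
      linarith)
    refine ⟨m, hm, ?_⟩
    filter_upwards [ae_restrict_mem hΩ] with x hxΩ u v hu hv huv
    exact hgap x hxΩ u v ⟨⟨by simpa using hu, by simpa using hv⟩, huv⟩

/-- The gap in the midpoint convexity inequality. -/
noncomputable def midpointGap {α E : Type*} [AddCommGroup E] [Module ℝ E] (F : α → E → ℝ) (x : α) (u v : E) : ℝ :=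
  (1 / 2 : ℝ) * (F x u + F x v) - F x ((1 / 2 : ℝ) • (u + v))

theorem measure_ge_le_ofReal_integral_div {α : Type*} [MeasurableSpace α] {μ : Measure α}
    {f : α → ℝ} (hf : Integrable f μ) (hf0 : ∀ᵐ x ∂μ, 0 ≤ f x) {t : ℝ} (ht : 0 < t) :
    μ {x | t ≤ f x} ≤ ENNReal.ofReal ((∫ x, f x ∂μ) / t) := by
  have h1 := mul_meas_ge_le_lintegral₀ (μ := μ) (hf.aemeasurable.ennreal_ofReal) (ENNReal.ofReal t)
  rw [← ofReal_integral_eq_lintegral_ofReal hf hf0] at h1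
  rw [ENNReal.ofReal_div_of_pos ht, ENNReal.le_div_iff_mul_le (Or.inl (by simpa using ht))
    (Or.inl ENNReal.ofReal_ne_top), mul_comm]
  refine le_trans ?_ h1
  gcongr with x
  exact ENNReal.ofReal_le_ofReal

theorem Lp.exists_tendsto_ae {α E : Type*} [MeasurableSpace α] {μ : Measure α}
    [NormedAddCommGroup E] {p : ℝ≥0∞} {u : ℕ → Lp E p μ} {M : ℝ≥0}
    (hM : ∀ n, ‖u n‖ ≤ M) (hlim : ∀ᵐ x ∂μ, ∃ y, Tendsto (fun n => u n x) atTop (𝓝 y)) :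
    ∃ w : Lp E p μ, ‖w‖ ≤ M ∧ ∀ᵐ x ∂μ, Tendsto (fun n => u n x) atTop (𝓝 (w x)) := by
  classical
  set g : α → E := fun x => if hx : ∃ y, Tendsto (fun n => u n x) atTop (𝓝 y)
    then hx.choose else 0 with hgdef
  have hglim : ∀ᵐ x ∂μ, Tendsto (fun n => u n x) atTop (𝓝 (g x)) := by
    filter_upwards [hlim] with x hx
    simp only [hgdef, dif_pos hx]
    exact hx.choose_spec
  obtain ⟨w, hw, hwM⟩ := Lp.exists_eq_of_tendsto_ae hM hglim
  refine ⟨w, hwM, ?_⟩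
  filter_upwards [hglim, hw] with x h1 h2
  rwa [h2]

theorem Lp.norm_le_rpow_inv {α E : Type*} [MeasurableSpace α] {μ : Measure α}
    [NormedAddCommGroup E] {p : ℝ} (hp : 1 ≤ p) [Fact (1 ≤ ENNReal.ofReal p)]
    {w : Lp E (ENNReal.ofReal p) μ} {K : ℝ} (h : ∫ x, ‖w x‖ ^ p ∂μ ≤ K) : ‖w‖ ≤ K ^ p⁻¹ := by
  rw [← Lp.norm_rpow_eq_integral hp] at h
  have := Real.rpow_le_rpow (Real.rpow_nonneg (norm_nonneg w) p) h (by positivity : 0 ≤ p⁻¹)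
  rwa [← Real.rpow_mul (norm_nonneg _), mul_inv_cancel₀ (by linarith), Real.rpow_one] at this

/-! ### The integrated convexity gap; existence and uniqueness of minimisers -/

namespace UniformlyConvexIntegrand

variable {α : Type*} [MeasurableSpace α] {μ : Measure α} {E : Type*} [NormedAddCommGroup E]
  [NormedSpace ℝ E] {p : ℝ} {F : α → E → ℝ} {b : α → ℝ} {c : ℝ}

theorem nonneg (h : UniformlyConvexIntegrand μ p F b c) : ∀ᵐ x ∂μ, ∀ u, 0 ≤ F x u := by
  filter_upwards [h.coercive] with x hx u
  have := h.coercive_pos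
  exact le_trans (by positivity) (hx u)

theorem integrable_comp (h : UniformlyConvexIntegrand μ p F b c) (hp : 1 ≤ p) {u : α → E}
    (hu : MemLp u (ENNReal.ofReal p) μ) : Integrable (fun x => F x (u x)) μ := by
  obtain ⟨C, hC, hb⟩ := h.abs_sub_le 1 one_pos
  refine (h.integrable_bound.add ((MemLp.integrable_norm_rpow_ofReal hp hu).const_mul C)).mono'
    (h.aestronglyMeasurable_comp u hu.1) ?_
  filter_upwards [hb, h.zero] with x hx h0
  simpa [h0, Real.zero_rpow (by linarith : p ≠ 0)] using hx 0 (u x)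

theorem exists_integral_le (h : UniformlyConvexIntegrand μ p F b c) (hp : 1 ≤ p) :
    ∃ C, 0 ≤ C ∧ ∀ u : α → E, MemLp u (ENNReal.ofReal p) μ →
      ∫ x, F x (u x) ∂μ ≤ C + C * ∫ x, ‖u x‖ ^ p ∂μ := by
  obtain ⟨C, hC, hb⟩ := h.abs_sub_le 1 one_pos
  have hb0 : 0 ≤ ∫ x, b x ∂μ := integral_nonneg h.bound_nonneg
  refine ⟨C + ∫ x, b x ∂μ, by positivity, fun u hu => ?_⟩
  have hui := MemLp.integrable_norm_rpow_ofReal hp hu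
  have hu0 : 0 ≤ ∫ x, ‖u x‖ ^ p ∂μ := integral_nonneg fun x => by positivity
  have h1 : ∫ x, F x (u x) ∂μ ≤ ∫ x, (b x + C * ‖u x‖ ^ p) ∂μ := by
    refine integral_mono_ae (h.integrable_comp hp hu) (h.integrable_bound.add (hui.const_mul C)) ?_
    filter_upwards [hb, h.zero] with x hx h0
    have := hx 0 (u x)
    simp only [zero_add, h0, sub_zero, norm_zero, Real.zero_rpow (by linarith : p ≠ 0), add_zero,
      one_mul] at this
    exact (le_abs_self _).trans this
  rw [integral_add h.integrable_bound (hui.const_mul C), integral_const_mul] at h1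
  nlinarith [mul_nonneg hb0 hu0]

theorem integral_norm_rpow_le (h : UniformlyConvexIntegrand μ p F b c) (hp : 1 ≤ p) {u : α → E}
    (hu : MemLp u (ENNReal.ofReal p) μ) :
    ∫ x, ‖u x‖ ^ p ∂μ ≤ (∫ x, F x (u x) ∂μ) / c := by
  rw [le_div_iff₀ h.coercive_pos, mul_comm, ← integral_const_mul]
  exact integral_mono_ae ((MemLp.integrable_norm_rpow_ofReal hp hu).const_mul c)
    (h.integrable_comp hp hu) (h.coercive.mono fun x hx => hx _)

theorem integrable_midpointGap (h : UniformlyConvexIntegrand μ p F b c) (hp : 1 ≤ p)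
    {u v : α → E} (hu : MemLp u (ENNReal.ofReal p) μ) (hv : MemLp v (ENNReal.ofReal p) μ) :
    Integrable (fun x => midpointGap F x (u x) (v x)) μ :=
  (((h.integrable_comp hp hu).add (h.integrable_comp hp hv)).const_mul _).sub
    (h.integrable_comp hp ((hu.add hv).const_smul (1 / 2 : ℝ)))

theorem integral_midpointGap (h : UniformlyConvexIntegrand μ p F b c) (hp : 1 ≤ p)
    {u v : α → E} (hu : MemLp u (ENNReal.ofReal p) μ) (hv : MemLp v (ENNReal.ofReal p) μ) :
    ∫ x, midpointGap F x (u x) (v x) ∂μ = (1 / 2) * (∫ x, F x (u x) ∂μ + ∫ x, F x (v x) ∂μ) -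
      ∫ x, F x ((1 / 2 : ℝ) • (u x + v x)) ∂μ := by
  have h1 := h.integrable_comp hp hu
  have h2 := h.integrable_comp hp hv
  have h3 : Integrable (fun x => F x ((1 / 2 : ℝ) • (u x + v x))) μ :=
    h.integrable_comp hp ((hu.add hv).const_smul (1 / 2 : ℝ))
  rw [← integral_add h1 h2, ← integral_const_mul, ← integral_sub _ h3]
  · rfl
  · exact (h1.add h2).const_mul _

theorem midpointGap_nonneg (h : UniformlyConvexIntegrand μ p F b c) :
    ∀ᵐ x ∂μ, ∀ u v, 0 ≤ midpointGap F x u v := by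
  filter_upwards [h.convex] with x hx u v
  have := hx.2 (Set.mem_univ u) (Set.mem_univ v) (by norm_num : (0 : ℝ) ≤ 1 / 2)
    (by norm_num : (0 : ℝ) ≤ 1 / 2) (by norm_num)
  simp only [smul_eq_mul] at this
  rw [midpointGap, smul_add]
  linarith

/-- If the weighted integral of the convexity gap is small, then the functions are close in
measure. -/
theorem exists_measure_le_of_integral_gap_le (h : UniformlyConvexIntegrand μ p F b c)
    (hp : 1 ≤ p) (M : ℝ) {τ η : ℝ} (hτ : 0 < τ) (hη : 0 < η) :
    ∃ δ > 0, ∀ (u v : α → E) (φ : α → ℝ), MemLp u (ENNReal.ofReal p) μ →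
      MemLp v (ENNReal.ofReal p) μ → ∫ x, ‖u x‖ ^ p ∂μ ≤ M → ∫ x, ‖v x‖ ^ p ∂μ ≤ M →
      AEStronglyMeasurable φ μ → (∀ x, 0 ≤ φ x) → (∀ x, φ x ≤ 1) →
      ∫ x, φ x * midpointGap F x (u x) (v x) ∂μ ≤ δ →
      μ ({x | φ x = 1} ∩ {x | τ ≤ dist (u x) (v x)}) ≤ ENNReal.ofReal η := by
  set M' := max M 0
  have hM' : 0 ≤ M' := le_max_right _ _
  -- By Chebyshev, each of the two functions exceeds `R` on a set of measure at most `η / 3`; the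
  -- summand 1 keeps `R` positive when `M' = 0`. The last third of `η` is for the set where the
  -- weighted gap is at least `m`.
  set R : ℝ := (3 * M' / η + 1) ^ p⁻¹ with hR
  have hR0 : 0 < R := by positivity
  have hRp : R ^ p = 3 * M' / η + 1 := by
    rw [hR, ← Real.rpow_mul (by positivity), inv_mul_cancel₀ (by linarith), Real.rpow_one]
  obtain ⟨m, hm, hgap⟩ := h.gap R τ hτ
  refine ⟨m * (η / 3), by positivity, fun u v φ hu hv huM hvM hφm hφ0 hφ1 hint => ?_⟩
  have hbig : ∀ w : α → E, MemLp w (ENNReal.ofReal p) μ → ∫ x, ‖w x‖ ^ p ∂μ ≤ M →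
      μ {x | R ^ p ≤ ‖w x‖ ^ p} ≤ ENNReal.ofReal (η / 3) := by
    intro w hw hwM
    refine (measure_ge_le_ofReal_integral_div (MemLp.integrable_norm_rpow_ofReal hp hw)
      (ae_of_all _ fun x => by positivity) (by positivity)).trans (ENNReal.ofReal_le_ofReal ?_)
    rw [div_le_iff₀ (by positivity), hRp]
    have : η / 3 * (3 * M' / η + 1) = M' + η / 3 := by field_simp
    rw [this]
    have : M ≤ M' := le_max_left _ _
    linarith
  have hgi : Integrable (fun x => φ x * midpointGap F x (u x) (v x)) μ :=
    (h.integrable_midpointGap hp hu hv).bdd_mul (c := 1) hφm (ae_of_all _ fun x => by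
      rw [Real.norm_of_nonneg (hφ0 x)]; exact hφ1 x)
  have hsmall : μ {x | m ≤ φ x * midpointGap F x (u x) (v x)} ≤ ENNReal.ofReal (η / 3) := by
    refine (measure_ge_le_ofReal_integral_div hgi ?_ hm).trans (ENNReal.ofReal_le_ofReal ?_)
    · filter_upwards [h.midpointGap_nonneg] with x hx
      exact mul_nonneg (hφ0 x) (hx _ _)
    · rw [div_le_iff₀ hm]
      linarith
  have hsub : ({x | φ x = 1} ∩ {x | τ ≤ dist (u x) (v x)} : Set α) ≤ᵐ[μ]
      ({x | R ^ p ≤ ‖u x‖ ^ p} ∪ {x | R ^ p ≤ ‖v x‖ ^ p} ∪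
        {x | m ≤ φ x * midpointGap F x (u x) (v x)} : Set α) := by
    filter_upwards [hgap] with x hx hxm
    obtain ⟨hx1, hx2⟩ : φ x = 1 ∧ τ ≤ dist (u x) (v x) := hxm
    by_cases h1 : R ≤ ‖u x‖
    · exact Or.inl (Or.inl (Real.rpow_le_rpow hR0.le h1 (by linarith)))
    by_cases h2 : R ≤ ‖v x‖
    · exact Or.inl (Or.inr (Real.rpow_le_rpow hR0.le h2 (by linarith)))
    · refine Or.inr ?_
      change m ≤ φ x * midpointGap F x (u x) (v x)
      rw [hx1, one_mul]
      exact hx _ _ (not_le.1 h1).le (not_le.1 h2).le (by rwa [← dist_eq_norm])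
  refine (measure_mono_ae hsub).trans ((measure_union_le _ _).trans
    ((add_le_add ((measure_union_le _ _).trans (add_le_add (hbig u hu huM) (hbig v hv hvM)))
      hsmall).trans (le_of_eq ?_)))
  rw [← ENNReal.ofReal_add (by positivity) (by positivity),
    ← ENNReal.ofReal_add (by positivity) (by positivity)]
  congr 1
  ring

/-- Existence and uniqueness of the minimiser of `∫ F(x, v + w) dx` over a closed subspace. -/
theorem existsUnique_minimizer [CompleteSpace E] [Fact (1 ≤ ENNReal.ofReal p)]
    (h : UniformlyConvexIntegrand μ p F b c) (hp : 1 < p)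
    {S : Submodule ℝ (Lp E (ENNReal.ofReal p) μ)}
    (hS : IsClosed (S : Set (Lp E (ENNReal.ofReal p) μ))) {v : α → E}
    (hv : MemLp v (ENNReal.ofReal p) μ) :
    ∃! w : S, ∀ w' : S, ∫ x, F x (v x + w.1 x) ∂μ ≤ ∫ x, F x (v x + w'.1 x) ∂μ := by
  have hmem : ∀ w : S, MemLp (fun x => v x + w.1 x) (ENNReal.ofReal p) μ := fun w =>
    hv.add (Lp.memLp w.1)
  set e : S → ℝ := fun w => ∫ x, F x (v x + w.1 x) ∂μ with he
  have he0 : ∀ w, 0 ≤ e w := fun w => integral_nonneg_of_ae (h.nonneg.mono fun x hx => hx _)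
  have hbdd : BddBelow (Set.range e) := ⟨0, by rintro _ ⟨w, rfl⟩; exact he0 w⟩
  set I := ⨅ w, e w with hI
  have hIe : ∀ w, I ≤ e w := fun w => ciInf_le hbdd w
  -- The midpoint of two competitors is a competitor, so its energy is at least the infimum `I`.
  have hmid : ∀ w w' : S, ∫ x, midpointGap F x (v x + w.1 x) (v x + w'.1 x) ∂μ ≤
      (1 / 2) * (e w + e w') - I := by
    intro w w'
    rw [h.integral_midpointGap hp.le (hmem w) (hmem w')]
    refine sub_le_sub_left ?_ _
    refine (hIe ((1 / 2 : ℝ) • (w + w'))).trans (le_of_eq ?_)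
    refine integral_congr_ae ?_
    filter_upwards [Lp.coeFn_smul (1 / 2 : ℝ) (w.1 + w'.1), Lp.coeFn_add w.1 w'.1] with x h1 h2
    have : ((((1 / 2 : ℝ) • (w + w') : S) : Lp E (ENNReal.ofReal p) μ)) x =
        (1 / 2 : ℝ) • (w.1 x + w'.1 x) := by
      rw [Submodule.coe_smul, Submodule.coe_add, h1, Pi.smul_apply, h2, Pi.add_apply]
    rw [this]
    congr 1
    module
  have huniq : ∀ w w' : S, (∀ z, e w ≤ e z) → (∀ z, e w' ≤ e z) → w = w' := by
    intro w w' hw hw'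
    have h1 : e w ≤ I := le_ciInf hw
    have h2 : e w' ≤ I := le_ciInf hw'
    have h3 := hmid w w'
    -- For two minimisers the integrated gap is at most zero, so the closeness criterion holds with
    -- every tolerance `η`.
    have hzero : ∀ k : ℕ, μ {x | 1 / ((k : ℝ) + 1) ≤ dist (v x + w.1 x) (v x + w'.1 x)} = 0 := by
      intro k
      refine le_antisymm (le_of_forall_pos_le_add fun η hη => ?_) bot_le
      rw [zero_add]
      by_cases hηt : η = ⊤
      · rw [hηt]; exact le_top
      have hη' : 0 < η.toReal := ENNReal.toReal_pos hη.ne' hηt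
      obtain ⟨δ, hδ, hδ'⟩ := h.exists_measure_le_of_integral_gap_le hp.le
        (max (∫ x, ‖v x + w.1 x‖ ^ p ∂μ) (∫ x, ‖v x + w'.1 x‖ ^ p ∂μ))
        (Nat.one_div_pos_of_nat (α := ℝ) (n := k)) hη'
      have := hδ' _ _ (fun _ => 1) (hmem w) (hmem w') (le_max_left _ _) (le_max_right _ _)
        aestronglyMeasurable_const (fun _ => zero_le_one) (fun _ => le_rfl)
        (by simp only [one_mul]; linarith)
      simpa [ENNReal.ofReal_toReal hηt] using this
    have hae : ∀ᵐ x ∂μ, ∀ k : ℕ, dist (v x + w.1 x) (v x + w'.1 x) < 1 / ((k : ℝ) + 1) := by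
      rw [ae_all_iff]
      intro k
      rw [ae_iff]
      simpa using hzero k
    refine Subtype.ext (Lp.ext ?_)
    filter_upwards [hae] with x hx
    have h0 : dist (v x + w.1 x) (v x + w'.1 x) ≤ 0 :=
      ge_of_tendsto' tendsto_one_div_add_atTop_nhds_zero_nat fun k => (hx k).le
    rw [dist_add_left] at h0
    exact dist_le_zero.1 h0
  refine existsUnique_of_exists_of_unique ?_ huniq
  have hseq : ∀ n : ℕ, ∃ w : S, e w < I + 1 / ((n : ℝ) + 1) := fun n =>
    exists_lt_of_ciInf_lt (lt_add_of_pos_right _ Nat.one_div_pos_of_nat)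
  choose w hw using hseq
  have hle1 : ∀ n : ℕ, 1 / ((n : ℝ) + 1) ≤ 1 := fun n => by
    rw [div_le_one (by positivity)]
    have : (0 : ℝ) ≤ n := Nat.cast_nonneg n
    linarith
  set M : ℝ := (I + 1) / c with hM
  have huM : ∀ n, ∫ x, ‖v x + (w n).1 x‖ ^ p ∂μ ≤ M := fun n => by
    refine (h.integral_norm_rpow_le hp.le (hmem (w n))).trans ?_
    have h1 := hw n
    have h2 := hle1 n
    have h3 := h.coercive_pos
    have h4 : e (w n) ≤ I + 1 := by linarith
    exact div_le_div_of_nonneg_right h4 h3.le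
  -- The gap of `w n` and `w m` is at most the mean of the excesses `1/(n+1)` and `1/(m+1)`, so the
  -- minimising sequence is Cauchy in measure on the whole space.
  obtain ⟨s, hs, hsl⟩ := exists_seq_tendsto_ae_of_cauchy_in_measure (μ := μ)
    (A := fun _ => Set.univ) (f := fun n x => v x + (w n).1 x) (by
      intro i ε hε
      obtain ⟨δ, hδ, hδ'⟩ := h.exists_measure_le_of_integral_gap_le hp.le M hε hε
      obtain ⟨n₀, hn₀⟩ := exists_nat_one_div_lt hδ
      refine ⟨n₀, fun n hn m hm => ?_⟩
      have hn' : 1 / ((n : ℝ) + 1) ≤ 1 / ((n₀ : ℝ) + 1) := Nat.one_div_le_one_div hn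
      have hm' : 1 / ((m : ℝ) + 1) ≤ 1 / ((n₀ : ℝ) + 1) := Nat.one_div_le_one_div hm
      have := hδ' _ _ (fun _ => 1) (hmem (w n)) (hmem (w m)) (huM n) (huM m)
        aestronglyMeasurable_const (fun _ => zero_le_one) (fun _ => le_rfl) (by
          simp only [one_mul]
          have h1 := hmid (w n) (w m)
          have h2 := hw n
          have h3 := hw m
          linarith)
      simpa using this)
  have hsl' : ∀ᵐ x ∂μ, ∃ y, Tendsto (fun n => (w (s n)).1 x) atTop (𝓝 y) := by
    filter_upwards [hsl] with x hx
    obtain ⟨y, hy⟩ := hx 0 (Set.mem_univ x)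
    exact ⟨y - v x, by simpa using hy.sub_const (v x)⟩
  set K : ℝ := 2 ^ (p - 1) * (M + ∫ x, ‖v x‖ ^ p ∂μ) with hK
  have hwb : ∀ n, ‖(w n).1‖ ≤ K ^ p⁻¹ := fun n => by
    refine Lp.norm_le_rpow_inv hp.le ?_
    have h1 := MemLp.integrable_norm_rpow_ofReal hp.le (hmem (w n))
    have h2 := MemLp.integrable_norm_rpow_ofReal hp.le hv
    have h3 : ∫ x, ‖(w n).1 x‖ ^ p ∂μ ≤
        ∫ x, 2 ^ (p - 1) * (‖v x + (w n).1 x‖ ^ p + ‖v x‖ ^ p) ∂μ := by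
      refine integral_mono (MemLp.integrable_norm_rpow_ofReal hp.le (Lp.memLp (w n).1))
        ((h1.add h2).const_mul _) fun x => ?_
      simpa using norm_sub_rpow_le hp.le (v x + (w n).1 x) (v x)
    rw [integral_const_mul, integral_add h1 h2] at h3
    refine h3.trans ?_
    rw [hK]
    gcongr
    exact huM n
  have hK0 : 0 ≤ K ^ p⁻¹ := (norm_nonneg _).trans (hwb 0)
  obtain ⟨w₀, -, hlim⟩ := Lp.exists_tendsto_ae (M := ⟨K ^ p⁻¹, hK0⟩)
    (u := fun n => (w (s n)).1) (fun n => hwb (s n)) hsl'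
  have hw₀S : w₀ ∈ S := Lp.mem_of_tendsto_ae hp hS (fun n => hwb (s n)) hlim fun n => (w (s n)).2
  refine ⟨⟨w₀, hw₀S⟩, fun w' => ?_⟩
  refine le_trans ?_ (hIe w')
  refine le_of_forall_pos_le_add fun ε hε => ?_
  have h1 := eventually_integral_sub_le_of_tendsto_ae (μ := μ)
    (f := fun n x => F x (v x + (w (s n)).1 x)) (g := fun x => F x (v x + w₀ x))
    (fun n => h.integrable_comp hp.le (hmem (w (s n))))
    (fun n => h.nonneg.mono fun x hx => hx _)
    (h.integrable_comp hp.le (hmem ⟨w₀, hw₀S⟩)) (by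
      filter_upwards [hlim, h.continuous] with x hx hc
      exact (hc.tendsto _).comp (hx.const_add (v x))) (half_pos hε)
  have h2 : ∀ᶠ n : ℕ in atTop, 1 / (((s n : ℕ) : ℝ) + 1) < ε / 2 :=
    (tendsto_one_div_add_atTop_nhds_zero_nat.comp hs.tendsto_atTop).eventually
      (gt_mem_nhds (half_pos hε))
  obtain ⟨n, hn1, hn2⟩ := (h1.and h2).exists
  have h3 := hw (s n)
  simp only [he] at h3
  linarith

end UniformlyConvexIntegrand

/-! ### Curl-free fields and the duality pairing -/

theorem one_lt_critExp (N : ℕ) [Fact (3 ≤ N)] : 1 < critExp N :=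
  one_lt_two.trans (critExp_gt_two N)

/-- The exponent conjugate to `2*`, as an `L^p` exponent. -/
noncomputable def twoStarConj (N : ℕ) : ℝ≥0∞ := ENNReal.ofReal (critExp N).conjExponent

instance holderConjugate_twoStar (N : ℕ) [Fact (3 ≤ N)] :
    ENNReal.HolderConjugate (twoStar N) (twoStarConj N) :=
  (Real.HolderConjugate.conjExponent (one_lt_critExp N)).ennrealOfReal

instance one_le_twoStarConj (N : ℕ) [Fact (3 ≤ N)] : Fact (1 ≤ twoStarConj N) :=
  ⟨ENNReal.HolderConjugate.one_le _ (twoStar N)⟩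

theorem inner_basisVec {N : ℕ} (v : Vec N) (j : Fin N) : inner ℝ v (basisVec j) = v j := by
  simp [basisVec, EuclideanSpace.inner_single_right]

theorem two_le_smooth : (2 : WithTop ℕ∞) ≤ ((⊤ : ℕ∞) : WithTop ℕ∞) :=
  ENat.LEInfty.out

theorem one_add_one_le_smooth : (1 : WithTop ℕ∞) + 1 ≤ ((⊤ : ℕ∞) : WithTop ℕ∞) := by
  rw [one_add_one_eq_two]
  exact two_le_smooth

theorem IsTestFunction.continuous_partialDeriv {N : ℕ} {Ω : Set (Vec N)} {ψ : Vec N → ℝ} (hψ : IsTestFunction Ω ψ)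
    (k : Fin N) : Continuous (partialDeriv k ψ) :=
  (hψ.1.continuous_fderiv (by simp)).clm_apply continuous_const

theorem IsTestFunction.hasCompactSupport_partialDeriv {N : ℕ} {Ω : Set (Vec N)} {ψ : Vec N → ℝ} (hψ : IsTestFunction Ω ψ)
    (k : Fin N) : HasCompactSupport (partialDeriv k ψ) :=
  (hψ.2.1.fderiv ℝ).comp_left (g := fun L : Vec N →L[ℝ] ℝ => L (basisVec k)) rfl

section CurlFree

variable {N : ℕ} [Fact (3 ≤ N)] {Ω : Set (Vec N)}

/-- The pairing of `L^{2*}` with its dual. -/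
noncomputable def critPairing (N : ℕ) [Fact (3 ≤ N)] (Ω : Set (Vec N)) :
    LCrit N Ω →L[ℝ] Lp (Vec N) (twoStarConj N) (volume.restrict Ω) →L[ℝ] ℝ :=
  (innerSL ℝ (E := Vec N)).lpPairing (volume.restrict Ω) (twoStar N) (twoStarConj N)

theorem critPairing_apply (w : LCrit N Ω) {θ : Vec N → Vec N}
    (hθ : MemLp θ (twoStarConj N) (volume.restrict Ω)) :
    critPairing N Ω w hθ.toLp = ∫ x in Ω, inner ℝ (w x) (θ x) := by
  rw [critPairing, ContinuousLinearMap.lpPairing_eq_integral]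
  refine integral_congr_ae ?_
  filter_upwards [hθ.coeFn_toLp] with x hx
  rw [hx]
  rfl

theorem exists_distDeriv_eq (k l : Fin N) {ψ : Vec N → ℝ} (hψ : IsTestFunction Ω ψ) :
    ∃ L : LCrit N Ω →L[ℝ] ℝ, ∀ w, distDeriv w k l ψ = L w := by
  have hθ : MemLp (fun x => partialDeriv k ψ x • (basisVec l : Vec N)) (twoStarConj N)
      (volume.restrict Ω) :=
    ((hψ.continuous_partialDeriv k).smul continuous_const).memLp_of_hasCompactSupport
      ((hψ.hasCompactSupport_partialDeriv k).smul_right)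
  refine ⟨-((critPairing N Ω).flip hθ.toLp), fun w => ?_⟩
  rw [neg_apply, ContinuousLinearMap.flip_apply, critPairing_apply, distDeriv]
  congr 1
  refine integral_congr_ae (ae_of_all _ fun x => ?_)
  simp only [inner_smul_right, inner_basisVec, mul_comm]

/-- Each defining condition is an equality of two bounded functionals, given by pairing with
compactly supported continuous fields. -/
theorem isClosed_curlFree (N : ℕ) [Fact (3 ≤ N)] (Ω : Set (Vec N)) :
    IsClosed (curlFree N Ω : Set (LCrit N Ω)) := by
  have : (curlFree N Ω : Set (LCrit N Ω)) = ⋂ (k : Fin N) (l : Fin N) (ψ : Vec N → ℝ)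
      (_ : IsTestFunction Ω ψ), {w | distDeriv w k l ψ - distDeriv w l k ψ = 0} := by
    ext w
    simp only [Set.mem_iInter]
    rfl
  rw [this]
  refine isClosed_iInter fun k => isClosed_iInter fun l => isClosed_iInter fun ψ =>
    isClosed_iInter fun hψ => ?_
  obtain ⟨L₁, h₁⟩ := exists_distDeriv_eq (Ω := Ω) k l hψ
  obtain ⟨L₂, h₂⟩ := exists_distDeriv_eq (Ω := Ω) l k hψ
  simp only [h₁, h₂]
  exact isClosed_eq (L₁.continuous.sub L₂.continuous) continuous_const

/-- Gradients of compactly supported functions are curl free. -/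
theorem mem_curlFree_of_ae_eq_gradient {Ψ : Vec N → ℝ} (hΨ : ContDiff ℝ 1 Ψ)
    (hΨc : HasCompactSupport Ψ) (hΨΩ : tsupport Ψ ⊆ Ω) {w : LCrit N Ω}
    (hw : w =ᵐ[volume.restrict Ω] gradient Ψ) : w ∈ curlFree N Ω := by
  intro k l ψ hψ
  have hgrad : ∀ x (j : Fin N), gradient Ψ x j = fderiv ℝ Ψ x (basisVec j) := fun x j => by
    have h1 : inner ℝ (gradient Ψ x) (basisVec j) = fderiv ℝ Ψ x (basisVec j) := by
      rw [gradient, InnerProductSpace.toDual_symm_apply]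
    rw [← h1, inner_basisVec]
  -- Since `Ψ` is only C¹, the derivative is moved onto `ψ`. The resulting expression is symmetric
  -- in `i` and `j` because second derivatives of `ψ` commute.
  have key : ∀ i j : Fin N, distDeriv w i j ψ =
      ∫ x, fderiv ℝ (fderiv ℝ ψ) x (basisVec j) (basisVec i) * Ψ x := by
    intro i j
    have hψi : ContDiff ℝ 1 (fun x => fderiv ℝ ψ x (basisVec i)) :=
      (hψ.1.fderiv_right (m := 1) one_add_one_le_smooth).clm_apply contDiff_const
    have hsupp : ∀ x, x ∉ Ω → fderiv ℝ Ψ x = 0 := fun x hx => by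
      have : x ∉ tsupport (fderiv ℝ Ψ) := fun h => hx (hΨΩ (tsupport_fderiv_subset ℝ h))
      exact image_eq_zero_of_notMem_tsupport this
    have e1 : distDeriv w i j ψ =
        - ∫ x, fderiv ℝ ψ x (basisVec i) * fderiv ℝ Ψ x (basisVec j) := by
      rw [distDeriv, ← setIntegral_eq_integral_of_forall_compl_eq_zero (s := Ω)
        (f := fun x => fderiv ℝ ψ x (basisVec i) * fderiv ℝ Ψ x (basisVec j))]
      · congr 1
        refine integral_congr_ae ?_
        filter_upwards [hw] with x hx
        rw [hx, hgrad, partialDeriv, mul_comm]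
      · intro x hx
        rw [hsupp x hx]
        simp
    have hfc : Continuous fun x => fderiv ℝ Ψ x (basisVec j) :=
      (hΨ.continuous_fderiv (by simp)).clm_apply continuous_const
    have hdc : Continuous fun x => fderiv ℝ (fun x => fderiv ℝ ψ x (basisVec i)) x (basisVec j) :=
      (hψi.continuous_fderiv (by simp)).clm_apply continuous_const
    have hfs : HasCompactSupport fun x => fderiv ℝ Ψ x (basisVec j) :=
      (hΨc.fderiv ℝ).comp_left (g := fun L : Vec N →L[ℝ] ℝ => L (basisVec j)) rfl
    have e2 := integral_mul_fderiv_eq_neg_fderiv_mul_of_integrable (μ := (volume : Measure (Vec N)))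
      (f := fun x => fderiv ℝ ψ x (basisVec i)) (g := Ψ) (v := basisVec j)
      ((hdc.mul hΨ.continuous).integrable_of_hasCompactSupport hΨc.mul_left)
      ((hψi.continuous.mul hfc).integrable_of_hasCompactSupport hfs.mul_left)
      ((hψi.continuous.mul hΨ.continuous).integrable_of_hasCompactSupport hΨc.mul_left)
      (fun x _ => hψi.differentiable (by simp) x) (fun x _ => hΨ.differentiable (by simp) x)
    rw [e1, e2, neg_neg]
    refine integral_congr_ae (ae_of_all _ fun x => ?_)
    have hdd : DifferentiableAt ℝ (fderiv ℝ ψ) x :=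
      (hψ.1.fderiv_right (m := 1) one_add_one_le_smooth).differentiable (by simp) x
    have : fderiv ℝ (fun x => fderiv ℝ ψ x (basisVec i)) x (basisVec j) =
        fderiv ℝ (fderiv ℝ ψ) x (basisVec j) (basisVec i) := by
      rw [fderiv_clm_apply hdd (differentiableAt_const _)]
      simp
    simp only [this]
  rw [key, key, sub_eq_zero]
  refine integral_congr_ae (ae_of_all _ fun x => ?_)
  have hsymm : IsSymmSndFDerivAt ℝ ψ x := hψ.1.contDiffAt.isSymmSndFDerivAt (by simpa using two_le_smooth)
  simp only [hsymm.eq (basisVec l) (basisVec k)]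

end CurlFree

/-! ### Mollification in L^p -/

theorem lintegral_rpow_le_lintegral_rpow {α : Type*} [MeasurableSpace α] {ν : Measure α}
    [IsProbabilityMeasure ν] {p : ℝ} (hp : 1 < p) {f : α → ℝ≥0∞} (hf : AEMeasurable f ν) :
    (∫⁻ x, f x ∂ν) ^ p ≤ ∫⁻ x, f x ^ p ∂ν := by
  have h := ENNReal.lintegral_mul_le_Lp_mul_Lq ν (Real.HolderConjugate.conjExponent hp) hf
    (aemeasurable_const (b := (1 : ℝ≥0∞)))
  simp only [Pi.mul_apply, mul_one, ENNReal.one_rpow, lintegral_one, measure_univ] at h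
  have h2 := ENNReal.rpow_le_rpow h (by linarith : 0 ≤ p)
  rwa [← ENNReal.rpow_mul, one_div_mul_cancel (by linarith), ENNReal.rpow_one] at h2

section Mollification

open scoped Convolution

variable {N : ℕ} {p : ℝ}

/-- The normalised bump is a probability density, so the mollification is an average of translates:
Jensen's inequality, Tonelli's theorem and translation invariance give a contraction of L^p. -/
theorem lintegral_convolution_rpow_le (hp : 1 < p) {g : Vec N → Vec N} (hg : StronglyMeasurable g)
    (η : ContDiffBump (0 : Vec N)) :
    ∫⁻ x, ‖(η.normed volume ⋆[ContinuousLinearMap.lsmul ℝ ℝ, volume] g) x‖ₑ ^ p ≤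
      ∫⁻ x, ‖g x‖ₑ ^ p := by
  set d : Vec N → ℝ≥0∞ := fun t => ENNReal.ofReal (η.normed volume t) with hd
  have hdm : Measurable d := (η.continuous_normed.measurable).ennreal_ofReal
  set ν : Measure (Vec N) := volume.withDensity d with hν
  have hprob : IsProbabilityMeasure ν := by
    refine ⟨?_⟩
    rw [hν, withDensity_apply _ MeasurableSet.univ, Measure.restrict_univ, hd,
      ← ofReal_integral_eq_lintegral_ofReal η.integrable_normed
        (ae_of_all _ fun t => η.nonneg_normed t), η.integral_normed, ENNReal.ofReal_one]
  have hgm : Measurable fun z : Vec N × Vec N => ‖g (z.1 - z.2)‖ₑ :=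
    (hg.measurable.comp (measurable_fst.sub measurable_snd)).enorm
  have h1 : ∀ x, ‖(η.normed volume ⋆[ContinuousLinearMap.lsmul ℝ ℝ, volume] g) x‖ₑ ≤
      ∫⁻ t, ‖g (x - t)‖ₑ ∂ν := by
    intro x
    have hgx : Measurable fun t => ‖g (x - t)‖ₑ :=
      (hg.measurable.comp (measurable_const.sub measurable_id)).enorm
    rw [hν, lintegral_withDensity_eq_lintegral_mul _ hdm hgx]
    refine (enorm_integral_le_lintegral_enorm _).trans (lintegral_mono fun t => ?_)
    simp only [ContinuousLinearMap.lsmul_apply, enorm_smul, Pi.mul_apply, hd]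
    rw [Real.enorm_of_nonneg (η.nonneg_normed t)]
  calc ∫⁻ x, ‖(η.normed volume ⋆[ContinuousLinearMap.lsmul ℝ ℝ, volume] g) x‖ₑ ^ p
      ≤ ∫⁻ x, ∫⁻ t, ‖g (x - t)‖ₑ ^ p ∂ν := by
        refine lintegral_mono fun x => ?_
        have hgx : Measurable fun t => ‖g (x - t)‖ₑ :=
          (hg.measurable.comp (measurable_const.sub measurable_id)).enorm
        exact (ENNReal.rpow_le_rpow (h1 x) (by linarith)).trans
          (lintegral_rpow_le_lintegral_rpow hp hgx.aemeasurable)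
    _ = ∫⁻ t, (∫⁻ x, ‖g (x - t)‖ₑ ^ p) ∂ν := by
        rw [lintegral_lintegral_swap]
        exact (hgm.pow_const p).aemeasurable
    _ = ∫⁻ _, (∫⁻ x, ‖g x‖ₑ ^ p) ∂ν := by
        refine lintegral_congr fun t => ?_
        exact lintegral_sub_right_eq_self (fun x => ‖g x‖ₑ ^ p) t
    _ = ∫⁻ x, ‖g x‖ₑ ^ p := by simp

theorem eLpNorm_le_of_lintegral_rpow_le {α E G : Type*} [MeasurableSpace α] {μ : Measure α}
    [NormedAddCommGroup E] [NormedAddCommGroup G] (hp : 1 < p) {f : α → E} {g : α → G}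
    (h : ∫⁻ x, ‖f x‖ₑ ^ p ∂μ ≤ ∫⁻ x, ‖g x‖ₑ ^ p ∂μ) :
    eLpNorm f (ENNReal.ofReal p) μ ≤ eLpNorm g (ENNReal.ofReal p) μ := by
  have h0 : ENNReal.ofReal p ≠ 0 := by simpa using by linarith
  rw [eLpNorm_eq_lintegral_rpow_enorm_toReal h0 ENNReal.ofReal_ne_top,
    eLpNorm_eq_lintegral_rpow_enorm_toReal h0 ENNReal.ofReal_ne_top,
    ENNReal.toReal_ofReal (by linarith)]
  exact ENNReal.rpow_le_rpow h (by positivity)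

theorem integral_norm_rpow_le_of_eLpNorm_le {α E G : Type*} [MeasurableSpace α] {μ : Measure α}
    [NormedAddCommGroup E] [NormedAddCommGroup G] (hp : 1 < p) {f : α → E} {g : α → G}
    (hf : MemLp f (ENNReal.ofReal p) μ) (hg : MemLp g (ENNReal.ofReal p) μ)
    (h : eLpNorm f (ENNReal.ofReal p) μ ≤ eLpNorm g (ENNReal.ofReal p) μ) :
    ∫ x, ‖f x‖ ^ p ∂μ ≤ ∫ x, ‖g x‖ ^ p ∂μ := by
  have h1 : 0 ≤ ∫ x, ‖f x‖ ^ p ∂μ := integral_nonneg fun x => by positivity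
  have h2 : 0 ≤ ∫ x, ‖g x‖ ^ p ∂μ := integral_nonneg fun x => by positivity
  rw [eLpNorm_ofReal_eq hp.le hf, eLpNorm_ofReal_eq hp.le hg,
    ENNReal.ofReal_le_ofReal_iff (by positivity)] at h
  exact (Real.rpow_le_rpow_iff h1 h2 (by positivity)).1 h

/-- Mollifications approximate a function in `L^p`. -/
theorem exists_contDiffBump_integral_sub_le (hp : 1 < p) {g : Vec N → Vec N}
    (hgm : StronglyMeasurable g) (hg : MemLp g (ENNReal.ofReal p) volume) {ρ ε : ℝ} (hρ : 0 < ρ)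
    (hε : 0 < ε) :
    ∃ η : ContDiffBump (0 : Vec N), η.rOut < ρ ∧
      MemLp (η.normed volume ⋆[ContinuousLinearMap.lsmul ℝ ℝ, volume] g) (ENNReal.ofReal p)
        volume ∧
      ∫ x, ‖(η.normed volume ⋆[ContinuousLinearMap.lsmul ℝ ℝ, volume] g) x - g x‖ ^ p ≤ ε := by
  have hp1 : 1 ≤ ENNReal.ofReal p := by rw [ENNReal.one_le_ofReal]; exact hp.le
  have hloc : LocallyIntegrable g volume := hg.locallyIntegrable hp1
  set η : ℕ → ContDiffBump (0 : Vec N) := fun n =>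
    ⟨1 / ((n : ℝ) + 1) / 2, 1 / ((n : ℝ) + 1), by positivity, half_lt_self (by positivity)⟩ with hη
  have hout : Tendsto (fun n => (η n).rOut) atTop (𝓝 0) :=
    tendsto_one_div_add_atTop_nhds_zero_nat
  have hae := ContDiffBump.ae_convolution_tendsto_right_of_locallyIntegrable (K := 2) hout
    (Eventually.of_forall fun n => by simp [hη]; linarith) hloc
  have hle : ∀ n, eLpNorm ((η n).normed volume ⋆[ContinuousLinearMap.lsmul ℝ ℝ, volume] g)
      (ENNReal.ofReal p) volume ≤ eLpNorm g (ENNReal.ofReal p) volume := fun n =>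
    eLpNorm_le_of_lintegral_rpow_le hp (lintegral_convolution_rpow_le hp hgm (η n))
  have hcont : ∀ n, Continuous ((η n).normed volume ⋆[ContinuousLinearMap.lsmul ℝ ℝ, volume] g) :=
    fun n => (η n).hasCompactSupport_normed.continuous_convolution_left _
      (η n).continuous_normed hloc
  have hmem : ∀ n, MemLp ((η n).normed volume ⋆[ContinuousLinearMap.lsmul ℝ ℝ, volume] g)
      (ENNReal.ofReal p) volume := fun n =>
    ⟨(hcont n).aestronglyMeasurable, (hle n).trans_lt hg.2⟩
  -- A.e. convergence at Lebesgue points together with norms not exceeding that of `g` forces strong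
  -- convergence: with this `A` the main term of the bound vanishes.
  have key := eventually_integral_norm_sub_rpow_le hp.le hmem hg hae
    (A := ∫ x, ‖g x‖ ^ p)
    (Eventually.of_forall fun n => integral_norm_rpow_le_of_eLpNorm_le hp (hmem n) hg (hle n)) hε
  obtain ⟨n, hn1, hn2⟩ := (key.and (hout.eventually (gt_mem_nhds hρ))).exists
  refine ⟨η n, hn2, hmem n, ?_⟩
  simpa using hn1

end Mollification

/-! ### Mollified curl-free fields are closed one-forms -/

section CurlFreeMollification

open scoped Convolution

variable {N : ℕ} [Fact (3 ≤ N)] {Ω : Set (Vec N)}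

/-- The derivative of the mollification of a curl free field is symmetric. -/
theorem inner_fderiv_convolution_comm (hΩ : MeasurableSet Ω) {w : LCrit N Ω}
    (hw : w ∈ curlFree N Ω) (η : ContDiffBump (0 : Vec N)) {x : Vec N}
    (hx : Metric.closedBall x η.rOut ⊆ Ω) (a b : Vec N) :
    inner ℝ (fderiv ℝ (η.normed volume ⋆[ContinuousLinearMap.lsmul ℝ ℝ, volume] Ω.indicator w) x a)
      b =
    inner ℝ (fderiv ℝ (η.normed volume ⋆[ContinuousLinearMap.lsmul ℝ ℝ, volume] Ω.indicator w) x b)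
      a := by
  have hloc : LocallyIntegrable (Ω.indicator w) volume :=
    ((memLp_indicator_iff_restrict hΩ).2 (Lp.memLp w)).locallyIntegrable (one_le_twoStar N).out
  set m := η.normed volume ⋆[ContinuousLinearMap.lsmul ℝ ℝ, volume] Ω.indicator w with hm
  set D : Vec N →L[ℝ] Vec N := fderiv ℝ m x with hD
  have hηs : ContDiff ℝ ∞ (η.normed (volume : Measure (Vec N))) := η.contDiff_normed
  have hder := η.hasCompactSupport_normed.hasFDerivAt_convolution_left
    (ContinuousLinearMap.lsmul ℝ ℝ) (η.contDiff_normed (n := 1) (μ := volume)) hloc x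
  -- The reflected kernel centred at `x` is an admissible test function because its support lies in
  -- the closed ball assumed to be in `Ω`.
  have hψ : IsTestFunction Ω fun y => η.normed (volume : Measure (Vec N)) (x - y) := by
    have hsub : ∀ y, η.normed (volume : Measure (Vec N)) (x - y) ≠ 0 →
        y ∈ Metric.closedBall x η.rOut := by
      intro y hy
      have h1 : x - y ∈ Function.support (η.normed (volume : Measure (Vec N))) := hy
      rw [η.support_normed_eq, mem_ball_zero_iff] at h1
      rw [Metric.mem_closedBall, dist_comm, dist_eq_norm]
      exact h1.le
    refine ⟨hηs.comp (contDiff_const.sub contDiff_id), ?_, ?_⟩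
    · exact HasCompactSupport.of_support_subset_isCompact (isCompact_closedBall x η.rOut) hsub
    · exact (closure_minimal hsub Metric.isClosed_closedBall).trans hx
  -- Differentiating the convolution differentiates the kernel; the reflection contributes the sign
  -- in the definition of the distributional derivative.
  have hDkl : ∀ k l : Fin N, D (basisVec k) l =
      distDeriv w k l fun y => η.normed (volume : Measure (Vec N)) (x - y) := by
    intro k l
    have hint : Integrable (fun t => (ContinuousLinearMap.lsmul ℝ ℝ (E := Vec N)).precompL (Vec N)
        (fderiv ℝ (η.normed (volume : Measure (Vec N))) t) (Ω.indicator w (x - t))) volume :=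
      (η.hasCompactSupport_normed.fderiv ℝ).convolutionExists_left _
        (hηs.continuous_fderiv (by simp)) hloc x
    have h1 : D (basisVec k) l =
        ∫ t, fderiv ℝ (η.normed (volume : Measure (Vec N))) t (basisVec k) *
          Ω.indicator w (x - t) l := by
      have := ((EuclideanSpace.proj l : Vec N →L[ℝ] ℝ).comp
        (ContinuousLinearMap.apply ℝ (Vec N) (basisVec k : Vec N))).integral_comp_comm hint
      rw [hD, hder.fderiv, convolution]
      simpa using this.symm
    have h2 := integral_sub_left_eq_self
      (fun t => fderiv ℝ (η.normed (volume : Measure (Vec N))) t (basisVec k) *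
        Ω.indicator w (x - t) l) volume x
    rw [h1, ← h2, distDeriv, ← integral_neg, ← integral_indicator hΩ]
    refine integral_congr_ae (ae_of_all _ fun y => ?_)
    have h3 : partialDeriv k (fun y => η.normed (volume : Measure (Vec N)) (x - y)) y =
        -(fderiv ℝ (η.normed (volume : Measure (Vec N))) (x - y) (basisVec k)) := by
      have hd : HasFDerivAt (fun y : Vec N => x - y) (-(ContinuousLinearMap.id ℝ (Vec N))) y := by
        simpa using (hasFDerivAt_id y).const_sub x
      have hη := (hηs.differentiable (by simp) (x - y)).hasFDerivAt
      have hc : HasFDerivAt (fun y => η.normed (volume : Measure (Vec N)) (x - y)) _ y :=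
        hη.comp y hd
      rw [partialDeriv, hc.fderiv]
      simp
    by_cases hy : y ∈ Ω
    · simp [hy, h3, mul_comm]
    · simp [hy]
  have hsymm : ∀ k l : Fin N, inner ℝ (D (basisVec k)) (basisVec l) =
      inner ℝ (D (basisVec l)) (basisVec k) := fun k l => by
    rw [inner_basisVec, inner_basisVec, hDkl, hDkl]
    exact sub_eq_zero.1 (hw k l _ hψ)
  have hrep : ∀ v : Vec N, v = ∑ i, v i • (basisVec i : Vec N) := fun v => by
    simpa [basisVec] using ((EuclideanSpace.basisFun (Fin N) ℝ).sum_repr v).symm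
  rw [hrep a, hrep b]
  simp only [map_sum, map_smul, sum_inner, inner_sum, real_inner_smul_left, real_inner_smul_right,
    hsymm]
  rw [Finset.sum_comm]
  refine Finset.sum_congr rfl fun i _ => Finset.sum_congr rfl fun j _ => ?_
  rw [hsymm i j]
  ring

end CurlFreeMollification

/-! ### Compactness of potentials on balls -/

section Potential

variable {N : ℕ} {p : ℝ}

theorem lintegral_comp_smul_add {f : Vec N → ℝ≥0∞} (hf : Measurable f) {c : ℝ} (hc : 0 < c)
    (v : Vec N) :
    ∫⁻ z, f (c • z + v) = ENNReal.ofReal ((c ^ N)⁻¹) * ∫⁻ z, f z := by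
  have h1 : ∫⁻ z, f (c • z + v) = ∫⁻ z, f (z + v) ∂(Measure.map (c • ·) volume) := by
    have hfv : Measurable fun z => f (z + v) := hf.comp (measurable_id.add_const v)
    rw [lintegral_map hfv (measurable_const_smul c)]
  rw [h1, Measure.map_addHaar_smul _ hc.ne', lintegral_smul_measure, smul_eq_mul,
    lintegral_add_right_eq_self f v, finrank_euclideanSpace_fin, abs_of_pos (by positivity)]

/-- Convexity keeps (1 - t)z + tx in B, so the integrand can be extended by zero outside B before
the affine change of variables in z. -/
theorem setLIntegral_comp_convex_comb_le {f : Vec N → ℝ≥0∞} (hf : Measurable f) {B : Set (Vec N)}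
    (hB : MeasurableSet B) (hconv : Convex ℝ B) {x : Vec N} (hx : x ∈ B) {t : ℝ} (ht0 : 0 ≤ t)
    (ht1 : t < 1) :
    ∫⁻ z in B, f ((1 - t) • z + t • x) ≤ ENNReal.ofReal (((1 - t) ^ N)⁻¹) * ∫⁻ z in B, f z := by
  rw [← lintegral_indicator hB, ← lintegral_indicator hB,
    ← lintegral_comp_smul_add (hf.indicator hB) (by linarith : 0 < 1 - t) (t • x)]
  refine lintegral_mono fun z => ?_
  by_cases hz : z ∈ B
  · have : (1 - t) • z + t • x ∈ B := hconv hz hx (by linarith) ht0 (by ring)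
    simp [hz, this]
  · simp [hz]

/-- The average over the base point `z` of the component along `x - z` of the field `s` at the
point `(1 - t) z + t x`. -/
noncomputable def segmentAverage (B : Set (Vec N)) (s : Vec N → Vec N) (t : ℝ) (x : Vec N) : ℝ :=
  (volume.real B)⁻¹ * ∫ z in B, inner ℝ (s ((1 - t) • z + t • x)) (x - z)

variable {x₀ : Vec N} {R : ℝ}

theorem measurable_segmentAverage (B : Set (Vec N)) {s : Vec N → Vec N} (hs : Continuous s) :
    Measurable fun y : ℝ × Vec N => segmentAverage B s y.1 y.2 := by
  have h : StronglyMeasurable (Function.uncurry fun (y : ℝ × Vec N) (z : Vec N) =>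
      inner ℝ (s ((1 - y.1) • z + y.1 • y.2)) (y.2 - z)) := by
    refine Continuous.stronglyMeasurable ?_
    simp only [Function.uncurry_def]
    fun_prop
  exact (h.integral_prod_right.measurable).const_mul _

theorem Measurable.segmentAverage {α : Type*} [MeasurableSpace α] {f : α → ℝ} {g : α → Vec N}
    (hf : Measurable f) (hg : Measurable g) (B : Set (Vec N)) {s : Vec N → Vec N}
    (hs : Continuous s) : Measurable fun y => segmentAverage B s (f y) (g y) := by
  have h := (measurable_segmentAverage B hs).comp (hf.prodMk hg)
  exact h

/-- A potential minus its mean value is the mean of the segment averages. -/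
theorem potential_sub_average_eq (hR : 0 < R) {s : Vec N → Vec N} (hs : Continuous s)
    {ξ : Vec N → ℝ}
    (hξ : ∀ x ∈ Metric.closedBall x₀ R, HasFDerivAt ξ (innerSL ℝ (s x)) x) {x : Vec N}
    (hx : x ∈ Metric.closedBall x₀ R) :
    ξ x - (volume.real (Metric.closedBall x₀ R))⁻¹ * ∫ z in Metric.closedBall x₀ R, ξ z =
      ∫ t in Set.Ioc (0 : ℝ) 1, segmentAverage (Metric.closedBall x₀ R) s t x := by
  set B := Metric.closedBall x₀ R with hB
  have hBm : MeasurableSet B := measurableSet_closedBall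
  have hβ : 0 < volume.real B := by
    rw [hB, Measure.real, ENNReal.toReal_pos_iff]
    exact ⟨Metric.measure_closedBall_pos _ _ hR, measure_closedBall_lt_top⟩
  have hξi : IntegrableOn ξ B :=
    ContinuousOn.integrableOn_compact (isCompact_closedBall _ _)
      fun z hz => (hξ z hz).continuousAt.continuousWithinAt
  -- The fundamental theorem of calculus on the segment from `z` to `x`; averaging over `z` and
  -- exchanging the integrals yields the claim.
  have hline : ∀ z ∈ B, ξ x - ξ z =
      ∫ t in Set.Ioc (0 : ℝ) 1, inner ℝ (s ((1 - t) • z + t • x)) (x - z) := by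
    intro z hz
    have hder : ∀ t ∈ Set.uIcc (0 : ℝ) 1, HasDerivAt (fun t : ℝ => ξ ((1 - t) • z + t • x))
        (inner ℝ (s ((1 - t) • z + t • x)) (x - z)) t := by
      intro t ht
      rw [Set.uIcc_of_le zero_le_one] at ht
      have hmem : (1 - t) • z + t • x ∈ B :=
        convex_closedBall _ _ hz hx (by linarith [ht.2]) ht.1 (by ring)
      have hs1 : HasDerivAt (fun t : ℝ => (1 - t) • z + t • x) (x - z) t := by
        have h1 := (((hasDerivAt_id t).const_sub 1).smul_const z).add
          ((hasDerivAt_id t).smul_const x)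
        have e : (-1 : ℝ) • z + (1 : ℝ) • x = x - z := by module
        rw [e] at h1
        exact h1
      have := (hξ _ hmem).comp_hasDerivAt t hs1
      simpa [Function.comp_def] using this
    have hcont : Continuous fun t : ℝ => inner ℝ (s ((1 - t) • z + t • x)) (x - z) := by fun_prop
    have := intervalIntegral.integral_eq_sub_of_hasDerivAt hder (hcont.intervalIntegrable 0 1)
    rw [intervalIntegral.integral_of_le zero_le_one] at this
    simpa using this.symm
  have hprod : Integrable (Function.uncurry fun (z : Vec N) (t : ℝ) =>
      inner ℝ (s ((1 - t) • z + t • x)) (x - z))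
      ((volume.restrict B).prod (volume.restrict (Set.Ioc (0 : ℝ) 1))) := by
    rw [Measure.prod_restrict]
    have hc : Continuous (Function.uncurry fun (z : Vec N) (t : ℝ) =>
      inner ℝ (s ((1 - t) • z + t • x)) (x - z)) := by
      simp only [Function.uncurry_def]
      fun_prop
    exact (hc.continuousOn.integrableOn_compact ((isCompact_closedBall x₀ R).prod
      (isCompact_Icc (a := (0 : ℝ)) (b := 1)))).mono_set
      (Set.prod_mono_right Set.Ioc_subset_Icc_self)
  have hswap := integral_integral_swap hprod
  have hconst : ∫ _ in B, ξ x = volume.real B * ξ x := by simp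
  simp only [segmentAverage]
  rw [integral_const_mul, ← hswap, ← setIntegral_congr_fun hBm hline,
    integral_sub (by exact integrableOn_const (by exact measure_closedBall_lt_top.ne)) hξi, hconst]
  field_simp

/-- Jensen's inequality for the normalised volume on the ball, with |x - z| ≤ 2R. -/
theorem enorm_segmentAverage_rpow_le (hp : 1 < p) (hR : 0 < R) {s : Vec N → Vec N}
    (hs : Continuous s) {x : Vec N} (hx : x ∈ Metric.closedBall x₀ R) (t : ℝ) :
    ‖segmentAverage (Metric.closedBall x₀ R) s t x‖ₑ ^ p ≤
      ENNReal.ofReal (2 * R) ^ p * ((volume (Metric.closedBall x₀ R))⁻¹ *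
        ∫⁻ z in Metric.closedBall x₀ R, ‖s ((1 - t) • z + t • x)‖ₑ ^ p) := by
  set B := Metric.closedBall x₀ R with hB
  have hBm : MeasurableSet B := measurableSet_closedBall
  have hβ0 : volume B ≠ 0 := (Metric.measure_closedBall_pos _ _ hR).ne'
  have hβt : volume B ≠ ⊤ := measure_closedBall_lt_top.ne
  set ν : Measure (Vec N) := (volume B)⁻¹ • volume.restrict B with hν
  have : IsProbabilityMeasure ν := ⟨by
    rw [hν, Measure.smul_apply, Measure.restrict_apply_univ, smul_eq_mul,
      ENNReal.inv_mul_cancel hβ0 hβt]⟩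
  have hm : Measurable fun z : Vec N => ‖s ((1 - t) • z + t • x)‖ₑ := by
    have : Continuous fun z : Vec N => s ((1 - t) • z + t • x) := by fun_prop
    exact this.measurable.enorm
  have h1 : ‖segmentAverage B s t x‖ₑ ≤
      ENNReal.ofReal (2 * R) * ∫⁻ z, ‖s ((1 - t) • z + t • x)‖ₑ ∂ν := by
    rw [segmentAverage, enorm_mul, hν, lintegral_smul_measure, smul_eq_mul]
    have e1 : ‖(volume.real B)⁻¹‖ₑ = (volume B)⁻¹ := by
      rw [Real.enorm_of_nonneg (by positivity), Measure.real, ENNReal.ofReal_inv_of_pos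
        (ENNReal.toReal_pos hβ0 hβt), ENNReal.ofReal_toReal hβt]
    rw [e1, mul_left_comm]
    gcongr
    refine (enorm_integral_le_lintegral_enorm _).trans ?_
    rw [← lintegral_const_mul _ hm]
    refine setLIntegral_mono (hm.const_mul _) fun z hz => ?_
    have hxz : ‖x - z‖ ≤ 2 * R := by
      have h1 := Metric.mem_closedBall.1 hx
      have h2 := Metric.mem_closedBall'.1 hz
      rw [← dist_eq_norm]
      linarith [dist_triangle x x₀ z]
    have h2 : ‖(inner ℝ (s ((1 - t) • z + t • x)) (x - z) : ℝ)‖ ≤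
        2 * R * ‖s ((1 - t) • z + t • x)‖ := by
      refine (norm_inner_le_norm _ _).trans ?_
      rw [mul_comm]
      gcongr
    rw [← ofReal_norm, ← ofReal_norm, ← ENNReal.ofReal_mul (by positivity)]
    exact ENNReal.ofReal_le_ofReal h2
  refine (ENNReal.rpow_le_rpow h1 (by linarith)).trans ?_
  rw [ENNReal.mul_rpow_of_nonneg _ _ (by linarith)]
  gcongr
  refine (lintegral_rpow_le_lintegral_rpow hp hm.aemeasurable).trans (le_of_eq ?_)
  rw [hν, lintegral_smul_measure, smul_eq_mul]

/-- One of the coefficients t and 1 - t is at least 1/2; changing variables in the corresponding one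
of x and z costs at most 2^N. The bound is thus uniform in t, whereas the pointwise bound
degenerates as t tends to 1. -/
theorem lintegral_enorm_segmentAverage_rpow_le (hp : 1 < p) (hR : 0 < R) {s : Vec N → Vec N}
    (hs : Continuous s) {t : ℝ} (ht0 : 0 < t) (ht1 : t < 1) :
    ∫⁻ x in Metric.closedBall x₀ R, ‖segmentAverage (Metric.closedBall x₀ R) s t x‖ₑ ^ p ≤
      ENNReal.ofReal (2 * R) ^ p * (ENNReal.ofReal (2 ^ N) *
        ∫⁻ z in Metric.closedBall x₀ R, ‖s z‖ₑ ^ p) := by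
  set B := Metric.closedBall x₀ R with hB
  have hBm : MeasurableSet B := measurableSet_closedBall
  have hβ0 : volume B ≠ 0 := (Metric.measure_closedBall_pos _ _ hR).ne'
  have hβt : volume B ≠ ⊤ := measure_closedBall_lt_top.ne
  have hsm : Measurable fun y : Vec N => ‖s y‖ₑ ^ p := hs.measurable.enorm.pow_const p
  have hjm : Measurable fun y : Vec N × Vec N => ‖s ((1 - t) • y.2 + t • y.1)‖ₑ ^ p := by
    have : Continuous fun y : Vec N × Vec N => s ((1 - t) • y.2 + t • y.1) := by fun_prop
    exact this.measurable.enorm.pow_const p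
  have hinv : ∀ r : ℝ, 1 / 2 ≤ r → (r ^ N)⁻¹ ≤ 2 ^ N := fun r hr => by
    have : (1 / 2 : ℝ) ^ N ≤ r ^ N := pow_le_pow_left₀ (by norm_num) hr N
    calc (r ^ N)⁻¹ ≤ ((1 / 2 : ℝ) ^ N)⁻¹ := inv_anti₀ (by positivity) this
      _ = 2 ^ N := by rw [← inv_pow]; norm_num
  have hdouble : ∫⁻ x in B, ∫⁻ z in B, ‖s ((1 - t) • z + t • x)‖ₑ ^ p ≤
      volume B * (ENNReal.ofReal (2 ^ N) * ∫⁻ z in B, ‖s z‖ₑ ^ p) := by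
    rcases le_total t (1 / 2) with h | h
    · calc ∫⁻ x in B, ∫⁻ z in B, ‖s ((1 - t) • z + t • x)‖ₑ ^ p
          ≤ ∫⁻ _ in B, ENNReal.ofReal (2 ^ N) * ∫⁻ z in B, ‖s z‖ₑ ^ p := by
            refine setLIntegral_mono measurable_const fun x hx => ?_
            refine (setLIntegral_comp_convex_comb_le hsm hBm (convex_closedBall _ _) hx ht0.le
              ht1).trans ?_
            gcongr
            exact hinv _ (by linarith)
        _ = _ := by rw [setLIntegral_const, mul_comm]
    · rw [lintegral_lintegral_swap hjm.aemeasurable]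
      calc ∫⁻ z in B, ∫⁻ x in B, ‖s ((1 - t) • z + t • x)‖ₑ ^ p
          ≤ ∫⁻ _ in B, ENNReal.ofReal (2 ^ N) * ∫⁻ z in B, ‖s z‖ₑ ^ p := by
            refine setLIntegral_mono measurable_const fun z hz => ?_
            have := setLIntegral_comp_convex_comb_le hsm hBm (convex_closedBall _ _) hz
              (by linarith : 0 ≤ 1 - t) (by linarith)
            rw [sub_sub_cancel] at this
            simp only [add_comm ((1 - t) • z)]
            refine this.trans ?_
            gcongr
            exact hinv _ h
        _ = _ := by rw [setLIntegral_const, mul_comm]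
  calc ∫⁻ x in B, ‖segmentAverage B s t x‖ₑ ^ p
      ≤ ∫⁻ x in B, ENNReal.ofReal (2 * R) ^ p * ((volume B)⁻¹ *
        ∫⁻ z in B, ‖s ((1 - t) • z + t • x)‖ₑ ^ p) := by
        refine setLIntegral_mono ?_ fun x hx => enorm_segmentAverage_rpow_le hp hR hs hx t
        exact (hjm.lintegral_prod_right'.const_mul _).const_mul _
    _ = ENNReal.ofReal (2 * R) ^ p * ((volume B)⁻¹ *
        ∫⁻ x in B, ∫⁻ z in B, ‖s ((1 - t) • z + t • x)‖ₑ ^ p) := by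
        rw [lintegral_const_mul _ (hjm.lintegral_prod_right'.const_mul _),
          lintegral_const_mul _ hjm.lintegral_prod_right']
    _ ≤ ENNReal.ofReal (2 * R) ^ p * ((volume B)⁻¹ *
        (volume B * (ENNReal.ofReal (2 ^ N) * ∫⁻ z in B, ‖s z‖ₑ ^ p))) := by gcongr
    _ = _ := by rw [← mul_assoc (volume B)⁻¹, ENNReal.inv_mul_cancel hβ0 hβt, one_mul]

/-- For fixed t < 1 the substitution y = (1 - t)z + tx turns the segment average into a pairing of
`s k` with a bounded field θ supported in the image of the ball, to which weak convergence applies.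
-/
theorem tendsto_segmentAverage {s : ℕ → Vec N → Vec N}
    (hweak : ∀ (θ : Vec N → Vec N) (C : ℝ), Measurable θ → (∀ y, ‖θ y‖ ≤ C) →
      Tendsto (fun k => ∫ y in Metric.closedBall x₀ R, inner ℝ (s k y) (θ y)) atTop (𝓝 0))
    {x : Vec N} (hx : x ∈ Metric.closedBall x₀ R) {t : ℝ} (ht0 : 0 ≤ t) (ht1 : t < 1) :
    Tendsto (fun k => segmentAverage (Metric.closedBall x₀ R) (s k) t x) atTop (𝓝 0) := by
  set B := Metric.closedBall x₀ R with hB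
  have hBm : MeasurableSet B := measurableSet_closedBall
  have hr : 0 < 1 - t := by linarith
  set T : Vec N → Vec N := fun y => (1 - t)⁻¹ • (y - t • x) with hT
  have hTm : Measurable T := by
    have : Continuous T := by fun_prop
    exact this.measurable
  set B' : Set (Vec N) := T ⁻¹' B with hB'
  have hB'm : MeasurableSet B' := hTm hBm
  have hTinv : ∀ y, (1 - t) • T y + t • x = y := fun y => by
    simp only [hT, smul_smul, mul_inv_cancel₀ hr.ne', one_smul, sub_add_cancel]
  have hTz : ∀ z, T ((1 - t) • z + t • x) = z := fun z => by
    simp only [hT, add_sub_cancel_right, smul_smul, inv_mul_cancel₀ hr.ne', one_smul]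
  have hsub : B' ⊆ B := fun y hy => by
    have := convex_closedBall x₀ R hy hx hr.le ht0 (by ring)
    rwa [hTinv] at this
  set θ : Vec N → Vec N := B'.indicator fun y => (1 - t)⁻¹ • (x - y) with hθ
  have hθm : Measurable θ := by
    have : Continuous fun y : Vec N => (1 - t)⁻¹ • (x - y) := by fun_prop
    exact this.measurable.indicator hB'm
  have hR : 0 ≤ R := dist_nonneg.trans (Metric.mem_closedBall.1 hx)
  have hθb : ∀ y, ‖θ y‖ ≤ (1 - t)⁻¹ * (2 * R) := fun y => by
    by_cases hy : y ∈ B'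
    · simp only [hθ, Set.indicator_of_mem hy]
      rw [norm_smul, Real.norm_of_nonneg (by positivity)]
      gcongr
      have h1 := Metric.mem_closedBall.1 hx
      have h2 := Metric.mem_closedBall'.1 (hsub hy)
      rw [← dist_eq_norm]
      linarith [dist_triangle x x₀ y]
    · simp only [hθ, Set.indicator_of_notMem hy, norm_zero]
      positivity
  have hrew : ∀ k, segmentAverage B (s k) t x =
      (volume.real B)⁻¹ * (((1 - t) ^ N)⁻¹ * ∫ y in B, inner ℝ (s k y) (θ y)) := by
    intro k
    set H : Vec N → ℝ := fun y => inner ℝ (s k y) (θ y) with hH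
    have h1 : ∫ y in B, H y = ∫ y, H y := by
      refine setIntegral_eq_integral_of_forall_compl_eq_zero fun y hy => ?_
      have : y ∉ B' := fun h => hy (hsub h)
      simp [hH, hθ, this]
    have h2 : ∫ z, H ((1 - t) • z + t • x) = ((1 - t) ^ N)⁻¹ * ∫ y, H y := by
      have := Measure.integral_comp_smul volume (fun y => H (y + t • x)) (1 - t)
      rw [this, integral_add_right_eq_self H, finrank_euclideanSpace_fin,
        abs_of_pos (by positivity), smul_eq_mul]
    rw [segmentAverage, h1, ← h2, ← integral_indicator hBm]
    congr 2
    ext z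
    by_cases hz : z ∈ B
    · have hmem : (1 - t) • z + t • x ∈ B' := by
        rw [hB', Set.mem_preimage, hTz]
        exact hz
      have hxz : (1 - t)⁻¹ • (x - ((1 - t) • z + t • x)) = x - z := by
        have : x - ((1 - t) • z + t • x) = (1 - t) • (x - z) := by module
        rw [this, smul_smul, inv_mul_cancel₀ hr.ne', one_smul]
      simp only [Set.indicator_of_mem hz, hH, hθ, Set.indicator_of_mem hmem, hxz]
    · have hmem : (1 - t) • z + t • x ∉ B' := by
        rw [hB', Set.mem_preimage, hTz]
        exact hz
      simp only [Set.indicator_of_notMem hz, hH, hθ, Set.indicator_of_notMem hmem, inner_zero_right]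
  simp only [hrew]
  simpa using ((hweak θ _ hθm hθb).const_mul (((1 - t) ^ N)⁻¹)).const_mul ((volume.real B)⁻¹)

/-- Compactness of potentials: if the gradients are bounded in `L^p` and converge weakly to zero on
a ball, then the potentials with mean value zero converge to zero in `L^p`. -/
theorem tendsto_lintegral_potential (hp : 1 < p) (hR : 0 < R) {s : ℕ → Vec N → Vec N}
    (hs : ∀ k, Continuous (s k)) {M : ℝ≥0∞} (hM : M ≠ ⊤)
    (hsM : ∀ k, ∫⁻ y in Metric.closedBall x₀ R, ‖s k y‖ₑ ^ p ≤ M)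
    (hweak : ∀ (θ : Vec N → Vec N) (C : ℝ), Measurable θ → (∀ y, ‖θ y‖ ≤ C) →
      Tendsto (fun k => ∫ y in Metric.closedBall x₀ R, inner ℝ (s k y) (θ y)) atTop (𝓝 0))
    {ξ : ℕ → Vec N → ℝ}
    (hξ : ∀ k, ∀ x ∈ Metric.closedBall x₀ R, HasFDerivAt (ξ k) (innerSL ℝ (s k x)) x) :
    Tendsto (fun k => ∫⁻ x in Metric.closedBall x₀ R, ‖ξ k x -
      (volume.real (Metric.closedBall x₀ R))⁻¹ * ∫ z in Metric.closedBall x₀ R, ξ k z‖ₑ ^ p)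
      atTop (𝓝 0) := by
  set B := Metric.closedBall x₀ R with hB
  have hBm : MeasurableSet B := measurableSet_closedBall
  have hβ0 : volume B ≠ 0 := (Metric.measure_closedBall_pos _ _ hR).ne'
  have hβt : volume B ≠ ⊤ := measure_closedBall_lt_top.ne
  have hpR : ENNReal.ofReal (2 * R) ^ p ≠ ⊤ :=
    ENNReal.rpow_ne_top_of_nonneg (by linarith) ENNReal.ofReal_ne_top
  have hm : ∀ k, Measurable fun y : ℝ × Vec N => ‖segmentAverage B (s k) y.1 y.2‖ₑ ^ p := fun k =>
    (measurable_fst.segmentAverage measurable_snd B (hs k)).enorm.pow_const p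
  have hms : ∀ k, Measurable fun y : Vec N × ℝ => ‖segmentAverage B (s k) y.2 y.1‖ₑ ^ p := fun k =>
    (measurable_snd.segmentAverage measurable_fst B (hs k)).enorm.pow_const p
  have hmt : ∀ k t, Measurable fun x : Vec N => ‖segmentAverage B (s k) t x‖ₑ ^ p := fun k t =>
    (measurable_const.segmentAverage measurable_id B (hs k)).enorm.pow_const p
  set G : ℕ → ℝ → ℝ≥0∞ := fun k t => ∫⁻ x in B, ‖segmentAverage B (s k) t x‖ₑ ^ p with hG
  have hGm : ∀ k, Measurable (G k) := fun k => (hm k).lintegral_prod_right'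
  -- For fixed `t`, the averages tend to zero pointwise in `x` and are bounded by a constant
  -- depending on `t`.
  have hG0 : ∀ t ∈ Set.Ioo (0 : ℝ) 1, Tendsto (fun k => G k t) atTop (𝓝 0) := by
    intro t ht
    have := tendsto_lintegral_of_dominated_convergence (μ := volume.restrict B)
      (F := fun k x => ‖segmentAverage B (s k) t x‖ₑ ^ p) (f := fun _ => 0)
      (fun _ => ENNReal.ofReal (2 * R) ^ p * ((volume B)⁻¹ *
        (ENNReal.ofReal (((1 - t) ^ N)⁻¹) * M))) (fun k => hmt k t) ?_ ?_ ?_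
    · simpa using this
    · intro k
      filter_upwards [ae_restrict_mem hBm] with x hx
      refine (enorm_segmentAverage_rpow_le hp hR (hs k) hx t).trans ?_
      gcongr
      refine (setLIntegral_comp_convex_comb_le ((hs k).measurable.enorm.pow_const p) hBm
        (convex_closedBall _ _) hx ht.1.le ht.2).trans ?_
      gcongr
      exact hsM k
    · rw [setLIntegral_const]
      refine ENNReal.mul_ne_top (ENNReal.mul_ne_top hpR (ENNReal.mul_ne_top
        (ENNReal.inv_ne_top.2 hβ0) (ENNReal.mul_ne_top ENNReal.ofReal_ne_top hM))) hβt
    · filter_upwards [ae_restrict_mem hBm] with x hx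
      have h1 := (tendsto_segmentAverage hweak hx ht.1.le ht.2).enorm
      have h2 := h1.ennrpow_const p
      simpa [ENNReal.zero_rpow_of_pos (by linarith : 0 < p)] using h2
  have hae : ∀ᵐ t ∂(volume.restrict (Set.Ioc (0 : ℝ) 1)), t ∈ Set.Ioo (0 : ℝ) 1 := by
    rw [← Measure.restrict_congr_set (Ioo_ae_eq_Ioc (a := (0 : ℝ)) (b := 1))]
    exact ae_restrict_mem measurableSet_Ioo
  -- Here the majorant must not depend on `t`; it comes from the estimate with the factor `2 ^ N`.
  have hGlim : Tendsto (fun k => ∫⁻ t in Set.Ioc (0 : ℝ) 1, G k t) atTop (𝓝 0) := by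
    have := tendsto_lintegral_of_dominated_convergence (μ := volume.restrict (Set.Ioc (0 : ℝ) 1))
      (F := G) (f := fun _ => 0)
      (fun _ => ENNReal.ofReal (2 * R) ^ p * (ENNReal.ofReal (2 ^ N) * M)) hGm ?_ ?_ ?_
    · simpa using this
    · intro k
      filter_upwards [hae] with t ht
      refine (lintegral_enorm_segmentAverage_rpow_le hp hR (hs k) ht.1 ht.2).trans ?_
      gcongr
      exact hsM k
    · rw [setLIntegral_const]
      refine ENNReal.mul_ne_top (ENNReal.mul_ne_top hpR
        (ENNReal.mul_ne_top ENNReal.ofReal_ne_top hM)) (by simp)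
    · filter_upwards [hae] with t ht using hG0 t ht
  refine tendsto_of_tendsto_of_tendsto_of_le_of_le tendsto_const_nhds hGlim
    (fun _ => bot_le) fun k => ?_
  have hprob : IsProbabilityMeasure (volume.restrict (Set.Ioc (0 : ℝ) 1)) := ⟨by simp⟩
  have hmx : ∀ x, Measurable fun t : ℝ => ‖segmentAverage B (s k) t x‖ₑ := fun x =>
    (measurable_id.segmentAverage measurable_const B (hs k)).enorm
  calc ∫⁻ x in B, ‖ξ k x - (volume.real B)⁻¹ * ∫ z in B, ξ k z‖ₑ ^ p
      ≤ ∫⁻ x in B, ∫⁻ t in Set.Ioc (0 : ℝ) 1, ‖segmentAverage B (s k) t x‖ₑ ^ p := by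
        refine setLIntegral_mono ?_ fun x hx => ?_
        · exact (hms k).lintegral_prod_right'
        · rw [potential_sub_average_eq hR (hs k) (hξ k) hx]
          exact (ENNReal.rpow_le_rpow (enorm_integral_le_lintegral_enorm _) (by linarith)).trans
            (lintegral_rpow_le_lintegral_rpow hp (hmx x).aemeasurable)
    _ = ∫⁻ t in Set.Ioc (0 : ℝ) 1, G k t := by
        rw [lintegral_lintegral_swap]
        exact (hms k).aemeasurable

end Potential

/-! ### Cutoffs of curl-free fields -/

theorem lintegral_enorm_rpow_eq_ofReal {α E : Type*} [MeasurableSpace α] {μ : Measure α}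
    [NormedAddCommGroup E] {p : ℝ} (hp : 0 ≤ p) {f : α → E}
    (hf : Integrable (fun x => ‖f x‖ ^ p) μ) :
    ∫⁻ x, ‖f x‖ₑ ^ p ∂μ = ENNReal.ofReal (∫ x, ‖f x‖ ^ p ∂μ) := by
  rw [ofReal_integral_eq_lintegral_ofReal hf (ae_of_all _ fun x => by positivity)]
  refine lintegral_congr fun x => ?_
  rw [← ENNReal.ofReal_rpow_of_nonneg (norm_nonneg _) hp, ofReal_norm]

/-- Either d ≤ ε or d ≤ d (d/ε)^(p-1). With ε^p equal to a bound for the p-th power integral this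
controls the L¹ norm on a finite measure space. -/
theorem norm_le_add_rpow_mul {p d ε : ℝ} (hp : 1 ≤ p) (hd : 0 ≤ d) (hε : 0 < ε) :
    d ≤ ε + ε ^ (1 - p) * d ^ p := by
  rcases le_total d ε with h | h
  · have : 0 ≤ ε ^ (1 - p) * d ^ p := by positivity
    linarith
  · have hd0 : 0 < d := hε.trans_le h
    have h1 : ε ^ (p - 1) ≤ d ^ (p - 1) := Real.rpow_le_rpow hε.le h (by linarith)
    have h2 : d ^ p = d ^ (p - 1) * d := by rw [← Real.rpow_add_one hd0.ne']; ring_nf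
    have h3 : ε ^ (1 - p) * ε ^ (p - 1) = 1 := by
      rw [← Real.rpow_add hε]; simp
    calc d = ε ^ (1 - p) * ε ^ (p - 1) * d := by rw [h3, one_mul]
      _ ≤ ε ^ (1 - p) * d ^ (p - 1) * d := by gcongr
      _ = ε ^ (1 - p) * d ^ p := by rw [h2]; ring
      _ ≤ _ := by linarith

theorem tendsto_integral_norm_of_integral_rpow_le {α E : Type*} [MeasurableSpace α] {μ : Measure α}
    [IsFiniteMeasure μ] [NormedAddCommGroup E] {p : ℝ} (hp : 1 < p) {d : ℕ → α → E} {δ : ℕ → ℝ}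
    (hd : ∀ k, MemLp (d k) (ENNReal.ofReal p) μ) (hδ0 : ∀ k, 0 < δ k)
    (hδt : Tendsto δ atTop (𝓝 0)) (hδ : ∀ k, ∫ x, ‖d k x‖ ^ p ∂μ ≤ δ k) :
    Tendsto (fun k => ∫ x, ‖d k x‖ ∂μ) atTop (𝓝 0) := by
  have hlim : Tendsto (fun k => (μ.real Set.univ + 1) * δ k ^ p⁻¹) atTop (𝓝 0) := by
    have := (hδt.rpow_const (p := p⁻¹) (Or.inr (by positivity))).const_mul (μ.real Set.univ + 1)
    rwa [Real.zero_rpow (by positivity), mul_zero] at this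
  refine squeeze_zero (fun k => integral_nonneg fun y => norm_nonneg _) (fun k => ?_) hlim
  set e := δ k ^ p⁻¹ with he
  have he0 : 0 < e := Real.rpow_pos_of_pos (hδ0 k) _
  have hep : e ^ p = δ k := by
    rw [he, ← Real.rpow_mul (hδ0 k).le, inv_mul_cancel₀ (by linarith), Real.rpow_one]
  have hdi := MemLp.integrable_norm_rpow_ofReal hp.le (hd k)
  have hi1 : Integrable (d k) μ := (hd k).integrable (by rw [ENNReal.one_le_ofReal]; exact hp.le)
  calc ∫ y, ‖d k y‖ ∂μ ≤ ∫ y, (e + e ^ (1 - p) * ‖d k y‖ ^ p) ∂μ :=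
        integral_mono hi1.norm ((integrable_const e).add (hdi.const_mul _)) fun y =>
          norm_le_add_rpow_mul hp.le (norm_nonneg _) he0
    _ = μ.real Set.univ * e + e ^ (1 - p) * ∫ y, ‖d k y‖ ^ p ∂μ := by
        rw [integral_add (integrable_const e) (hdi.const_mul _), integral_const_mul]
        simp
    _ ≤ μ.real Set.univ * e + e ^ (1 - p) * e ^ p := by
        rw [hep]
        gcongr
        exact hδ k
    _ = (μ.real Set.univ + 1) * e := by
        rw [← Real.rpow_add he0]
        simp
        ring

theorem gradient_eq_zero_of_notMem_tsupport {N : ℕ} {φ : Vec N → ℝ} {x : Vec N} (hx : x ∉ tsupport φ) :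
    gradient φ x = 0 := by
  have : fderiv ℝ φ x = 0 := image_eq_zero_of_notMem_tsupport
    fun h => hx (tsupport_fderiv_subset ℝ h)
  rw [gradient, this, map_zero]

theorem ContDiff.continuous_gradient {N : ℕ} {φ : Vec N → ℝ} (hφ : ContDiff ℝ ∞ φ) :
    Continuous (gradient φ) :=
  (InnerProductSpace.toDual ℝ (Vec N)).symm.continuous.comp (hφ.continuous_fderiv (by simp))

/-- The error splits as φ(w - s) - g∇φ. The first part is the approximation error of w by s, the
second is small when the potential g is small in L^p on the support of φ. -/
theorem integral_norm_cutoff_sub_rpow_le {N : ℕ} {Ω : Set (Vec N)} {p : ℝ}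
    (hp : 1 ≤ p) (hΩ : MeasurableSet Ω)
    {B : Set (Vec N)} (hBm : MeasurableSet B) {φ : Vec N → ℝ} (hφs : tsupport φ ⊆ B)
    (hφ1 : ∀ x, |φ x| ≤ 1) {C : ℝ} (hC : ∀ x, ‖gradient φ x‖ ≤ C) {w h s : Vec N → Vec N}
    {g : Vec N → ℝ} (hh : h =ᵐ[volume.restrict Ω] fun x => φ x • s x + g x • gradient φ x)
    (hsw : Integrable (fun x => ‖s x - Ω.indicator w x‖ ^ p) volume)
    (hg : IntegrableOn (fun x => ‖g x‖ ^ p) B volume) :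
    ∫ x in Ω, ‖φ x • w x - h x‖ ^ p ≤
      2 ^ (p - 1) * ((∫ x, ‖s x - Ω.indicator w x‖ ^ p) + C ^ p * ∫ x in B, ‖g x‖ ^ p) := by
  have hC0 : 0 ≤ C := (norm_nonneg _).trans (hC 0)
  have hi2 : Integrable (B.indicator fun x => ‖g x‖ ^ p) volume :=
    (integrable_indicator_iff hBm).2 hg
  have hi3 := hi2.const_mul (C ^ p)
  have hQi := (hsw.add hi3).const_mul (2 ^ (p - 1))
  have hind : ∀ x, 0 ≤ B.indicator (fun x => ‖g x‖ ^ p) x := fun x =>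
    Set.indicator_nonneg (fun x _ => by positivity) x
  have hQ0 : ∀ x, 0 ≤ 2 ^ (p - 1) * (‖s x - Ω.indicator w x‖ ^ p +
      C ^ p * B.indicator (fun x => ‖g x‖ ^ p) x) := fun x => by
    have := hind x
    positivity
  have hle : ∫ x in Ω, ‖φ x • w x - h x‖ ^ p ≤ ∫ x in Ω, 2 ^ (p - 1) *
      (‖s x - Ω.indicator w x‖ ^ p + C ^ p * B.indicator (fun x => ‖g x‖ ^ p) x) := by
    refine integral_mono_of_nonneg (ae_of_all _ fun x => by positivity) hQi.integrableOn ?_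
    filter_upwards [hh, ae_restrict_mem hΩ] with x hx hxΩ
    have e1 : φ x • w x - (φ x • s x + g x • gradient φ x) =
        φ x • (Ω.indicator w x - s x) - g x • gradient φ x := by
      rw [Set.indicator_of_mem hxΩ]
      module
    rw [hx, e1]
    refine (norm_sub_rpow_le hp _ _).trans ?_
    have e2 : ‖φ x • (Ω.indicator w x - s x)‖ ^ p ≤ ‖s x - Ω.indicator w x‖ ^ p := by
      refine Real.rpow_le_rpow (norm_nonneg _) ?_ (by linarith)
      rw [norm_smul, norm_sub_rev]
      exact mul_le_of_le_one_left (norm_nonneg _) (hφ1 x)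
    have e3 : ‖g x • gradient φ x‖ ^ p ≤ C ^ p * B.indicator (fun x => ‖g x‖ ^ p) x := by
      by_cases hxB : x ∈ B
      · rw [Set.indicator_of_mem hxB, norm_smul, mul_comm,
          Real.mul_rpow (norm_nonneg _) (norm_nonneg _)]
        exact mul_le_mul_of_nonneg_right
          (Real.rpow_le_rpow (norm_nonneg _) (hC x) (by linarith)) (by positivity)
      · rw [gradient_eq_zero_of_notMem_tsupport fun h => hxB (hφs h), smul_zero, norm_zero,
          Real.zero_rpow (by linarith), Set.indicator_of_notMem hxB, mul_zero]
    exact mul_le_mul_of_nonneg_left (add_le_add e2 e3) (by positivity)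
  refine hle.trans ((setIntegral_le_integral hQi (ae_of_all _ hQ0)).trans (le_of_eq ?_))
  rw [integral_const_mul, integral_add' hsw hi3, integral_const_mul, integral_indicator hBm]

section CurlFreeCompactness

open scoped Convolution

variable {N : ℕ} [Fact (3 ≤ N)] {Ω : Set (Vec N)}

/-- The mollification of a curl free field has a potential on balls. -/
theorem exists_potential_convolution (hΩ : MeasurableSet Ω) {w : LCrit N Ω}
    (hw : w ∈ curlFree N Ω) (η : ContDiffBump (0 : Vec N)) {x₀ : Vec N} {r : ℝ}
    (hr : Metric.closedBall x₀ (r + η.rOut) ⊆ Ω) :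
    ∃ ξ : Vec N → ℝ, ∀ x ∈ Metric.ball x₀ r, HasFDerivAt ξ (innerSL ℝ
      ((η.normed volume ⋆[ContinuousLinearMap.lsmul ℝ ℝ, volume] Ω.indicator w) x)) x := by
  have hloc : LocallyIntegrable (Ω.indicator w) volume :=
    ((memLp_indicator_iff_restrict hΩ).2 (Lp.memLp w)).locallyIntegrable (one_le_twoStar N).out
  set s := η.normed volume ⋆[ContinuousLinearMap.lsmul ℝ ℝ, volume] Ω.indicator w with hs
  have hsd : Differentiable ℝ s :=
    (η.hasCompactSupport_normed.contDiff_convolution_left (ContinuousLinearMap.lsmul ℝ ℝ)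
      (η.contDiff_normed (n := 1) (μ := volume)) hloc).differentiable (by simp)
  have hω : ∀ x, HasFDerivAt (fun x => innerSL ℝ (s x))
      ((innerSL ℝ (E := Vec N)).comp (fderiv ℝ s x)) x := fun x =>
    (innerSL ℝ (E := Vec N)).hasFDerivAt.comp x (hsd x).hasFDerivAt
  -- The Poincaré lemma on a convex open set: symmetry of the derivative is the closedness of the
  -- one-form.
  refine (convex_ball x₀ r).exists_forall_hasFDerivAt_of_fderiv_symmetric Metric.isOpen_ball
    (fun x _ => (hω x).differentiableAt.differentiableWithinAt) fun a ha x y => ?_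
  rw [(hω a).fderiv]
  refine inner_fderiv_convolution_comm hΩ hw η ?_ x y
  refine (Metric.closedBall_subset_closedBall' ?_).trans hr
  have := Metric.mem_ball.1 ha
  linarith

/-- Curl free fields are approximated in `L^p` by continuous fields with a potential on a ball. -/
theorem exists_approx_with_potential (hΩ : MeasurableSet Ω) {w : LCrit N Ω}
    (hw : w ∈ curlFree N Ω) {x₀ : Vec N} {r R' : ℝ} (hr : r < R')
    (hball : Metric.closedBall x₀ R' ⊆ Ω) {δ : ℝ} (hδ : 0 < δ) :
    ∃ (s : Vec N → Vec N) (ξ : Vec N → ℝ), Continuous s ∧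
      MemLp s (ENNReal.ofReal (critExp N)) volume ∧
      ∫ x, ‖s x - Ω.indicator w x‖ ^ critExp N ≤ δ ∧
      ∫⁻ x, ‖s x‖ₑ ^ critExp N ≤ ∫⁻ x in Ω, ‖w x‖ₑ ^ critExp N ∧
      ∀ x ∈ Metric.ball x₀ r, HasFDerivAt ξ (innerSL ℝ (s x)) x := by
  have hp := one_lt_critExp N
  have hWm : StronglyMeasurable (Ω.indicator w) := (Lp.stronglyMeasurable w).indicator hΩ
  have hWp : MemLp (Ω.indicator w) (ENNReal.ofReal (critExp N)) volume :=
    (memLp_indicator_iff_restrict hΩ).2 (Lp.memLp w)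
  obtain ⟨η, hη1, hη2, hη3⟩ := exists_contDiffBump_integral_sub_le hp hWm hWp
    (sub_pos.2 hr) hδ
  obtain ⟨ξ, hξ⟩ := exists_potential_convolution hΩ hw η (x₀ := x₀) (r := r)
    ((Metric.closedBall_subset_closedBall (by linarith)).trans hball)
  refine ⟨_, ξ, ?_, hη2, hη3, ?_, hξ⟩
  · exact η.hasCompactSupport_normed.continuous_convolution_left _ η.continuous_normed
      (hWp.locallyIntegrable (one_le_twoStar N).out)
  · refine (lintegral_convolution_rpow_le hp hWm η).trans (le_of_eq ?_)
    rw [← lintegral_indicator hΩ]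
    refine lintegral_congr fun x => ?_
    by_cases hx : x ∈ Ω
    · simp [hx]
    · simp [hx, ENNReal.zero_rpow_of_pos (by linarith : 0 < critExp N)]

/-- The gradient of the product of a cutoff function and a local potential is curl free. -/
theorem exists_curlFree_eq_cutoff {φ : Vec N → ℝ} (hφ : ContDiff ℝ ∞ φ) {B U : Set (Vec N)}
    (hB : IsCompact B) (hφs : tsupport φ ⊆ B) (hBU : B ⊆ U) (hBΩ : B ⊆ Ω) {s : Vec N → Vec N}
    (hs : Continuous s) {ξ : Vec N → ℝ} (hξ : ∀ x ∈ U, HasFDerivAt ξ (innerSL ℝ (s x)) x) (c : ℝ) :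
    ∃ h : curlFree N Ω, h.1 =ᵐ[volume.restrict Ω]
      fun x => φ x • s x + (ξ x - c) • gradient φ x := by
  -- Outside `U` nothing is known about `ξ`, but there `φ` vanishes in a neighbourhood; so `Ψ` is C¹
  -- on the whole space, with gradient `V`.
  set Ψ : Vec N → ℝ := fun x => φ x * (ξ x - c) with hΨ
  set V : Vec N → Vec N := fun x => φ x • s x + (ξ x - c) • gradient φ x with hV
  have hφout : ∀ x, x ∉ tsupport φ → φ x = 0 ∧ gradient φ x = 0 := fun x hx =>
    ⟨image_eq_zero_of_notMem_tsupport hx, gradient_eq_zero_of_notMem_tsupport hx⟩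
  have hgc : Continuous (gradient φ) := hφ.continuous_gradient
  have hΨg : ∀ x, HasGradientAt Ψ (V x) x := by
    intro x
    by_cases hx : x ∈ tsupport φ
    · have h1 := ((hφ.differentiable (by simp)) x).hasFDerivAt.mul
        ((hξ x (hBU (hφs hx))).sub_const c)
      rw [hasGradientAt_iff_hasFDerivAt]
      refine h1.congr_fderiv ?_
      ext y
      simp [hV, gradient]
    · have h0 : Ψ =ᶠ[𝓝 x] fun _ => 0 := by
        filter_upwards [(isClosed_tsupport φ).isOpen_compl.mem_nhds hx] with y hy
        simp [hΨ, (hφout y hy).1]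
      have hV0 : V x = 0 := by simp [hV, hφout x hx]
      rw [hV0]
      exact (hasGradientAt_const x (0 : ℝ)).congr_of_eventuallyEq h0
  have hVc : Continuous V := by
    rw [continuous_iff_continuousAt]
    intro x
    by_cases hx : x ∈ tsupport φ
    · exact (hφ.continuous.continuousAt.smul hs.continuousAt).add
        (((hξ x (hBU (hφs hx))).continuousAt.sub continuousAt_const).smul hgc.continuousAt)
    · have h0 : V =ᶠ[𝓝 x] fun _ => 0 := by
        filter_upwards [(isClosed_tsupport φ).isOpen_compl.mem_nhds hx] with y hy
        simp [hV, hφout y hy]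
      exact continuousAt_const.congr h0.symm
  have hVs : HasCompactSupport V :=
    HasCompactSupport.intro hB fun x hx => by simp [hV, hφout x fun h => hx (hφs h)]
  have hVp : MemLp V (twoStar N) (volume.restrict Ω) := hVc.memLp_of_hasCompactSupport hVs
  have hΨsupp : tsupport Ψ ⊆ B := tsupport_mul_subset_left.trans hφs
  have hΨ1 : ContDiff ℝ 1 Ψ := by
    rw [contDiff_one_iff_fderiv]
    refine ⟨fun x => (hΨg x).differentiableAt, ?_⟩
    have : fderiv ℝ Ψ = fun x => innerSL ℝ (V x) := by
      ext1 x
      exact (hΨg x).hasFDerivAt.fderiv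
    rw [this]
    exact (innerSL ℝ (E := Vec N)).continuous.comp hVc
  exact ⟨⟨hVp.toLp, mem_curlFree_of_ae_eq_gradient hΨ1
    (HasCompactSupport.of_support_subset_isCompact hB ((subset_tsupport _).trans hΨsupp))
    (hΨsupp.trans hBΩ) (hVp.coeFn_toLp.trans (ae_of_all _ fun x => (hΨg x).gradient.symm))⟩,
    hVp.coeFn_toLp⟩

/-- The approximations `s k` inherit the weak convergence of `w k`: their difference tends to zero
in L^p, hence in L¹(B), and a bounded field on B represents an element of the dual space. -/
theorem tendsto_integral_inner_of_approx (hΩ : MeasurableSet Ω) {B : Set (Vec N)}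
    (hBm : MeasurableSet B) (hBt : volume B ≠ ⊤) (hBΩ : B ⊆ Ω) {w : ℕ → LCrit N Ω}
    (hweak : ∀ θ, Tendsto (fun k => critPairing N Ω (w k) θ) atTop (𝓝 0))
    {s : ℕ → Vec N → Vec N} (hs : ∀ k, MemLp (s k) (ENNReal.ofReal (critExp N)) volume)
    {δ : ℕ → ℝ} (hδ0 : ∀ k, 0 < δ k) (hδt : Tendsto δ atTop (𝓝 0))
    (hδ : ∀ k, ∫ x, ‖s k x - Ω.indicator (w k) x‖ ^ critExp N ≤ δ k)
    (θ : Vec N → Vec N) (C : ℝ) (hθ : Measurable θ) (hC : ∀ y, ‖θ y‖ ≤ C) :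
    Tendsto (fun k => ∫ y in B, inner ℝ (s k y) (θ y)) atTop (𝓝 0) := by
  have hp := one_lt_critExp N
  have hfin : IsFiniteMeasure (volume.restrict B) := ⟨by simpa using hBt.lt_top⟩
  have hWp : ∀ k, MemLp (Ω.indicator (w k)) (ENNReal.ofReal (critExp N)) volume := fun k =>
    (memLp_indicator_iff_restrict hΩ).2 (Lp.memLp (w k))
  have hp1 : 1 ≤ ENNReal.ofReal (critExp N) := (one_le_twoStar N).out
  have hd : ∀ k, MemLp (fun x => s k x - Ω.indicator (w k) x) (ENNReal.ofReal (critExp N)) volume :=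
    fun k => (hs k).sub (hWp k)
  have hdB : Tendsto (fun k => ∫ y in B, ‖s k y - Ω.indicator (w k) y‖) atTop (𝓝 0) := by
    refine tendsto_integral_norm_of_integral_rpow_le hp (fun k => (hd k).restrict B) hδ0 hδt
      fun k => ?_
    exact (setIntegral_le_integral (MemLp.integrable_norm_rpow_ofReal hp.le (hd k))
      (ae_of_all _ fun y => by positivity)).trans (hδ k)
  have hθL : MemLp (B.indicator θ) (twoStarConj N) (volume.restrict Ω) := by
    refine MemLp.restrict Ω ?_
    rw [memLp_indicator_iff_restrict hBm]
    exact MemLp.of_bound hθ.aestronglyMeasurable C (ae_of_all _ hC)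
  have h1 := hweak hθL.toLp
  have hWint : ∀ k, critPairing N Ω (w k) hθL.toLp =
      ∫ y in B, inner ℝ (Ω.indicator (w k) y) (θ y) := by
    intro k
    rw [critPairing_apply, ← integral_indicator hΩ, ← integral_indicator hBm]
    congr 1
    ext y
    by_cases hyB : y ∈ B
    · simp [hBΩ hyB, hyB]
    · by_cases hyΩ : y ∈ Ω <;> simp [hyB, hyΩ]
  simp only [hWint] at h1
  have hbd : ∀ v y : Vec N, ‖(inner ℝ v (θ y) : ℝ)‖ ≤ C * ‖v‖ := fun v y => by
    refine (norm_inner_le_norm _ _).trans ?_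
    rw [mul_comm]
    exact mul_le_mul_of_nonneg_right (hC y) (norm_nonneg _)
  have hint : ∀ g : Vec N → Vec N, MemLp g (ENNReal.ofReal (critExp N)) volume →
      IntegrableOn (fun y => (inner ℝ (g y) (θ y) : ℝ)) B volume := by
    intro g hg
    have hgi : Integrable g (volume.restrict B) := (hg.restrict B).integrable hp1
    exact (hgi.norm.const_mul C).mono' (hgi.1.inner hθ.aestronglyMeasurable)
      (ae_of_all _ fun y => hbd _ y)
  have h2 : Tendsto (fun k => ∫ y in B, inner ℝ (s k y - Ω.indicator (w k) y) (θ y)) atTop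
      (𝓝 0) := by
    have h3 := hdB.const_mul C
    rw [mul_zero] at h3
    refine squeeze_zero_norm (fun k => ?_) h3
    rw [← integral_const_mul]
    exact norm_integral_le_of_norm_le ((((hd k).restrict B).integrable hp1).norm.const_mul C)
      (ae_of_all _ fun y => hbd _ y)
  have h4 := h2.add h1
  rw [add_zero] at h4
  refine h4.congr fun k => ?_
  rw [← integral_add (hint _ (hd k)) (hint _ (hWp k))]
  refine integral_congr_ae (ae_of_all _ fun y => ?_)
  simp only
  rw [← inner_add_left, sub_add_cancel]

theorem lintegral_enorm_rpow_le_of_norm_le {w : LCrit N Ω} {M : ℝ} (hM : ‖w‖ ≤ M) :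
    ∫⁻ x in Ω, ‖w x‖ₑ ^ critExp N ≤ ENNReal.ofReal (M ^ critExp N) := by
  have hp := one_lt_critExp N
  rw [lintegral_enorm_rpow_eq_ofReal (by linarith)
    (MemLp.integrable_norm_rpow_ofReal hp.le (Lp.memLp w))]
  refine ENNReal.ofReal_le_ofReal ?_
  rw [← Lp.norm_rpow_eq_integral hp.le w]
  exact Real.rpow_le_rpow (norm_nonneg w) hM (by linarith)

/-- The product of a cutoff function with a bounded sequence of curl free fields which converges
weakly to zero is asymptotically curl free. -/
theorem exists_curlFree_tendsto_integral_sub (hΩ : IsOpen Ω) {x₀ : Vec N} {R R' : ℝ} (hR : 0 < R)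
    (hRR' : R < R') (hball : Metric.closedBall x₀ R' ⊆ Ω) {φ : Vec N → ℝ} (hφ : ContDiff ℝ ∞ φ)
    (hφs : tsupport φ ⊆ Metric.closedBall x₀ R) (hφ1 : ∀ x, |φ x| ≤ 1) {w : ℕ → LCrit N Ω}
    (hw : ∀ k, w k ∈ curlFree N Ω) {M : ℝ} (hM : ∀ k, ‖w k‖ ≤ M)
    (hweak : ∀ θ, Tendsto (fun k => critPairing N Ω (w k) θ) atTop (𝓝 0)) :
    ∃ h : ℕ → curlFree N Ω, Tendsto (fun k => ∫ x in Ω, ‖φ x • w k x - (h k).1 x‖ ^ critExp N)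
      atTop (𝓝 0) := by
  have hp := one_lt_critExp N
  have hp0 : 0 ≤ critExp N := by linarith
  -- An intermediate radius: the potentials live on the open ball of radius `r`, which contains the
  -- closed ball of radius `R`, and `R' - r` leaves room for the mollification.
  obtain ⟨r, hRr, hrR'⟩ := exists_between hRR'
  have hδ0 : ∀ k : ℕ, 0 < 1 / ((k : ℝ) + 1) := fun k => by positivity
  have hδt : Tendsto (fun k : ℕ => 1 / ((k : ℝ) + 1)) atTop (𝓝 0) :=
    tendsto_one_div_add_atTop_nhds_zero_nat
  choose s ξ hsc hη2 hη3 hsw hξ using fun k =>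
    exists_approx_with_potential hΩ.measurableSet (hw k) hrR' hball (hδ0 k)
  have hWp : ∀ k, MemLp (Ω.indicator (w k)) (ENNReal.ofReal (critExp N)) volume := fun k =>
    (memLp_indicator_iff_restrict hΩ.measurableSet).2 (Lp.memLp (w k))
  have hdi : ∀ k, Integrable (fun x => ‖s k x - Ω.indicator (w k) x‖ ^ critExp N) volume :=
    fun k => MemLp.integrable_norm_rpow_ofReal hp.le ((hη2 k).sub (hWp k))
  have hBm : MeasurableSet (Metric.closedBall x₀ R) := measurableSet_closedBall
  have hBr : Metric.closedBall x₀ R ⊆ Metric.ball x₀ r := Metric.closedBall_subset_ball hRr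
  have hBΩ : Metric.closedBall x₀ R ⊆ Ω := (Metric.closedBall_subset_closedBall hRR'.le).trans hball
  have hBt : volume (Metric.closedBall x₀ R) ≠ ⊤ := measure_closedBall_lt_top.ne
  have hsM : ∀ k, ∫⁻ y in Metric.closedBall x₀ R, ‖s k y‖ₑ ^ critExp N ≤
      ENNReal.ofReal (M ^ critExp N) := fun k =>
    (setLIntegral_le_lintegral _ _).trans
      ((hsw k).trans (lintegral_enorm_rpow_le_of_norm_le (hM k)))
  have hsweak := tendsto_integral_inner_of_approx hΩ.measurableSet hBm hBt hBΩ hweak hη2 hδ0 hδt hη3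
  have hpot := tendsto_lintegral_potential hp hR hsc ENNReal.ofReal_ne_top hsM hsweak
    (fun k x hx => hξ k x (hBr hx))
  -- Potentials are determined up to constants; subtracting the mean values makes them tend to zero
  -- in L^p of the ball.
  obtain ⟨c, hc⟩ : ∃ c : ℕ → ℝ, ∀ k, c k =
      (volume.real (Metric.closedBall x₀ R))⁻¹ * ∫ z in Metric.closedBall x₀ R, ξ k z :=
    ⟨_, fun k => rfl⟩
  simp only [← hc] at hpot
  have hξc : ∀ k, ContinuousOn (fun x => ξ k x - c k) (Metric.closedBall x₀ R) := fun k x hx =>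
    ((hξ k x (hBr hx)).continuousAt.sub continuousAt_const).continuousWithinAt
  have hξi : ∀ k, IntegrableOn (fun x => ‖ξ k x - c k‖ ^ critExp N) (Metric.closedBall x₀ R)
      volume := fun k =>
    ((hξc k).norm.rpow_const fun x _ => Or.inr hp0).integrableOn_compact (isCompact_closedBall _ _)
  have hpot' : Tendsto (fun k => ∫ x in Metric.closedBall x₀ R, ‖ξ k x - c k‖ ^ critExp N) atTop
      (𝓝 0) := by
    have h1 := (ENNReal.tendsto_toReal ENNReal.zero_ne_top).comp hpot
    refine h1.congr fun k => ?_
    rw [Function.comp_apply, lintegral_enorm_rpow_eq_ofReal hp0 (hξi k),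
      ENNReal.toReal_ofReal (integral_nonneg fun x => by positivity)]
  choose h hh using fun k => exists_curlFree_eq_cutoff hφ (isCompact_closedBall x₀ R) hφs hBr hBΩ
    (hsc k) (hξ k) (c k)
  obtain ⟨C, hC⟩ : ∃ C, ∀ x, ‖gradient φ x‖ ≤ C := by
    have hgs : HasCompactSupport (gradient φ) :=
      HasCompactSupport.intro (isCompact_closedBall x₀ R) fun x hx =>
        gradient_eq_zero_of_notMem_tsupport fun h => hx (hφs h)
    exact hgs.exists_bound_of_continuous hφ.continuous_gradient
  refine ⟨h, ?_⟩
  have hlim := (hδt.add (hpot'.const_mul (C ^ critExp N))).const_mul (2 ^ (critExp N - 1))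
  rw [mul_zero, add_zero, mul_zero] at hlim
  refine squeeze_zero (fun k => integral_nonneg fun x => by positivity) (fun k => ?_) hlim
  refine (integral_norm_cutoff_sub_rpow_le hp.le hΩ.measurableSet hBm hφs hφ1 hC (hh k) (hdi k)
    (hξi k)).trans ?_
  exact mul_le_mul_of_nonneg_left (add_le_add (hη3 k) le_rfl) (by positivity)

end CurlFreeCompactness

/-! ### Measures related by a reverse Hölder inequality -/

section ConcentratedMeasures

variable {X : Type*} [TopologicalSpace X] [MeasurableSpace X]

/-- Inner regularity of α replaces E by a compact subset, and outer regularity of β and γ replaces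
it by open supersets; intersecting the two open sets serves both measures at once. -/
theorem measure_le_add_rpow_of_isCompact_isOpen {α β γ : Measure X} [α.InnerRegularCompactLTTop]
    [IsFiniteMeasure α] [β.OuterRegular] [IsFiniteMeasure β] [γ.OuterRegular] [IsFiniteMeasure γ]
    {a b : ℝ≥0∞} (ha : a ≠ ⊤) (hb : b ≠ ⊤) {r : ℝ}
    (h : ∀ K U : Set X, IsCompact K → IsOpen U → K ⊆ U → α K ≤ a * β U + b * γ U ^ r)
    (hr : 0 ≤ r) {E : Set X} (hE : MeasurableSet E) : α E ≤ a * β E + b * γ E ^ r := by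
  rw [hE.measure_eq_iSup_isCompact_of_ne_top (measure_ne_top α E)]
  refine iSup₂_le fun K hKE => iSup_le fun hK => ?_
  have hinv : Tendsto (fun n : ℕ => ((n : ℝ≥0∞) + 1)⁻¹) atTop (𝓝 0) := by
    have := ENNReal.tendsto_inv_nat_nhds_zero.comp (tendsto_add_atTop_nat 1)
    simpa [Function.comp_def] using this
  have hpos : ∀ n : ℕ, ((n : ℝ≥0∞) + 1)⁻¹ ≠ 0 := fun n => by simp
  choose U hEU hU hβ using fun n : ℕ => E.exists_isOpen_lt_add (measure_ne_top β E) (hpos n)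
  choose W hEW hW hγ using fun n : ℕ => E.exists_isOpen_lt_add (measure_ne_top γ E) (hpos n)
  have hlim : Tendsto (fun n : ℕ => a * (β E + ((n : ℝ≥0∞) + 1)⁻¹) +
      b * (γ E + ((n : ℝ≥0∞) + 1)⁻¹) ^ r) atTop (𝓝 (a * β E + b * γ E ^ r)) := by
    have h1 : Tendsto (fun n : ℕ => β E + ((n : ℝ≥0∞) + 1)⁻¹) atTop (𝓝 (β E)) := by
      simpa using hinv.const_add (β E)
    have h2 : Tendsto (fun n : ℕ => γ E + ((n : ℝ≥0∞) + 1)⁻¹) atTop (𝓝 (γ E)) := by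
      simpa using hinv.const_add (γ E)
    exact (ENNReal.Tendsto.const_mul h1 (Or.inr ha)).add
      (ENNReal.Tendsto.const_mul ((ENNReal.continuous_rpow_const.tendsto _).comp h2) (Or.inr hb))
  refine ge_of_tendsto' hlim fun n => ?_
  refine (h K (U n ∩ W n) hK ((hU n).inter (hW n))
    (hKE.trans (Set.subset_inter (hEU n) (hEW n)))).trans ?_
  gcongr
  · exact (measure_mono Set.inter_subset_left).trans (hβ n).le
  · exact (measure_mono Set.inter_subset_right).trans (hγ n).le

variable [BorelSpace X]

theorem countable_setOf_measure_singleton_ne_zero [T1Space X] (μ : Measure X) [IsFiniteMeasure μ] :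
    {x | μ {x} ≠ 0}.Countable := by
  have h := Measure.countable_meas_pos_of_disjoint_iUnion (μ := μ) (As := fun x : X => {x})
    (fun x => measurableSet_singleton x) fun x y hxy => by simpa using hxy
  simpa [pos_iff_ne_zero] using h

/-- Reverse Hölder inequalities force a measure to be atomic relative to `β`. -/
theorem measure_le_of_forall_le_add_rpow [T1Space X] [SecondCountableTopology X]
    {α β γ : Measure X} [IsFiniteMeasure β] [IsFiniteMeasure γ] [γ.OuterRegular] {r : ℝ}
    (hr : 1 < r)
    (h : ∀ a : ℝ≥0∞, 1 < a → ∃ b : ℝ≥0∞, b ≠ ⊤ ∧ ∀ E, MeasurableSet E →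
      α E ≤ a * β E + b * γ E ^ r)
    {E : Set X} (hE : MeasurableSet E) (hE0 : ∀ x ∈ E, γ {x} = 0) : α E ≤ β E := by
  have key : ∀ a : ℝ≥0∞, 1 < a → α E ≤ a * β E := by
    intro a ha
    obtain ⟨b, hb, hab⟩ := h a ha
    -- Points of `E` have `γ`-measure zero, so `E` is covered by countably many open sets of
    -- `γ`-measure at most `τ`. On disjoint pieces P of them `γ P ^ r ≤ τ ^ (r - 1) * γ P`, which
    -- can be summed; then `τ` tends to 0, and finally `a` tends to 1.
    have hτ : ∀ τ : ℝ≥0∞, τ ≠ 0 → α E ≤ a * β E + b * (τ ^ (r - 1) * γ E) := by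
      intro τ hτ0
      have hU : ∀ x : X, ∃ U ∈ 𝓝 x, x ∈ E → γ U ≤ τ := fun x => by
        by_cases hx : x ∈ E
        · obtain ⟨U, hxU, hUo, hUτ⟩ :=
            Set.exists_isOpen_lt_add {x} (measure_ne_top γ {x}) hτ0
          rw [hE0 x hx, zero_add] at hUτ
          exact ⟨U, hUo.mem_nhds (hxU rfl), fun _ => hUτ.le⟩
        · exact ⟨Set.univ, univ_mem, fun h => absurd h hx⟩
      choose U hUn hUτ using hU
      obtain ⟨t, htE, htc, ht⟩ := TopologicalSpace.countable_cover_nhdsWithin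
        (s := E) (f := fun x => interior (U x))
        fun x _ => mem_nhdsWithin_of_mem_nhds (interior_mem_nhds.2 (hUn x))
      rcases t.eq_empty_or_nonempty with rfl | hne
      · have : E = ∅ := by simpa using ht
        simp [this]
      obtain ⟨g, hg⟩ := htc.exists_eq_range hne
      set P : ℕ → Set X := fun i => E ∩ disjointed (fun i => interior (U (g i))) i with hP
      have hPm : ∀ i, MeasurableSet (P i) := fun i =>
        hE.inter (MeasurableSet.disjointed (fun i => isOpen_interior.measurableSet) i)
      have hPd : Pairwise (Function.onFun Disjoint P) := fun i j hij =>
        ((disjoint_disjointed _) hij).mono Set.inter_subset_right Set.inter_subset_right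
      have hPE : ⋃ i, P i = E := by
        rw [← Set.inter_iUnion, iUnion_disjointed, Set.inter_eq_left]
        refine ht.trans ?_
        rw [hg]
        simp
      have hPτ : ∀ i, γ (P i) ≤ τ := fun i => by
        refine le_trans (measure_mono ?_) (hUτ (g i) (htE (hg ▸ Set.mem_range_self i)))
        exact Set.inter_subset_right.trans ((disjointed_subset _ _).trans interior_subset)
      have hsum : ∀ ν : Measure X, ν E = ∑' i, ν (P i) := fun ν => by
        conv_lhs => rw [← hPE]
        exact measure_iUnion hPd hPm
      calc α E = ∑' i, α (P i) := hsum α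
        _ ≤ ∑' i, (a * β (P i) + b * (τ ^ (r - 1) * γ (P i))) := by
            refine ENNReal.tsum_le_tsum fun i => (hab _ (hPm i)).trans ?_
            gcongr
            calc γ (P i) ^ r = γ (P i) ^ (r - 1) * γ (P i) := by
                  conv_lhs => rw [show r = (r - 1) + 1 by ring,
                    ENNReal.rpow_add_of_nonneg _ _ (by linarith) (by norm_num), ENNReal.rpow_one]
              _ ≤ τ ^ (r - 1) * γ (P i) := by
                  gcongr
                  exact hPτ i
        _ = a * β E + b * (τ ^ (r - 1) * γ E) := by
            rw [ENNReal.tsum_add, ENNReal.tsum_mul_left, ENNReal.tsum_mul_left,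
              ENNReal.tsum_mul_left, ← hsum, ← hsum]
    have hlim : Tendsto (fun τ : ℝ≥0∞ => a * β E + b * (τ ^ (r - 1) * γ E)) (𝓝[≠] 0)
        (𝓝 (a * β E + b * (0 * γ E))) := by
      have h1 : Tendsto (fun τ : ℝ≥0∞ => τ ^ (r - 1)) (𝓝[≠] 0) (𝓝 0) := by
        have := (ENNReal.continuous_rpow_const (y := r - 1)).tendsto 0
        rw [ENNReal.zero_rpow_of_pos (by linarith)] at this
        exact this.mono_left nhdsWithin_le_nhds
      exact (ENNReal.Tendsto.const_mul (ENNReal.Tendsto.mul_const h1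
        (Or.inr (measure_ne_top γ E))) (Or.inr hb)).const_add _
    rw [zero_mul, mul_zero, add_zero] at hlim
    exact ge_of_tendsto hlim (eventually_mem_nhdsWithin.mono fun τ h => hτ τ h)
  have hlim : Tendsto (fun a : ℝ≥0∞ => a * β E) (𝓝[>] 1) (𝓝 (1 * β E)) :=
    (ENNReal.Tendsto.mul_const tendsto_id (Or.inr (measure_ne_top β E))).mono_left
      nhdsWithin_le_nhds
  rw [one_mul] at hlim
  exact ge_of_tendsto hlim (eventually_mem_nhdsWithin.mono fun a h => key a h)

theorem restrict_eq_sum_dirac [T1Space X] (μ : Measure X) {D : Set X} (hD : D.Countable) :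
    μ.restrict D = Measure.sum fun x : D => μ {(x : X)} • Measure.dirac (x : X) := by
  have : Countable D := hD.to_subtype
  have h := Measure.restrict_iUnion (μ := μ) (s := fun x : D => {(x : X)})
    (fun x y hxy => by simpa [Subtype.ext_iff] using hxy) fun x => measurableSet_singleton _
  rw [Set.iUnion_of_singleton_coe] at h
  rw [h]
  simp only [Measure.restrict_singleton]

end ConcentratedMeasures

/-- Smooth cutoff functions for a compact set in an open set. -/
theorem exists_contDiff_cutoff {N : ℕ} {K U : Set (Vec N)} (hK : IsCompact K) (hU : IsOpen U)
    (hKU : K ⊆ U) : ∃ φ : Vec N → ℝ, ContDiff ℝ ∞ φ ∧ HasCompactSupport φ ∧ tsupport φ ⊆ U ∧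
      (∀ x ∈ K, φ x = 1) ∧ ∀ x, φ x ∈ Set.Icc 0 1 := by
  obtain ⟨V, hVo, hKV, hVU, hVc⟩ := exists_open_between_and_isCompact_closure hK hU hKU
  obtain ⟨f, hf0, hf1, hf⟩ := exists_contMDiffMap_zero_one_of_isClosed (n := (⊤ : ℕ∞))
    (modelWithCornersSelf ℝ (Vec N)) (s := Vᶜ) (t := K) hVo.isClosed_compl hK.isClosed
    (Set.disjoint_left.2 fun x hx hxK => hx (hKV hxK))
  have hsupp : tsupport f ⊆ closure V := closure_mono fun x hx => by
    by_contra h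
    exact hx (hf0 h)
  exact ⟨f, f.contMDiff.contDiff, hVc.of_isClosed_subset (isClosed_tsupport _) hsupp,
    hsupp.trans hVU, fun x hx => hf1 hx, hf⟩

/-- Powers with smaller exponents are dominated by powers with larger exponents. -/
theorem exists_rpow_le_mul_rpow_add {q p : ℝ} (hq : 0 ≤ q) (hqp : q < p) {ε : ℝ} (hε : 0 < ε) :
    ∃ C, 0 ≤ C ∧ ∀ y, 0 ≤ y → y ^ q ≤ ε * y ^ p + C := by
  -- The threshold beyond which `y ^ (q - p) ≤ ε`; below it `y ^ q` is at most `m ^ q`.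
  set m := ε ^ (q - p)⁻¹ with hm
  have hm0 : 0 < m := Real.rpow_pos_of_pos hε _
  have hmε : m ^ (q - p) = ε := by
    rw [hm, ← Real.rpow_mul hε.le, inv_mul_cancel₀ (by linarith), Real.rpow_one]
  refine ⟨m ^ q, by positivity, fun y hy => ?_⟩
  rcases le_total y m with h | h
  · have h1 : y ^ q ≤ m ^ q := Real.rpow_le_rpow hy h hq
    have h2 : 0 ≤ ε * y ^ p := by positivity
    linarith
  · have hy0 : 0 < y := hm0.trans_le h
    have h1 : y ^ (q - p) ≤ ε := by
      rw [← hmε]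
      exact Real.rpow_le_rpow_of_nonpos hm0 h (by linarith)
    have h2 : y ^ q = y ^ (q - p) * y ^ p := by rw [← Real.rpow_add hy0]; ring_nf
    have h3 : y ^ (q - p) * y ^ p ≤ ε * y ^ p := by gcongr
    have h4 : 0 ≤ m ^ q := by positivity
    linarith

/-- Convexity of the p-th power at ‖u‖/(1 - t) and ‖v‖/t with weights 1 - t and t. The coefficient
(1 - t)^(1-p) of ‖u‖^p tends to 1 as t tends to 0, so it falls below any a > 1. -/
theorem exists_norm_add_rpow_le_mul_add {E : Type*} [NormedAddCommGroup E] {p a : ℝ} (hp : 1 < p)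
    (ha : 1 < a) : ∃ C, 0 ≤ C ∧ ∀ u v : E, ‖u + v‖ ^ p ≤ a * ‖u‖ ^ p + C * ‖v‖ ^ p := by
  obtain ⟨t, ht0, ht1, hta⟩ : ∃ t : ℝ, 0 < t ∧ t < 1 ∧ (1 - t) ^ (1 - p) < a := by
    have hc : Tendsto (fun t : ℝ => (1 - t) ^ (1 - p)) (𝓝[>] 0) (𝓝 ((1 - 0) ^ (1 - p))) := by
      refine Tendsto.mono_left ?_ nhdsWithin_le_nhds
      have h1 : Tendsto (fun t : ℝ => 1 - t) (𝓝 0) (𝓝 (1 - 0)) := tendsto_const_nhds.sub tendsto_id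
      exact h1.rpow_const (Or.inl (by norm_num))
    rw [sub_zero, Real.one_rpow] at hc
    have h2 : ∀ᶠ t : ℝ in 𝓝[>] 0, t < 1 := nhdsWithin_le_nhds (Iio_mem_nhds one_pos)
    obtain ⟨t, ⟨h3, h4⟩, h5⟩ := ((hc.eventually (gt_mem_nhds ha)).and h2).and
      self_mem_nhdsWithin |>.exists
    exact ⟨t, h5, h4, h3⟩
  refine ⟨t ^ (1 - p), by positivity, fun u v => ?_⟩
  have h1t : 0 < 1 - t := by linarith
  have hconv := (convexOn_rpow hp.le).2 (x := ‖u‖ / (1 - t)) (y := ‖v‖ / t)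
    (Set.mem_Ici.2 (by positivity)) (Set.mem_Ici.2 (by positivity)) h1t.le ht0.le (by ring)
  have hs : ∀ s y : ℝ, 0 < s → 0 ≤ y → s * (y / s) ^ p = s ^ (1 - p) * y ^ p := fun s y hs hy => by
    rw [Real.div_rpow hy hs.le, Real.rpow_sub hs, Real.rpow_one]
    ring
  simp only [smul_eq_mul] at hconv
  rw [hs _ _ h1t (norm_nonneg u), hs _ _ ht0 (norm_nonneg v), mul_div_cancel₀ _ h1t.ne',
    mul_div_cancel₀ _ ht0.ne'] at hconv
  calc ‖u + v‖ ^ p ≤ (‖u‖ + ‖v‖) ^ p :=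
        Real.rpow_le_rpow (norm_nonneg _) (norm_add_le u v) (by linarith)
    _ ≤ (1 - t) ^ (1 - p) * ‖u‖ ^ p + t ^ (1 - p) * ‖v‖ ^ p := hconv
    _ ≤ a * ‖u‖ ^ p + t ^ (1 - p) * ‖v‖ ^ p := by gcongr

theorem two_le_twoStar (N : ℕ) [Fact (3 ≤ N)] : 2 ≤ twoStar N := by
  rw [twoStar, ← ENNReal.ofReal_ofNat]
  exact ENNReal.ofReal_le_ofReal (critExp_gt_two N).le

/-- Multiplication by a continuous function with compact support, between `L^p` spaces. -/
theorem exists_continuousLinearMap_mul {N : ℕ} {E : Type*} [NormedAddCommGroup E] [NormedSpace ℝ E]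
    {g : Vec N → ℝ} (hg : Continuous g) (hgs : HasCompactSupport g) (p q : ℝ≥0∞)
    [Fact (1 ≤ p)] [Fact (1 ≤ q)] (hqp : q ≤ p) :
    ∃ T : Lp E p (volume : Measure (Vec N)) →L[ℝ] Lp E q (volume : Measure (Vec N)),
      ∀ f, T f =ᵐ[volume] fun x => g x • f x := by
  set s : ℝ≥0∞ := (q⁻¹ - p⁻¹)⁻¹ with hs
  have hsi : s⁻¹ = q⁻¹ - p⁻¹ := by rw [hs, inv_inv]
  have : ENNReal.HolderTriple s p q :=
    ⟨by rw [hsi]; exact tsub_add_cancel_of_le (ENNReal.inv_le_inv.2 hqp)⟩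
  have : Fact (1 ≤ s) := ⟨by
    rw [hs, ENNReal.one_le_inv]
    exact tsub_le_self.trans (ENNReal.inv_le_one.2 Fact.out)⟩
  have hgm : MemLp g s volume := hg.memLp_of_hasCompactSupport hgs
  refine ⟨(ContinuousLinearMap.lsmul ℝ ℝ).holderL volume s p q hgm.toLp, fun f => ?_⟩
  have h := (ContinuousLinearMap.lsmul ℝ ℝ : ℝ →L[ℝ] E →L[ℝ] E).coeFn_holder (r := q) hgm.toLp f
  filter_upwards [h, hgm.coeFn_toLp] with x hx hgx
  rw [ContinuousLinearMap.holderL_apply_apply, hx, hgx]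
  rfl

theorem IsTestField.continuous_jac {N : ℕ} {ψ : Vec N → Vec N} (hψ : IsTestField ψ) :
    Continuous (jac ψ) :=
  (linMat N).continuous_of_finiteDimensional.comp (hψ.1.continuous_fderiv (by simp))

theorem IsTestField.hasCompactSupport_jac {N : ℕ} {ψ : Vec N → Vec N} (hψ : IsTestField ψ) :
    HasCompactSupport (jac ψ) :=
  (hψ.2.fderiv ℝ).comp_left (g := linMat N) (map_zero _)

theorem jac_smul {N : ℕ} {φ : Vec N → ℝ} (hφ : Differentiable ℝ φ) {ψ : Vec N → Vec N}
    (hψ : Differentiable ℝ ψ) (x : Vec N) : jac (fun x => φ x • ψ x) x =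
      φ x • jac ψ x + linMat N ((fderiv ℝ φ x).smulRight (ψ x)) := by
  rw [jac, fderiv_fun_smul (hφ x) (hψ x), map_add, map_smul]
  rfl

theorem exists_norm_linMat_le (N : ℕ) : ∃ K : ℝ≥0, ∀ L, ‖linMat N L‖ ≤ K * ‖L‖ :=
  ⟨‖(linMat N).toContinuousLinearMap‖₊, fun L => (linMat N).toContinuousLinearMap.le_opNorm L⟩

/-! ### The Sobolev inequality with a cutoff function -/

namespace D12

variable {N : ℕ} [Fact (3 ≤ N)]

theorem exists_eLpNorm_testField_le : ∃ C : ℝ≥0, ∀ ψ : Vec N → Vec N, IsTestField ψ →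
    eLpNorm ψ (twoStar N) volume ≤ C * eLpNorm (jac ψ) 2 volume := by
  obtain ⟨C, hC⟩ := sobolev (N := N)
  refine ⟨C, fun ψ hψ => ?_⟩
  have h1 : MemLp ψ (twoStar N) volume := hψ.1.continuous.memLp_of_hasCompactSupport hψ.2
  have h2 : MemLp (jac ψ) 2 volume :=
    hψ.continuous_jac.memLp_of_hasCompactSupport hψ.hasCompactSupport_jac
  have h3 := hC ⟨(h1.toLp, h2.toLp), subset_closure
    ⟨ψ, hψ, h1.coeFn_toLp, h2.coeFn_toLp⟩⟩
  rw [Lp.enorm_def, Lp.enorm_def] at h3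
  rwa [← eLpNorm_congr_ae h1.coeFn_toLp, ← eLpNorm_congr_ae h2.coeFn_toLp]

/-- The Sobolev inequality with a cutoff function, for test fields. -/
theorem exists_eLpNorm_cutoff_testField_le : ∃ C : ℝ≥0, ∀ φ : Vec N → ℝ, ContDiff ℝ ∞ φ →
    ∀ ψ : Vec N → Vec N, IsTestField ψ →
    eLpNorm (fun x => φ x • ψ x) (twoStar N) volume ≤
      C * (eLpNorm (fun x => φ x • jac ψ x) 2 volume +
        eLpNorm (fun x => ‖fderiv ℝ φ x‖ • ψ x) 2 volume) := by
  obtain ⟨C, hC⟩ := exists_eLpNorm_testField_le (N := N)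
  obtain ⟨K, hK⟩ := exists_norm_linMat_le N
  refine ⟨C * (1 + K), fun φ hφ ψ hψ => ?_⟩
  have hφψ : IsTestField fun x => φ x • ψ x := ⟨hφ.smul hψ.1, hψ.2.smul_left (f := φ)⟩
  refine (hC _ hφψ).trans ?_
  -- The product rule: the gradient of φψ is φ∇ψ plus a term bounded by a multiple of |∇φ||ψ|.
  have hj := jac_smul (hφ.differentiable (by simp)) (hψ.1.differentiable (by simp))
  have hAm : AEStronglyMeasurable (fun x => φ x • jac ψ x) volume :=
    (hφ.continuous.smul hψ.continuous_jac).aestronglyMeasurable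
  have hDm : AEStronglyMeasurable (fun x => linMat N ((fderiv ℝ φ x).smulRight (ψ x)))
      volume := by
    refine (hφψ.continuous_jac.aestronglyMeasurable.sub hAm).congr (ae_of_all _ fun x => ?_)
    rw [Pi.sub_apply, hj, add_sub_cancel_left]
  have hDB := eLpNorm_le_nnreal_smul_eLpNorm_of_ae_le_mul (μ := (volume : Measure (Vec N)))
    (f := fun x => linMat N ((fderiv ℝ φ x).smulRight (ψ x)))
    (g := fun x => ‖fderiv ℝ φ x‖ • ψ x) (c := K) (ae_of_all _ fun x => by
      refine (hK _).trans ?_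
      rw [ContinuousLinearMap.norm_smulRight_apply, NNReal.val_eq_coe, NNReal.coe_mul, coe_nnnorm,
        norm_smul, norm_norm]) 2
  rw [ENNReal.smul_def, smul_eq_mul] at hDB
  rw [funext hj]
  push_cast
  rw [mul_assoc]
  refine mul_le_mul_right ((eLpNorm_add_le hAm hDm one_le_two).trans ?_) _
  rw [mul_add]
  exact add_le_add (le_mul_of_one_le_left' le_self_add)
    (hDB.trans (mul_le_mul_left le_add_self _))

/-- The Sobolev inequality with a cutoff function. -/
theorem exists_eLpNorm_cutoff_le : ∃ C : ℝ≥0, ∀ φ : Vec N → ℝ, ContDiff ℝ ∞ φ →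
    HasCompactSupport φ → ∀ u : D12 N,
    eLpNorm (fun x => φ x • u.fn x) (twoStar N) volume ≤
      C * (eLpNorm (fun x => φ x • u.grad x) 2 volume +
        eLpNorm (fun x => ‖fderiv ℝ φ x‖ • u.fn x) 2 volume) := by
  obtain ⟨C, hC⟩ := exists_eLpNorm_cutoff_testField_le (N := N)
  refine ⟨C, fun φ hφ hφs => ?_⟩
  have h2 := two_le_twoStar N
  obtain ⟨T₁, hT₁⟩ := exists_continuousLinearMap_mul (E := Vec N) hφ.continuous hφs
    (twoStar N) (twoStar N) le_rfl
  obtain ⟨T₂, hT₂⟩ := exists_continuousLinearMap_mul (E := Mat N) hφ.continuous hφs 2 2 le_rfl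
  obtain ⟨T₃, hT₃⟩ := exists_continuousLinearMap_mul (E := Vec N)
    (hφ.continuous_fderiv (by simp)).norm (hφs.fderiv ℝ).norm (twoStar N) 2 h2
  -- The multiplications are bounded operators, the one by |∇φ| even from L^{2*} to L² because of
  -- its compact support. So the inequality is a closed condition and passes from test fields to
  -- D^{1,2}.
  suffices h : (((testPairs N).topologicalClosure : Submodule ℝ _) : Set _) ⊆
      {p : Lp (Vec N) (twoStar N) (volume : Measure (Vec N)) ×
        Lp (Mat N) 2 (volume : Measure (Vec N)) |
          ‖T₁ p.1‖ₑ ≤ C * (‖T₂ p.2‖ₑ + ‖T₃ p.1‖ₑ)} by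
    intro u
    have hu := h u.2
    rw [Set.mem_ofPred_eq, Lp.enorm_def, Lp.enorm_def, Lp.enorm_def, eLpNorm_congr_ae (hT₁ _),
      eLpNorm_congr_ae (hT₂ _), eLpNorm_congr_ae (hT₃ _)] at hu
    exact hu
  rw [Submodule.topologicalClosure_coe]
  refine closure_minimal ?_ (isClosed_le (T₁.continuous.comp continuous_fst).enorm
    ((ENNReal.continuous_const_mul ENNReal.coe_ne_top).comp
      ((T₂.continuous.comp continuous_snd).enorm.add (T₃.continuous.comp continuous_fst).enorm)))
  rintro p ⟨ψ, hψ, hp1, hp2⟩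
  rw [Set.mem_ofPred_eq, Lp.enorm_def, Lp.enorm_def, Lp.enorm_def]
  have e1 : T₁ p.1 =ᵐ[volume] fun x => φ x • ψ x := by
    filter_upwards [hT₁ p.1, hp1] with x hx h
    rw [hx, h]
  have e2 : T₂ p.2 =ᵐ[volume] fun x => φ x • jac ψ x := by
    filter_upwards [hT₂ p.2, hp2] with x hx h
    rw [hx, h]
  have e3 : T₃ p.1 =ᵐ[volume] fun x => ‖fderiv ℝ φ x‖ • ψ x := by
    filter_upwards [hT₃ p.1, hp1] with x hx h
    rw [hx, h]
  rw [eLpNorm_congr_ae e1, eLpNorm_congr_ae e2, eLpNorm_congr_ae e3]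
  exact hC φ hφ ψ hψ

end D12

theorem MeasTendsto.tendsto_integral {N : ℕ} {h : ℕ → Vec N → ℝ} {μ : Measure (Vec N)}
    (hh : MeasTendsto h μ) {φ : Vec N → ℝ} (hφ : Continuous φ) (hφs : HasCompactSupport φ) :
    Tendsto (fun n => ∫ x, φ x * h n x) atTop (𝓝 (∫ x, φ x ∂μ)) :=
  hh ⟨⟨φ, hφ⟩, hφs.is_zero_at_infty⟩

theorem integral_withDensity_ofReal {α : Type*} [MeasurableSpace α] {μ : Measure α} {f : α → ℝ}
    (hf : AEMeasurable f μ) (hf0 : ∀ x, 0 ≤ f x) (g : α → ℝ) :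
    ∫ x, g x ∂(μ.withDensity fun x => ENNReal.ofReal (f x)) = ∫ x, g x * f x ∂μ := by
  rw [integral_withDensity_eq_integral_toReal_smul₀ hf.ennreal_ofReal
    (ae_of_all _ fun x => ENNReal.ofReal_lt_top)]
  refine integral_congr_ae (ae_of_all _ fun x => ?_)
  simp only [ENNReal.toReal_ofReal (hf0 x), smul_eq_mul, mul_comm]

/-- Sequences bounded in `L^p` which converge almost everywhere on a set of finite measure converge
in `L^q` for `q < p`. -/
theorem tendsto_integral_norm_rpow_of_tendsto_ae {α E : Type*} [MeasurableSpace α] {μ : Measure α}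
    [IsFiniteMeasure μ] [NormedAddCommGroup E] {p q : ℝ} (hp : 1 ≤ p) (hq : 0 < q) (hqp : q < p)
    {f : ℕ → α → E} (hf : ∀ n, MemLp (f n) (ENNReal.ofReal p) μ) {M : ℝ}
    (hM : ∀ n, ∫ x, ‖f n x‖ ^ p ∂μ ≤ M)
    (hlim : ∀ᵐ x ∂μ, Tendsto (fun n => f n x) atTop (𝓝 0)) :
    Tendsto (fun n => ∫ x, ‖f n x‖ ^ q ∂μ) atTop (𝓝 0) := by
  have h := tendsto_integral_of_le_mul_add (μ := μ) (ψ := fun n x => ‖f n x‖ ^ q)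
    (G := fun n x => ‖f n x‖ ^ p) (ψ₀ := fun _ => 0) (M := M)
    (fun n => ((hf n).1.norm.aemeasurable.pow_const q).aestronglyMeasurable)
    (integrable_zero _ _ _) ?_ (fun n => MemLp.integrable_norm_rpow_ofReal hp (hf n))
    (fun n => ae_of_all _ fun x => by positivity) hM ?_
  · simpa using h
  · filter_upwards [hlim] with x hx
    have := hx.norm.rpow_const (p := q) (Or.inr hq.le)
    rwa [norm_zero, Real.zero_rpow hq.ne'] at this
  · intro ε hε
    obtain ⟨C, -, hC⟩ := exists_rpow_le_mul_rpow_add hq.le hqp hε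
    refine ⟨fun _ => C, integrable_const C, fun n => ae_of_all _ fun x => ?_⟩
    rw [abs_of_nonneg (by positivity)]
    exact hC _ (norm_nonneg _)

theorem eLpNorm_two_eq {α E : Type*} [MeasurableSpace α] {μ : Measure α} [NormedAddCommGroup E]
    {f : α → E} (hf : MemLp f 2 μ) :
    eLpNorm f 2 μ = ENNReal.ofReal ((∫ x, ‖f x‖ ^ (2 : ℝ) ∂μ) ^ (2 : ℝ)⁻¹) := by
  have := eLpNorm_ofReal_eq (p := 2) one_le_two (f := f) (by simpa using hf)
  simpa using this

/-! ### Testing measures with powers of cutoff functions -/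

section Cutoff

variable {N : ℕ}

theorem integral_rpow_cutoff_le {U : Set (Vec N)} (hU : MeasurableSet U) {φ : Vec N → ℝ}
    (hφU : tsupport φ ⊆ U) (hφ : ∀ x, φ x ∈ Set.Icc 0 1) {s : ℝ} (hs : 0 < s)
    (μ : Measure (Vec N)) [IsFiniteMeasure μ] : ∫ x, φ x ^ s ∂μ ≤ μ.real U := by
  rw [← integral_indicator_one hU]
  refine integral_mono_of_nonneg (ae_of_all _ fun x => Real.rpow_nonneg (hφ x).1 _)
    ((integrable_const (1 : ℝ)).indicator hU) (ae_of_all _ fun x => ?_)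
  by_cases hx : x ∈ U
  · simpa [hx] using Real.rpow_le_one (hφ x).1 (hφ x).2 hs.le
  · simp [hx, image_eq_zero_of_notMem_tsupport fun h => hx (hφU h), Real.zero_rpow hs.ne']

theorem continuous_rpow_cutoff {φ : Vec N → ℝ} (hφ : Continuous φ) {s : ℝ} (hs : 0 < s) :
    Continuous fun x => φ x ^ s := hφ.rpow_const fun _ => Or.inr hs.le

theorem hasCompactSupport_rpow_cutoff {φ : Vec N → ℝ} (hφ : HasCompactSupport φ) {s : ℝ}
    (hs : 0 < s) : HasCompactSupport fun x => φ x ^ s :=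
  hφ.comp_left (g := fun y : ℝ => y ^ s) (Real.zero_rpow hs.ne')

theorem le_integral_rpow_cutoff {K : Set (Vec N)} (hK : MeasurableSet K) {φ : Vec N → ℝ}
    (hφc : Continuous φ) (hφs : HasCompactSupport φ) (hφK : ∀ x ∈ K, φ x = 1)
    (hφ : ∀ x, φ x ∈ Set.Icc 0 1) {s : ℝ} (hs : 0 < s)
    (μ : Measure (Vec N)) [IsFiniteMeasure μ] : μ.real K ≤ ∫ x, φ x ^ s ∂μ := by
  rw [← integral_indicator_one hK]
  refine integral_mono ((integrable_const (1 : ℝ)).indicator hK)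
    ((continuous_rpow_cutoff hφc hs).integrable_of_hasCompactSupport
      (hasCompactSupport_rpow_cutoff hφs hs)) fun x => ?_
  by_cases hx : x ∈ K
  · simp [hx, hφK x hx]
  · simpa [hx] using Real.rpow_nonneg (hφ x).1 _

/-- For a cutoff equal to 1 on K and supported in U, every positive power has integral between the
measures of K and U. This gives the inequality for compact K in open U, and regularity extends it.
-/
theorem measure_le_of_forall_integral_rpow_le {α β γ : Measure (Vec N)} [IsFiniteMeasure α]
    [IsFiniteMeasure β] [IsFiniteMeasure γ] {a b s t r : ℝ} (ha : 0 ≤ a) (hb : 0 ≤ b) (hs : 0 < s)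
    (ht : 0 < t) (hr : 0 ≤ r)
    (h : ∀ φ : Vec N → ℝ, ContDiff ℝ ∞ φ → HasCompactSupport φ → (∀ x, φ x ∈ Set.Icc 0 1) →
      ∫ x, φ x ^ s ∂α ≤ a * ∫ x, φ x ^ s ∂β + b * (∫ x, φ x ^ t ∂γ) ^ r)
    {E : Set (Vec N)} (hE : MeasurableSet E) :
    α E ≤ ENNReal.ofReal a * β E + ENNReal.ofReal b * γ E ^ r := by
  refine measure_le_add_rpow_of_isCompact_isOpen ENNReal.ofReal_ne_top ENNReal.ofReal_ne_top
    (fun K U hK hU hKU => ?_) hr hE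
  obtain ⟨φ, hφ1, hφ2, hφ3, hφ4, hφ5⟩ := exists_contDiff_cutoff hK hU hKU
  have h1 := h φ hφ1 hφ2 hφ5
  have h2 := le_integral_rpow_cutoff hK.measurableSet hφ1.continuous hφ2 hφ4 hφ5 hs α
  have h3 := integral_rpow_cutoff_le hU.measurableSet hφ3 hφ5 hs β
  have h4 := integral_rpow_cutoff_le hU.measurableSet hφ3 hφ5 ht γ
  have h5 : 0 ≤ ∫ x, φ x ^ t ∂γ := integral_nonneg fun x => Real.rpow_nonneg (hφ5 x).1 _
  have h6 : α.real K ≤ a * β.real U + b * γ.real U ^ r := by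
    refine h2.trans (h1.trans ?_)
    gcongr
  rw [← ofReal_measureReal (μ := α), ← ofReal_measureReal (μ := β), ← ofReal_measureReal (μ := γ),
    ENNReal.ofReal_rpow_of_nonneg measureReal_nonneg hr, ← ENNReal.ofReal_mul ha,
    ← ENNReal.ofReal_mul hb, ← ENNReal.ofReal_add (by positivity) (by positivity)]
  exact ENNReal.ofReal_le_ofReal h6

theorem measure_le_of_forall_integral_le {α β : Measure (Vec N)} [IsFiniteMeasure α]
    [IsFiniteMeasure β]
    (h : ∀ φ : Vec N → ℝ, ContDiff ℝ ∞ φ → HasCompactSupport φ → (∀ x, φ x ∈ Set.Icc 0 1) →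
      ∫ x, φ x ∂α ≤ ∫ x, φ x ∂β) : α ≤ β := by
  refine Measure.le_iff.2 fun E hE => ?_
  have := measure_le_of_forall_integral_rpow_le (α := α) (β := β) (γ := β) (a := 1) (b := 0)
    (s := 1) (t := 1) (r := 1) zero_le_one le_rfl one_pos one_pos zero_le_one
    (fun φ h1 h2 h3 => by simpa using h φ h1 h2 h3) hE
  simpa using this

end Cutoff

/-! ### The measures with densities |∇u|² and |u|^{2*} -/

namespace D12

variable {N : ℕ} [Fact (3 ≤ N)]

theorem coeFn_fn_sub (u v : D12 N) : (u - v).fn =ᵐ[volume] fun x => u.fn x - v.fn x := by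
  rw [map_sub]
  exact Lp.coeFn_sub _ _

theorem coeFn_grad_sub (u v : D12 N) :
    (u - v).grad =ᵐ[volume] fun x => u.grad x - v.grad x := by
  rw [map_sub]
  exact Lp.coeFn_sub _ _

theorem memLp_fn (u : D12 N) : MemLp u.fn (ENNReal.ofReal (critExp N)) volume := Lp.memLp u.fn

theorem memLp_grad (u : D12 N) : MemLp u.grad (ENNReal.ofReal 2) volume := by
  have := Lp.memLp u.grad
  simpa using this

theorem exists_norm_fn_le : ∃ C, 0 ≤ C ∧ ∀ u : D12 N, ‖u.fn‖ ≤ C * ‖u‖ := by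
  obtain ⟨C, hC⟩ := sobolev (N := N)
  refine ⟨C, C.2, fun u => ?_⟩
  have := hC u
  rw [← ofReal_norm, ← ofReal_norm, ← ENNReal.ofReal_coe_nnreal,
    ← ENNReal.ofReal_mul NNReal.zero_le_coe] at this
  exact (ENNReal.ofReal_le_ofReal_iff (by positivity)).1 this

theorem integrable_norm_fn_rpow (u : D12 N) :
    Integrable (fun x => ‖u.fn x‖ ^ critExp N) volume :=
  MemLp.integrable_norm_rpow_ofReal (one_lt_critExp N).le u.memLp_fn

theorem integrable_norm_grad_sq (u : D12 N) : Integrable (fun x => ‖u.grad x‖ ^ 2) volume := by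
  simpa using MemLp.integrable_norm_rpow_ofReal one_le_two u.memLp_grad

/-- The measure `|∇u|² dx`. -/
noncomputable def gradMeasure (u : D12 N) : Measure (Vec N) :=
  volume.withDensity fun x => ENNReal.ofReal (‖u.grad x‖ ^ 2)

/-- The measure `|u|^{2*} dx`. -/
noncomputable def fnMeasure (u : D12 N) : Measure (Vec N) :=
  volume.withDensity fun x => ENNReal.ofReal (‖u.fn x‖ ^ critExp N)

instance (u : D12 N) : IsFiniteMeasure u.gradMeasure :=
  isFiniteMeasure_withDensity_ofReal u.integrable_norm_grad_sq.2

instance (u : D12 N) : IsFiniteMeasure u.fnMeasure :=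
  isFiniteMeasure_withDensity_ofReal u.integrable_norm_fn_rpow.2

theorem integral_gradMeasure (u : D12 N) (g : Vec N → ℝ) :
    ∫ x, g x ∂u.gradMeasure = ∫ x, g x * ‖u.grad x‖ ^ 2 :=
  integral_withDensity_ofReal u.integrable_norm_grad_sq.aemeasurable (fun x => by positivity) g

theorem integral_fnMeasure (u : D12 N) (g : Vec N → ℝ) :
    ∫ x, g x ∂u.fnMeasure = ∫ x, g x * ‖u.fn x‖ ^ critExp N :=
  integral_withDensity_ofReal u.integrable_norm_fn_rpow.aemeasurable (fun x => by positivity) g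

/-- The Sobolev inequality with a cutoff function, for integrals. -/
theorem exists_integral_cutoff_le : ∃ C : ℝ, 0 ≤ C ∧ ∀ φ : Vec N → ℝ, ContDiff ℝ ∞ φ →
    HasCompactSupport φ → ∀ u : D12 N,
    ∫ x, ‖φ x • u.fn x‖ ^ critExp N ≤ (C * ((∫ x, ‖φ x • u.grad x‖ ^ (2 : ℝ)) ^ (2 : ℝ)⁻¹ +
      (∫ x, ‖‖fderiv ℝ φ x‖ • u.fn x‖ ^ (2 : ℝ)) ^ (2 : ℝ)⁻¹)) ^ critExp N := by
  obtain ⟨C, hC⟩ := exists_eLpNorm_cutoff_le (N := N)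
  have hp := one_lt_critExp N
  refine ⟨C, C.2, fun φ hφ hφs u => ?_⟩
  have h2 := two_le_twoStar N
  obtain ⟨T₁, hT₁⟩ := exists_continuousLinearMap_mul (E := Vec N) hφ.continuous hφs
    (twoStar N) (twoStar N) le_rfl
  obtain ⟨T₂, hT₂⟩ := exists_continuousLinearMap_mul (E := Mat N) hφ.continuous hφs 2 2 le_rfl
  obtain ⟨T₃, hT₃⟩ := exists_continuousLinearMap_mul (E := Vec N)
    (hφ.continuous_fderiv (by simp)).norm (hφs.fderiv ℝ).norm (twoStar N) 2 h2
  have m1 : MemLp (fun x => φ x • u.fn x) (ENNReal.ofReal (critExp N)) volume :=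
    (memLp_congr_ae (hT₁ u.fn)).1 (Lp.memLp _)
  have m2 : MemLp (fun x => φ x • u.grad x) 2 volume :=
    (memLp_congr_ae (hT₂ u.grad)).1 (Lp.memLp _)
  have m3 : MemLp (fun x => ‖fderiv ℝ φ x‖ • u.fn x) 2 volume :=
    (memLp_congr_ae (hT₃ u.fn)).1 (Lp.memLp _)
  have h : eLpNorm (fun x => φ x • u.fn x) (ENNReal.ofReal (critExp N)) volume ≤ _ :=
    hC φ hφ hφs u
  rw [eLpNorm_ofReal_eq hp.le m1, eLpNorm_two_eq m2, eLpNorm_two_eq m3] at h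
  have i1 : 0 ≤ ∫ x, ‖φ x • u.fn x‖ ^ critExp N := integral_nonneg fun x => by positivity
  have i2 : 0 ≤ ∫ x, ‖φ x • u.grad x‖ ^ (2 : ℝ) := integral_nonneg fun x => by positivity
  have i3 : 0 ≤ ∫ x, ‖‖fderiv ℝ φ x‖ • u.fn x‖ ^ (2 : ℝ) := integral_nonneg fun x => by positivity
  rw [← ENNReal.ofReal_add (by positivity) (by positivity), ← ENNReal.ofReal_coe_nnreal,
    ← ENNReal.ofReal_mul NNReal.zero_le_coe,
    ENNReal.ofReal_le_ofReal_iff (mul_nonneg NNReal.zero_le_coe (by positivity))] at h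
  have h' := Real.rpow_le_rpow (by positivity) h (by linarith : 0 ≤ critExp N)
  rwa [← Real.rpow_mul i1, inv_mul_cancel₀ (by linarith), Real.rpow_one] at h'

end D12

/-! ### The reverse Hölder inequality for limit measures -/

namespace D12

variable {N : ℕ} [Fact (3 ≤ N)]

/-- The lower order term of the Sobolev inequality disappears in the limit. On the compact support
of φ, a.e. convergence and boundedness in L^{2*} give convergence in L², as 2 < 2*; no compact
embedding is needed. -/
theorem tendsto_integral_fderiv_smul_sub {u : ℕ → D12 N} {u₀ : D12 N} {M : ℝ}
    (hM : ∀ n, ‖u n‖ ≤ M)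
    (hae : ∀ᵐ x, Tendsto (fun n => (u n).fn x) atTop (𝓝 (u₀.fn x))) {φ : Vec N → ℝ}
    (hφ : ContDiff ℝ ∞ φ) (hφs : HasCompactSupport φ) :
    Tendsto (fun n => ∫ x, ‖‖fderiv ℝ φ x‖ • (u n - u₀).fn x‖ ^ (2 : ℝ)) atTop (𝓝 0) := by
  have hp := one_lt_critExp N
  obtain ⟨C, hC0, hC⟩ := exists_norm_fn_le (N := N)
  obtain ⟨L, hL⟩ := (hφs.fderiv ℝ).exists_bound_of_continuous (hφ.continuous_fderiv (by simp))
  have hL0 : 0 ≤ L := (norm_nonneg _).trans (hL 0)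
  have : IsFiniteMeasure (volume.restrict (tsupport φ)) := ⟨by simpa using hφs.measure_lt_top⟩
  have hb : ∀ n, ∫ x, ‖(u n - u₀).fn x‖ ^ critExp N ≤ (C * (M + ‖u₀‖)) ^ critExp N := fun n => by
    have h1 := Lp.norm_rpow_eq_integral hp.le ((u n - u₀).fn)
    refine (le_of_eq h1.symm).trans ?_
    refine Real.rpow_le_rpow (norm_nonneg ((u n - u₀).fn)) ((hC _).trans ?_) (by linarith)
    have h2 : ‖u n - u₀‖ ≤ M + ‖u₀‖ := (norm_sub_le (u n) u₀).trans (by linarith [hM n])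
    exact mul_le_mul_of_nonneg_left h2 hC0
  have h1 := tendsto_integral_norm_rpow_of_tendsto_ae (μ := volume.restrict (tsupport φ)) hp.le
    two_pos (critExp_gt_two N) (f := fun n => (u n - u₀).fn) (fun n => (memLp_fn _).restrict _)
    (M := (C * (M + ‖u₀‖)) ^ critExp N)
    (fun n => (setIntegral_le_integral (integrable_norm_fn_rpow _)
      (ae_of_all _ fun x => by positivity)).trans (hb n)) ?_
  · have h2 := h1.const_mul (L ^ (2 : ℝ))
    rw [mul_zero] at h2
    refine squeeze_zero (fun n => integral_nonneg fun x => by positivity) (fun n => ?_) h2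
    have hi : IntegrableOn (fun x => ‖(u n - u₀).fn x‖ ^ (2 : ℝ)) (tsupport φ) volume := by
      have : MemLp (u n - u₀).fn (ENNReal.ofReal 2) (volume.restrict (tsupport φ)) :=
        ((memLp_fn _).restrict _).mono_exponent (ENNReal.ofReal_le_ofReal (critExp_gt_two N).le)
      exact MemLp.integrable_norm_rpow_ofReal one_le_two this
    rw [← integral_const_mul, ← integral_indicator (isClosed_tsupport φ).measurableSet]
    refine integral_mono_of_nonneg (ae_of_all _ fun x => by positivity)
      (IntegrableOn.integrable_indicator (Integrable.const_mul hi _)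
        (isClosed_tsupport φ).measurableSet)
      (ae_of_all _ fun x => ?_)
    by_cases hx : x ∈ tsupport φ
    · simp only [Set.indicator_of_mem hx]
      rw [norm_smul, norm_norm, Real.mul_rpow (norm_nonneg _) (norm_nonneg _)]
      exact mul_le_mul_of_nonneg_right
        (Real.rpow_le_rpow (norm_nonneg _) (hL x) two_pos.le) (by positivity)
    · simp only [Set.indicator_of_notMem hx]
      rw [image_eq_zero_of_notMem_tsupport (f := fderiv ℝ φ)
        fun h => hx (tsupport_fderiv_subset ℝ h)]
      simp
  · filter_upwards [ae_restrict_of_ae hae,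
      ae_restrict_of_ae (ae_all_iff.2 fun n => coeFn_fn_sub (u n) u₀)] with x hx hs
    simp only [hs]
    simpa using hx.sub_const (u₀.fn x)

/-- The reverse Hölder inequality for the defect of compactness. -/
theorem exists_integral_rpow_cutoff_le {a : ℝ} (ha : 1 < a) : ∃ b : ℝ, 0 ≤ b ∧
    ∀ (u : ℕ → D12 N) (u₀ : D12 N) (M : ℝ) (μ ρ : Measure (Vec N)) [IsFiniteMeasure μ]
      [IsFiniteMeasure ρ],
      (∀ n, ‖u n‖ ≤ M) → (∀ᵐ x, Tendsto (fun n => (u n).fn x) atTop (𝓝 (u₀.fn x))) →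
      MeasTendsto (fun n x => ‖(u n).grad x‖ ^ 2) μ →
      MeasTendsto (fun n x => ‖(u n).fn x‖ ^ critExp N) ρ →
      ∀ φ : Vec N → ℝ, ContDiff ℝ ∞ φ → HasCompactSupport φ → (∀ x, φ x ∈ Set.Icc 0 1) →
      ∫ x, φ x ^ critExp N ∂ρ ≤ a * ∫ x, φ x ^ critExp N ∂u₀.fnMeasure +
        b * (∫ x, φ x ^ (2 : ℝ) ∂(μ + u₀.gradMeasure)) ^ (critExp N / 2) := by
  have hp := one_lt_critExp N
  have hp0 : 0 < critExp N := by linarith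
  obtain ⟨c, hc0, hc⟩ := exists_norm_add_rpow_le_mul_add (E := Vec N) hp ha
  obtain ⟨C, hC0, hC⟩ := exists_integral_cutoff_le (N := N)
  refine ⟨c * (C * 2 ^ (2 : ℝ)⁻¹) ^ critExp N, by positivity, ?_⟩
  intro u u₀ M μ ρ _ _ hM hae hμ hρ φ hφ hφs hφ01
  have hφ0 : ∀ x, 0 ≤ φ x := fun x => (hφ01 x).1
  have hi : ∀ {s : ℝ} {f : Vec N → ℝ}, 0 < s → Integrable f volume →
      Integrable (fun x => φ x ^ s * f x) volume := fun {s f} hs hf => by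
    refine hf.bdd_mul (c := 1) (continuous_rpow_cutoff hφ.continuous hs).aestronglyMeasurable
      (ae_of_all _ fun x => ?_)
    rw [Real.norm_eq_abs, abs_of_nonneg (Real.rpow_nonneg (hφ0 x) _)]
    exact Real.rpow_le_one (hφ0 x) (hφ01 x).2 hs.le
  have hρt := hρ.tendsto_integral (continuous_rpow_cutoff hφ.continuous hp0)
    (hasCompactSupport_rpow_cutoff hφs hp0)
  have hμt := hμ.tendsto_integral (continuous_rpow_cutoff hφ.continuous two_pos)
    (hasCompactSupport_rpow_cutoff hφs two_pos)
  have hBt := tendsto_integral_fderiv_smul_sub hM hae hφ hφs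
  -- The crude bound |A - B|² ≤ 2(|A|² + |B|²) suffices, since only the atoms of the measure on the
  -- right are used later; it is the reason for the measure `μ + u₀.gradMeasure`.
  have hA : ∀ n, ∫ x, ‖φ x • (u n - u₀).grad x‖ ^ (2 : ℝ) ≤
      2 * ((∫ x, φ x ^ (2 : ℝ) * ‖(u n).grad x‖ ^ 2) +
        ∫ x, φ x ^ (2 : ℝ) * ‖u₀.grad x‖ ^ 2) := fun n => by
    have i1 := hi two_pos (u n).integrable_norm_grad_sq
    have i2 := hi two_pos u₀.integrable_norm_grad_sq
    rw [← integral_add i1 i2, ← integral_const_mul]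
    refine integral_mono_of_nonneg (ae_of_all _ fun x => by positivity)
      ((i1.add i2).const_mul 2) ?_
    filter_upwards [coeFn_grad_sub (u n) u₀] with x hx
    rw [hx, norm_smul, Real.norm_eq_abs, abs_of_nonneg (hφ0 x),
      Real.mul_rpow (hφ0 x) (norm_nonneg _)]
    have h1 := norm_sub_rpow_le one_le_two ((u n).grad x) (u₀.grad x)
    have h2 : 0 ≤ φ x ^ (2 : ℝ) := Real.rpow_nonneg (hφ0 x) _
    have h3 := mul_le_mul_of_nonneg_left h1 h2
    simp only [Real.rpow_two] at h3 ⊢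
    norm_num at h3
    linarith
  -- Split `u n` into `u₀`, with coefficient `a` close to 1, and `u n - u₀`, to which the Sobolev
  -- inequality with cutoff applies.
  have hmain : ∀ n, ∫ x, φ x ^ critExp N * ‖(u n).fn x‖ ^ critExp N ≤
      a * ∫ x, φ x ^ critExp N ∂u₀.fnMeasure + c * (C * ((2 *
        ((∫ x, φ x ^ (2 : ℝ) * ‖(u n).grad x‖ ^ 2) +
          ∫ x, φ x ^ (2 : ℝ) * ‖u₀.grad x‖ ^ 2)) ^ (2 : ℝ)⁻¹ +
        (∫ x, ‖‖fderiv ℝ φ x‖ • (u n - u₀).fn x‖ ^ (2 : ℝ)) ^ (2 : ℝ)⁻¹)) ^ critExp N := by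
    intro n
    have i1 := hi hp0 u₀.integrable_norm_fn_rpow
    have i2 := hi hp0 (u n - u₀).integrable_norm_fn_rpow
    have h1 : ∫ x, φ x ^ critExp N * ‖(u n).fn x‖ ^ critExp N ≤
        ∫ x, (a * (φ x ^ critExp N * ‖u₀.fn x‖ ^ critExp N) +
          c * (φ x ^ critExp N * ‖(u n - u₀).fn x‖ ^ critExp N)) := by
      refine integral_mono_ae (hi hp0 (u n).integrable_norm_fn_rpow)
        ((i1.const_mul a).add (i2.const_mul c)) ?_
      filter_upwards [coeFn_fn_sub (u n) u₀] with x hx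
      have h2 := hc (u₀.fn x) ((u n - u₀).fn x)
      rw [hx, add_sub_cancel] at h2
      have h3 := mul_le_mul_of_nonneg_left h2 (Real.rpow_nonneg (hφ0 x) (critExp N))
      rw [hx]
      linarith
    rw [integral_add (i1.const_mul a) (i2.const_mul c), integral_const_mul,
      integral_const_mul] at h1
    have h2 : ∫ x, φ x ^ critExp N * ‖(u n - u₀).fn x‖ ^ critExp N =
        ∫ x, ‖φ x • (u n - u₀).fn x‖ ^ critExp N := by
      refine integral_congr_ae (ae_of_all _ fun x => ?_)
      simp only [norm_smul, Real.norm_eq_abs, abs_of_nonneg (hφ0 x),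
        Real.mul_rpow (hφ0 x) (norm_nonneg _)]
    rw [h2] at h1
    rw [integral_fnMeasure]
    refine h1.trans (add_le_add le_rfl (mul_le_mul_of_nonneg_left
      ((hC φ hφ hφs (u n - u₀)).trans ?_) hc0))
    have i3 : 0 ≤ ∫ x, ‖φ x • (u n - u₀).grad x‖ ^ (2 : ℝ) :=
      integral_nonneg fun x => by positivity
    have i4 : 0 ≤ ∫ x, ‖‖fderiv ℝ φ x‖ • (u n - u₀).fn x‖ ^ (2 : ℝ) :=
      integral_nonneg fun x => by positivity
    refine Real.rpow_le_rpow (by positivity) (mul_le_mul_of_nonneg_left (add_le_add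
      (Real.rpow_le_rpow i3 (hA n) (by norm_num)) le_rfl) hC0) hp0.le
  have hlim := (((((hμt.add_const (∫ x, φ x ^ (2 : ℝ) * ‖u₀.grad x‖ ^ 2)).const_mul 2).rpow_const
    (p := (2 : ℝ)⁻¹) (Or.inr (by norm_num))).add (hBt.rpow_const (p := (2 : ℝ)⁻¹)
      (Or.inr (by norm_num)))).const_mul C).rpow_const (p := critExp N) (Or.inr hp0.le)
  have hlim2 := (hlim.const_mul c).const_add (a * ∫ x, φ x ^ critExp N ∂u₀.fnMeasure)
  refine (le_of_tendsto_of_tendsto' hρt hlim2 hmain).trans (le_of_eq ?_)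
  have hI : ∫ x, φ x ^ (2 : ℝ) ∂(μ + u₀.gradMeasure) =
      (∫ x, φ x ^ (2 : ℝ) ∂μ) + ∫ x, φ x ^ (2 : ℝ) * ‖u₀.grad x‖ ^ 2 := by
    have hcs : ∀ ν : Measure (Vec N), IsFiniteMeasure ν →
        Integrable (fun x => φ x ^ (2 : ℝ)) ν := fun ν _ =>
      (continuous_rpow_cutoff hφ.continuous two_pos).integrable_of_hasCompactSupport
        (hasCompactSupport_rpow_cutoff hφs two_pos)
    rw [integral_add_measure (hcs _ inferInstance) (hcs _ inferInstance), integral_gradMeasure]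
  have hI0 : 0 ≤ ∫ x, φ x ^ (2 : ℝ) ∂(μ + u₀.gradMeasure) :=
    integral_nonneg fun x => Real.rpow_nonneg (hφ0 x) _
  rw [← hI, Real.zero_rpow (by norm_num), add_zero, Real.mul_rpow two_pos.le hI0, ← mul_assoc C,
    Real.mul_rpow (by positivity) (by positivity), ← Real.rpow_mul hI0, mul_assoc c]
  congr 4
  ring

end D12

/-! ### Concentration compactness -/

namespace D12

variable {N : ℕ} [Fact (3 ≤ N)]

/-- Fatou's lemma, tested with cutoff functions. -/
theorem fnMeasure_le {u : ℕ → D12 N} {u₀ : D12 N} {ρ : Measure (Vec N)} [IsFiniteMeasure ρ]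
    (hae : ∀ᵐ x, Tendsto (fun n => (u n).fn x) atTop (𝓝 (u₀.fn x)))
    (hρ : MeasTendsto (fun n x => ‖(u n).fn x‖ ^ critExp N) ρ) : u₀.fnMeasure ≤ ρ := by
  have hp0 : 0 < critExp N := by linarith [one_lt_critExp N]
  refine measure_le_of_forall_integral_le fun φ hφ hφs hφ01 => ?_
  have hi : ∀ v : D12 N, Integrable (fun x => φ x * ‖v.fn x‖ ^ critExp N) volume := fun v => by
    refine v.integrable_norm_fn_rpow.bdd_mul (c := 1) hφ.continuous.aestronglyMeasurable
      (ae_of_all _ fun x => ?_)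
    rw [Real.norm_eq_abs, abs_of_nonneg (hφ01 x).1]
    exact (hφ01 x).2
  rw [integral_fnMeasure]
  have ht := hρ.tendsto_integral hφ.continuous hφs
  refine le_of_forall_pos_le_add fun ε hε => ?_
  have h1 := eventually_integral_sub_le_of_tendsto_ae (fun n => hi (u n))
    (fun n => ae_of_all _ fun x => mul_nonneg (hφ01 x).1 (by positivity)) (hi u₀)
    (hae.mono fun x hx => (hx.norm.rpow_const (Or.inr hp0.le)).const_mul (φ x)) hε
  have := ge_of_tendsto ht h1
  linarith

/-- Weak lower semicontinuity, localised: expand ∫φ|∇u_n - ∇u₀|² ≥ 0 and use weak convergence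
against the field φ∇u₀. -/
theorem gradMeasure_le {u : ℕ → D12 N} {u₀ : D12 N} {μ : Measure (Vec N)} [IsFiniteMeasure μ]
    (hweak : ∀ G : Lp (Mat N) 2 (volume : Measure (Vec N)),
      Tendsto (fun n => inner ℝ (u n).grad G) atTop (𝓝 (inner ℝ u₀.grad G)))
    (hμ : MeasTendsto (fun n x => ‖(u n).grad x‖ ^ 2) μ) : u₀.gradMeasure ≤ μ := by
  refine measure_le_of_forall_integral_le fun φ hφ hφs hφ01 => ?_
  have hi : ∀ v : D12 N, Integrable (fun x => φ x * ‖v.grad x‖ ^ 2) volume := fun v => by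
    refine v.integrable_norm_grad_sq.bdd_mul (c := 1) hφ.continuous.aestronglyMeasurable
      (ae_of_all _ fun x => ?_)
    rw [Real.norm_eq_abs, abs_of_nonneg (hφ01 x).1]
    exact (hφ01 x).2
  rw [integral_gradMeasure]
  obtain ⟨T, hT⟩ := exists_continuousLinearMap_mul (E := Mat N) hφ.continuous hφs 2 2 le_rfl
  have hinner : ∀ v : D12 N, inner ℝ v.grad (T u₀.grad) =
      ∫ x, φ x * inner ℝ (v.grad x) (u₀.grad x) := fun v => by
    rw [L2.inner_def]
    refine integral_congr_ae ?_
    filter_upwards [hT u₀.grad] with x hx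
    rw [hx, inner_smul_right]
  have hin : ∀ v : D12 N, Integrable (fun x => φ x * inner ℝ (v.grad x) (u₀.grad x)) volume :=
    fun v => by
      refine (L2.integrable_inner v.grad (T u₀.grad)).congr ?_
      filter_upwards [hT u₀.grad] with x hx
      rw [hx, inner_smul_right]
  have h1 := hweak (T u₀.grad)
  simp only [hinner, real_inner_self_eq_norm_sq] at h1
  have h2 := ((hμ.tendsto_integral hφ.continuous hφs).sub (h1.const_mul 2)).add_const
    (∫ x, φ x * ‖u₀.grad x‖ ^ 2)
  have h3 : ∀ n, 0 ≤ (∫ x, φ x * ‖(u n).grad x‖ ^ 2) -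
      2 * (∫ x, φ x * inner ℝ ((u n).grad x) (u₀.grad x)) + ∫ x, φ x * ‖u₀.grad x‖ ^ 2 := by
    intro n
    have hs : Integrable (fun x => φ x * ‖(u n).grad x‖ ^ 2 -
        2 * (φ x * inner ℝ ((u n).grad x) (u₀.grad x))) volume :=
      (hi (u n)).sub ((hin (u n)).const_mul 2)
    rw [← integral_const_mul, ← integral_sub (hi (u n)) ((hin (u n)).const_mul 2),
      ← integral_add hs (hi u₀)]
    refine integral_nonneg fun x => ?_
    have h4 := norm_sub_sq_real ((u n).grad x) (u₀.grad x)
    have h5 : 0 ≤ φ x * ‖(u n).grad x - u₀.grad x‖ ^ 2 := mul_nonneg (hφ01 x).1 (by positivity)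
    rw [h4] at h5
    simp only [Pi.zero_apply]
    linarith
  have := ge_of_tendsto' h2 h3
  linarith

/-- The concentration compactness principle. -/
theorem exists_countable_concentration {u : ℕ → D12 N} {u₀ : D12 N} {M : ℝ}
    {μ ρ : Measure (Vec N)} [IsFiniteMeasure μ] [IsFiniteMeasure ρ] (hM : ∀ n, ‖u n‖ ≤ M)
    (hweak : ∀ G : Lp (Mat N) 2 (volume : Measure (Vec N)),
      Tendsto (fun n => inner ℝ (u n).grad G) atTop (𝓝 (inner ℝ u₀.grad G)))
    (hae : ∀ᵐ x, Tendsto (fun n => (u n).fn x) atTop (𝓝 (u₀.fn x)))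
    (hμ : MeasTendsto (fun n x => ‖(u n).grad x‖ ^ 2) μ)
    (hρ : MeasTendsto (fun n x => ‖(u n).fn x‖ ^ critExp N) ρ) :
    ∃ D : Set (Vec N), D.Countable ∧ u₀.gradMeasure + μ.restrict D ≤ μ ∧
      ρ = u₀.fnMeasure + ρ.restrict D := by
  have hN : 3 ≤ N := Fact.out
  have : Nontrivial (Vec N) := by
    have : Nonempty (Fin N) := ⟨⟨0, by lia⟩⟩
    infer_instance
  have hp := critExp_gt_two N
  -- The atoms of the measure in the reverse Hölder inequality. `D` is countable, hence Lebesgue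
  -- null, so the densities of `u₀` do not see it and both measures split into parts on `D` and off
  -- `D`.
  set D : Set (Vec N) := {x | (μ + u₀.gradMeasure) {x} ≠ 0} with hD
  have hDc : D.Countable := countable_setOf_measure_singleton_ne_zero _
  have hDm : MeasurableSet D := hDc.measurableSet
  have hD0 : volume D = 0 := hDc.measure_zero _
  have hgD : u₀.gradMeasure D = 0 := withDensity_absolutelyContinuous _ _ hD0
  have hfD : u₀.fnMeasure D = 0 := withDensity_absolutelyContinuous _ _ hD0
  have hsplit : ∀ ν : Measure (Vec N), ν D = 0 → ν.restrict Dᶜ = ν := fun ν hν =>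
    Measure.restrict_eq_self_of_ae_mem (measure_eq_zero_iff_ae_notMem.1 hν)
  refine ⟨D, hDc, ?_, ?_⟩
  · calc u₀.gradMeasure + μ.restrict D = u₀.gradMeasure.restrict Dᶜ + μ.restrict D := by
          rw [hsplit _ hgD]
      _ ≤ μ.restrict Dᶜ + μ.restrict D :=
          add_le_add (Measure.restrict_mono le_rfl (gradMeasure_le hweak hμ)) le_rfl
      _ = μ := Measure.restrict_compl_add_restrict hDm
  -- Off `D` the reverse Hölder inequality has `γ` without atoms and `r = 2*/2 > 1`, which leaves
  -- only `u₀.fnMeasure`.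
  · have hle : ∀ E, MeasurableSet E → E ⊆ Dᶜ → ρ E ≤ u₀.fnMeasure E := fun E hE hED => by
      refine measure_le_of_forall_le_add_rpow (γ := μ + u₀.gradMeasure) (r := critExp N / 2)
        (by linarith) (fun a ha => ?_) hE fun x hx => not_not.1 (hED hx)
      obtain ⟨a', ha', haa⟩ := ENNReal.lt_iff_exists_nnreal_btwn.1 ha
      have ha1 : (1 : ℝ) < a' := by exact_mod_cast ha'
      obtain ⟨b, hb, hab⟩ := exists_integral_rpow_cutoff_le (N := N) ha1
      refine ⟨ENNReal.ofReal b, ENNReal.ofReal_ne_top, fun E hE => ?_⟩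
      refine (measure_le_of_forall_integral_rpow_le (by linarith) hb (by linarith) two_pos
        (by linarith) (hab u u₀ M μ ρ hM hae hμ hρ) hE).trans ?_
      rw [ENNReal.ofReal_coe_nnreal]
      gcongr
    have heq : ρ.restrict Dᶜ = u₀.fnMeasure := by
      refine le_antisymm (Measure.le_iff.2 fun E hE => ?_) ?_
      · rw [Measure.restrict_apply hE]
        exact (hle _ (hE.inter hDm.compl) Set.inter_subset_right).trans
          (measure_mono Set.inter_subset_left)
      · rw [← hsplit _ hfD]
        exact Measure.restrict_mono le_rfl (fnMeasure_le hae hρ)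
    rw [← heq]
    exact (Measure.restrict_compl_add_restrict hDm).symm

end D12

theorem Real.rpow_le_add_of_le_max {p a b t : ℝ} (hp : 0 ≤ p) (ha : 0 ≤ a) (hb : 0 ≤ b) (ht : 0 ≤ t)
    (h : t ≤ max a b) : t ^ p ≤ a ^ p + b ^ p := by
  have h1 : 0 ≤ a ^ p := by positivity
  have h2 : 0 ≤ b ^ p := by positivity
  have h3 := Real.rpow_le_rpow ht h hp
  rcases max_choice a b with h' | h' <;> rw [h'] at h3 <;> linarith

/-! ### The localised convexity gap of two minimisers -/

namespace UniformlyConvexIntegrand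

variable {α : Type*} [MeasurableSpace α] {μ : Measure α} {E : Type*} [NormedAddCommGroup E]
  [NormedSpace ℝ E] {p : ℝ} {F : α → E → ℝ} {b : α → ℝ} {c : ℝ}

/-- The weighted convexity gap of two minimisers is controlled by the distance of the localised
difference to the space of competitors. -/
theorem integral_mul_midpointGap_le (h : UniformlyConvexIntegrand μ p F b c) (hp : 1 ≤ p)
    {u u' g : α → E} {φ : α → ℝ} (hu : MemLp u (ENNReal.ofReal p) μ)
    (hu' : MemLp u' (ENNReal.ofReal p) μ) (hg : MemLp g (ENNReal.ofReal p) μ)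
    (hφm : AEStronglyMeasurable φ μ) (hφ : ∀ x, φ x ∈ Set.Icc 0 1)
    (hmin : ∫ x, F x (u x) ∂μ ≤ ∫ x, F x (u x - (1 / 2 : ℝ) • g x) ∂μ)
    (hmin' : ∫ x, F x (u' x) ∂μ ≤ ∫ x, F x (u' x + (1 / 2 : ℝ) • g x) ∂μ)
    {ε C K : ℝ} (hε : 0 ≤ ε) (hC : 0 ≤ C)
    (hF : ∀ᵐ x ∂μ, ∀ u r, |F x (u + r) - F x u| ≤ ε * (b x + ‖u‖ ^ p) + C * ‖r‖ ^ p)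
    (hK : ∫ x, ‖u x‖ ^ p ∂μ ≤ K) (hK' : ∫ x, ‖u' x‖ ^ p ∂μ ≤ K) :
    ∫ x, φ x * midpointGap F x (u x) (u' x) ∂μ ≤
      ε * (∫ x, b x ∂μ + 2 * K) + C * ∫ x, ‖φ x • (u x - u' x) - g x‖ ^ p ∂μ := by
  have hp0 : 0 ≤ p := by linarith
  have hd : MemLp (fun x => φ x • (u x - u' x)) (ENNReal.ofReal p) μ := by
    refine (hu.sub hu').of_le (hφm.smul (hu.1.sub hu'.1)) (ae_of_all _ fun x => ?_)
    rw [norm_smul, Real.norm_eq_abs, abs_of_nonneg (hφ x).1]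
    exact mul_le_of_le_one_left (norm_nonneg _) (hφ x).2
  have hr : MemLp (fun x => φ x • (u x - u' x) - g x) (ENNReal.ofReal p) μ := hd.sub hg
  have hri := MemLp.integrable_norm_rpow_ofReal hp hr
  have hui := MemLp.integrable_norm_rpow_ofReal hp hu
  have hui' := MemLp.integrable_norm_rpow_ofReal hp hu'
  have hgap : Integrable (fun x => φ x * midpointGap F x (u x) (u' x)) μ := by
    refine (h.integrable_midpointGap hp hu hu').bdd_mul (c := 1) hφm (ae_of_all _ fun x => ?_)
    rw [Real.norm_eq_abs, abs_of_nonneg (hφ x).1]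
    exact (hφ x).2
  have hFu := h.integrable_comp hp hu
  have hFu' := h.integrable_comp hp hu'
  have hFg : Integrable (fun x => F x (u x - (1 / 2 : ℝ) • g x)) μ :=
    h.integrable_comp hp (hu.sub (hg.const_smul (1 / 2 : ℝ)))
  have hFg' : Integrable (fun x => F x (u' x + (1 / 2 : ℝ) • g x)) μ :=
    h.integrable_comp hp (hu'.add (hg.const_smul (1 / 2 : ℝ)))
  have hB : Integrable (fun x => ε * (b x + (‖u x‖ ^ p + ‖u' x‖ ^ p)) +
      C * ‖φ x • (u x - u' x) - g x‖ ^ p) μ :=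
    ((h.integrable_bound.add (hui.add hui')).const_mul ε).add (hri.const_mul C)
  -- Let m be the midpoint of u and u', and r = φ(u - u') - g. Then u - g/2 = (1 - φ)u + φm + r/2
  -- and u' + g/2 = (1 - φ)u' + φm - r/2. Convexity at the points without r produces -2φ times the
  -- gap on summation, and the increment estimate pays for r. After integration the two differences
  -- of energies are nonpositive by minimality.
  have hpt : ∀ᵐ x ∂μ, 2 * (φ x * midpointGap F x (u x) (u' x)) ≤
      (F x (u x) - F x (u x - (1 / 2 : ℝ) • g x)) +
      (F x (u' x) - F x (u' x + (1 / 2 : ℝ) • g x)) +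
      2 * (ε * (b x + (‖u x‖ ^ p + ‖u' x‖ ^ p)) + C * ‖φ x • (u x - u' x) - g x‖ ^ p) := by
    filter_upwards [hF, h.convex] with x hx hconv
    obtain ⟨h0, h1⟩ := hφ x
    set r := φ x • (u x - u' x) - g x with hrdef
    set m := (1 / 2 : ℝ) • (u x + u' x) with hm
    have hhalf : ‖(1 / 2 : ℝ) • r‖ ^ p ≤ ‖r‖ ^ p := by
      refine Real.rpow_le_rpow (norm_nonneg _) ?_ hp0
      rw [norm_smul]
      norm_num
      linarith [norm_nonneg r]
    have hstep : ∀ q q' : E, ‖(1 - φ x) • q + φ x • ((1 / 2 : ℝ) • (q + q'))‖ ^ p ≤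
        ‖q‖ ^ p + ‖q'‖ ^ p := fun q q' => by
      refine Real.rpow_le_add_of_le_max hp0 (norm_nonneg _) (norm_nonneg _) (norm_nonneg _) ?_
      have e : (1 - φ x) • q + φ x • ((1 / 2 : ℝ) • (q + q')) =
          (1 - φ x / 2) • q + (φ x / 2) • q' := by module
      rw [e]
      refine (norm_add_le _ _).trans ?_
      rw [norm_smul, norm_smul, Real.norm_of_nonneg (by linarith), Real.norm_of_nonneg (by linarith)]
      calc (1 - φ x / 2) * ‖q‖ + φ x / 2 * ‖q'‖ ≤
          (1 - φ x / 2) * max ‖q‖ ‖q'‖ + φ x / 2 * max ‖q‖ ‖q'‖ :=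
            add_le_add (mul_le_mul_of_nonneg_left (le_max_left _ _) (by linarith))
              (mul_le_mul_of_nonneg_left (le_max_right _ _) (by linarith))
        _ = max ‖q‖ ‖q'‖ := by ring
    have c1 := hconv.2 (Set.mem_univ (u x)) (Set.mem_univ m) (sub_nonneg.2 h1) h0 (by ring)
    have c2 := hconv.2 (Set.mem_univ (u' x)) (Set.mem_univ m) (sub_nonneg.2 h1) h0 (by ring)
    have d1 := hx ((1 - φ x) • u x + φ x • m) ((1 / 2 : ℝ) • r)
    have d2 := hx ((1 - φ x) • u' x + φ x • m) (-((1 / 2 : ℝ) • r))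
    have e1 : (1 - φ x) • u x + φ x • m + (1 / 2 : ℝ) • r = u x - (1 / 2 : ℝ) • g x := by
      rw [hm, hrdef]; module
    have e2 : (1 - φ x) • u' x + φ x • m + -((1 / 2 : ℝ) • r) = u' x + (1 / 2 : ℝ) • g x := by
      rw [hm, hrdef]; module
    rw [e1] at d1
    rw [e2, norm_neg] at d2
    have s1 : ‖(1 - φ x) • u x + φ x • m‖ ^ p ≤ ‖u x‖ ^ p + ‖u' x‖ ^ p := hstep _ _
    have s2 : ‖(1 - φ x) • u' x + φ x • m‖ ^ p ≤ ‖u x‖ ^ p + ‖u' x‖ ^ p := by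
      have := hstep (u' x) (u x)
      rw [add_comm (u' x) (u x), add_comm (‖u' x‖ ^ p)] at this
      exact this
    have t1 := mul_le_mul_of_nonneg_left s1 hε
    have t2 := mul_le_mul_of_nonneg_left s2 hε
    have t3 := mul_le_mul_of_nonneg_left hhalf hC
    have d1' := (abs_le.1 d1).2
    have d2' := (abs_le.1 d2).2
    simp only [smul_eq_mul] at c1 c2
    rw [midpointGap]
    linarith
  have hint := integral_mono_ae (hgap.const_mul 2)
    (((hFu.sub hFg).add (hFu'.sub hFg')).add (hB.const_mul 2)) hpt
  have hBe : ∫ x, (ε * (b x + (‖u x‖ ^ p + ‖u' x‖ ^ p)) +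
      C * ‖φ x • (u x - u' x) - g x‖ ^ p) ∂μ = ε * ((∫ x, b x ∂μ) + ((∫ x, ‖u x‖ ^ p ∂μ) +
        ∫ x, ‖u' x‖ ^ p ∂μ)) + C * ∫ x, ‖φ x • (u x - u' x) - g x‖ ^ p ∂μ := by
    have i1 : Integrable (fun x => ‖u x‖ ^ p + ‖u' x‖ ^ p) μ := hui.add hui'
    have i2 : Integrable (fun x => b x + (‖u x‖ ^ p + ‖u' x‖ ^ p)) μ := h.integrable_bound.add i1
    rw [integral_add (i2.const_mul ε) (hri.const_mul C), integral_const_mul, integral_const_mul,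
      integral_add h.integrable_bound i1, integral_add hui hui']
  rw [integral_const_mul, integral_add' ((hFu.sub hFg).add (hFu'.sub hFg')) (hB.const_mul 2),
    integral_add' (hFu.sub hFg) (hFu'.sub hFg'), integral_sub' hFu hFg, integral_sub' hFu' hFg',
    integral_const_mul, hBe] at hint
  have := mul_le_mul_of_nonneg_left (add_le_add hK hK') hε
  linarith

end UniformlyConvexIntegrand

theorem memLp_smul_cutoff {N : ℕ} {φ : Vec N → ℝ} (hφ : Continuous φ) (hφ1 : ∀ x, |φ x| ≤ 1)
    {p : ℝ≥0∞} {μ : Measure (Vec N)} {f : Vec N → Vec N} (hf : MemLp f p μ) :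
    MemLp (fun x => φ x • f x) p μ :=
  hf.of_le (hφ.aestronglyMeasurable.smul hf.1) (ae_of_all _ fun x => by
    rw [norm_smul, Real.norm_eq_abs]
    exact mul_le_of_le_one_left (norm_nonneg _) (hφ1 x))

/-! ### Cutoff functions avoiding the concentration points -/

namespace D12

variable {N : ℕ} [Fact (3 ≤ N)]

/-- Cutoff functions away from the concentration points make the convergence strong. -/
theorem exists_cutoff_eventually_integral_le {u : ℕ → D12 N} {u₀ : D12 N}
    {ρ : Measure (Vec N)} [IsFiniteMeasure ρ]
    (hae : ∀ᵐ x, Tendsto (fun n => (u n).fn x) atTop (𝓝 (u₀.fn x)))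
    (hρ : MeasTendsto (fun n x => ‖(u n).fn x‖ ^ critExp N) ρ)
    {D : Set (Vec N)} (hD : D.Countable) (hρD : ρ = u₀.fnMeasure + ρ.restrict D)
    {x₀ : Vec N} {r R : ℝ} (hrR : r < R) {ε : ℝ} (hε : 0 < ε) :
    ∃ φ : Vec N → ℝ, ContDiff ℝ ∞ φ ∧ tsupport φ ⊆ Metric.closedBall x₀ R ∧
      (∀ x, φ x ∈ Set.Icc 0 1) ∧
      volume (Metric.closedBall x₀ r \ {x | φ x = 1}) ≤ ENNReal.ofReal ε ∧
      ∀ᶠ n in atTop, ∫ x, ‖φ x • (u n).fn x - φ x • u₀.fn x‖ ^ critExp N ≤ ε := by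
  have hN : 3 ≤ N := Fact.out
  have : Nontrivial (Vec N) := by
    have : Nonempty (Fin N) := ⟨⟨0, by lia⟩⟩
    infer_instance
  have hp := one_lt_critExp N
  have hp0 : 0 < critExp N := by linarith
  -- Chosen so that `2^(2*-1) * (2 * ε₁) = ε / 2`: one `ε₁` is for the mass of `ρ` on `D` outside
  -- `C`, one for passing to the limit.
  set ε₁ : ℝ := ε / 2 / 2 ^ (critExp N - 1) / 2 with hε₁
  have hε₁0 : 0 < ε₁ := by positivity
  -- `D` may be dense, so only a compact part `C` carrying all but `ε₁` of the mass of `ρ` on `D` is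
  -- cut out. Being countable, `C` has an open neighbourhood `U` of small Lebesgue measure, outside
  -- which the cutoff equals 1 on the smaller ball.
  obtain ⟨C, hCD, hCc, hC⟩ := hD.measurableSet.exists_isCompact_sdiff_lt (measure_ne_top ρ D)
    (ENNReal.ofReal_pos.2 hε₁0).ne'
  obtain ⟨U, hCU, hUo, hU⟩ := C.exists_isOpen_lt_of_lt (μ := volume) (ENNReal.ofReal ε)
    (by rw [(hD.mono hCD).measure_zero]; exact ENNReal.ofReal_pos.2 hε)
  obtain ⟨φ, hφ1, hφ2, hφ3, hφ4, hφ5⟩ := exists_contDiff_cutoff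
    (K := Metric.closedBall x₀ r \ U) (U := Metric.ball x₀ R \ C)
    ((isCompact_closedBall x₀ r).diff hUo) (Metric.isOpen_ball.sdiff hCc.isClosed)
    fun x hx => ⟨Metric.closedBall_subset_ball hrR hx.1, fun h => hx.2 (hCU h)⟩
  have hφa : ∀ x, |φ x| ≤ 1 := fun x => by
    rw [abs_of_nonneg (hφ5 x).1]
    exact (hφ5 x).2
  refine ⟨φ, hφ1, (hφ3.trans Set.sdiff_subset).trans Metric.ball_subset_closedBall, hφ5, ?_, ?_⟩
  · refine le_trans (measure_mono fun x hx => ?_) hU.le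
    by_contra h
    exact hx.2 (hφ4 x ⟨hx.1, h⟩)
  have hpc := continuous_rpow_cutoff hφ1.continuous hp0
  have hps := hasCompactSupport_rpow_cutoff hφ2 hp0
  have hsm : ∀ v : D12 N, ∫ x, ‖φ x • v.fn x‖ ^ critExp N =
      ∫ x, φ x ^ critExp N * ‖v.fn x‖ ^ critExp N := fun v => by
    refine integral_congr_ae (ae_of_all _ fun x => ?_)
    simp only [norm_smul, Real.norm_eq_abs, abs_of_nonneg (hφ5 x).1,
      Real.mul_rpow (hφ5 x).1 (norm_nonneg _)]
  have hlim := hρ.tendsto_integral hpc hps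
  have hρle : ∫ x, φ x ^ critExp N ∂ρ ≤ (∫ x, φ x ^ critExp N * ‖u₀.fn x‖ ^ critExp N) + ε₁ := by
    have hi : ∀ ν : Measure (Vec N), IsFiniteMeasure ν → Integrable (fun x => φ x ^ critExp N) ν :=
      fun ν _ => hpc.integrable_of_hasCompactSupport hps
    have hDle : ∫ x, φ x ^ critExp N ∂(ρ.restrict D) ≤ ε₁ := by
      refine (integral_rpow_cutoff_le hCc.measurableSet.compl (fun x hx => (hφ3 hx).2) hφ5 hp0
        (ρ.restrict D)).trans ?_
      rw [measureReal_restrict_apply hCc.measurableSet.compl, Set.inter_comm, ← Set.sdiff_eq]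
      exact ENNReal.toReal_le_of_le_ofReal hε₁0.le hC.le
    have heq : ∫ x, φ x ^ critExp N ∂ρ = ∫ x, φ x ^ critExp N ∂(u₀.fnMeasure + ρ.restrict D) := by
      rw [← hρD]
    rw [heq, integral_add_measure (hi _ inferInstance) (hi _ inferInstance), integral_fnMeasure]
    linarith
  have hev : ∀ᶠ n in atTop, ∫ x, ‖φ x • (u n).fn x‖ ^ critExp N ≤
      (∫ x, ‖φ x • u₀.fn x‖ ^ critExp N) + 2 * ε₁ := by
    have h1 : ∫ x, φ x ^ critExp N ∂ρ <
        (∫ x, φ x ^ critExp N * ‖u₀.fn x‖ ^ critExp N) + 2 * ε₁ := by linarith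
    filter_upwards [hlim.eventually (gt_mem_nhds h1)] with n hn
    rw [hsm, hsm]
    exact hn.le
  have hfin := eventually_integral_norm_sub_rpow_le hp.le
    (fun n => memLp_smul_cutoff hφ1.continuous hφa (u n).memLp_fn)
    (memLp_smul_cutoff hφ1.continuous hφa u₀.memLp_fn)
    (hae.mono fun x hx => hx.const_smul (φ x)) hev (half_pos hε)
  filter_upwards [hfin] with n hn
  refine hn.trans (le_of_eq ?_)
  rw [hε₁, add_sub_cancel_left]
  field_simp
  ring

end D12

theorem norm_sub_add_add_rpow_le {E : Type*} [NormedAddCommGroup E] {p : ℝ} (hp : 1 ≤ p)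
    (a b c d : E) :
    ‖a - b + (c + d)‖ ^ p ≤ 4 ^ (p - 1) * (‖a‖ ^ p + ‖b‖ ^ p + ‖c‖ ^ p + ‖d‖ ^ p) := by
  have h4 : (4 : ℝ) ^ (p - 1) = 2 ^ (p - 1) * 2 ^ (p - 1) := by
    rw [← Real.mul_rpow two_pos.le two_pos.le]; norm_num
  have h0 : (0 : ℝ) ≤ 2 ^ (p - 1) := by positivity
  calc ‖a - b + (c + d)‖ ^ p ≤ 2 ^ (p - 1) * (‖a - b‖ ^ p + ‖c + d‖ ^ p) := norm_add_rpow_le hp _ _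
    _ ≤ 2 ^ (p - 1) * (2 ^ (p - 1) * (‖a‖ ^ p + ‖b‖ ^ p) + 2 ^ (p - 1) * (‖c‖ ^ p + ‖d‖ ^ p)) :=
      mul_le_mul_of_nonneg_left (add_le_add (norm_sub_rpow_le hp _ _) (norm_add_rpow_le hp _ _)) h0
    _ = _ := by rw [h4]; ring

theorem integral_norm_sub_add_add_rpow_le {α E : Type*} [MeasurableSpace α] {μ : Measure α}
    [NormedAddCommGroup E] {p : ℝ} (hp : 1 ≤ p) {a b c d f : α → E}
    (ha : MemLp a (ENNReal.ofReal p) μ) (hb : MemLp b (ENNReal.ofReal p) μ)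
    (hc : MemLp c (ENNReal.ofReal p) μ) (hd : MemLp d (ENNReal.ofReal p) μ)
    (hf : ∀ᵐ x ∂μ, f x = a x - b x + (c x + d x)) :
    ∫ x, ‖f x‖ ^ p ∂μ ≤ 4 ^ (p - 1) * ((∫ x, ‖a x‖ ^ p ∂μ) + (∫ x, ‖b x‖ ^ p ∂μ) +
      (∫ x, ‖c x‖ ^ p ∂μ) + ∫ x, ‖d x‖ ^ p ∂μ) := by
  have ia := MemLp.integrable_norm_rpow_ofReal hp ha
  have ib := MemLp.integrable_norm_rpow_ofReal hp hb
  have ic := MemLp.integrable_norm_rpow_ofReal hp hc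
  have id := MemLp.integrable_norm_rpow_ofReal hp hd
  have iab : Integrable (fun x => ‖a x‖ ^ p + ‖b x‖ ^ p) μ := ia.add ib
  have iabc : Integrable (fun x => ‖a x‖ ^ p + ‖b x‖ ^ p + ‖c x‖ ^ p) μ := iab.add ic
  rw [← integral_add ia ib, ← integral_add iab ic, ← integral_add iabc id, ← integral_const_mul]
  refine integral_mono_of_nonneg (ae_of_all _ fun x => by positivity)
    ((iabc.add id).const_mul _) ?_
  filter_upwards [hf] with x hx
  rw [hx]
  exact norm_sub_add_add_rpow_le hp _ _ _ _

/-! ### Correctors are Cauchy in measure on balls -/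

section Correctors

variable {N : ℕ} [Fact (3 ≤ N)] {Ω : Set (Vec N)}

theorem integral_norm_cutoff_rpow_le {φ : Vec N → ℝ} (hφ1 : ∀ x, |φ x| ≤ 1) (z : LCrit N Ω) :
    ∫ x in Ω, ‖φ x • z x‖ ^ critExp N ≤ ‖z‖ ^ critExp N := by
  have hp := one_lt_critExp N
  refine le_trans ?_ (le_of_eq (Lp.norm_rpow_eq_integral hp.le z).symm)
  refine integral_mono_of_nonneg (ae_of_all _ fun x => by positivity)
    (MemLp.integrable_norm_rpow_ofReal hp.le (Lp.memLp z)) (ae_of_all _ fun x => ?_)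
  refine Real.rpow_le_rpow (norm_nonneg _) ?_ (by linarith)
  rw [norm_smul, Real.norm_eq_abs]
  exact mul_le_of_le_one_left (norm_nonneg _) (hφ1 x)

/-- The localised differences of `v_n + y_n + z_n` are almost competitors. -/
theorem exists_curlFree_eventually_integral_le (hΩ : IsOpen Ω) {x₀ : Vec N} {R R' : ℝ} (hR : 0 < R)
    (hRR' : R < R') (hball : Metric.closedBall x₀ R' ⊆ Ω) {φ : Vec N → ℝ} (hφ : ContDiff ℝ ∞ φ)
    (hφs : tsupport φ ⊆ Metric.closedBall x₀ R) (hφ1 : ∀ x, |φ x| ≤ 1)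
    {v : ℕ → D12 N} {v₀ : D12 N} {ε : ℝ} (hε : 0 < ε)
    (hv : ∀ᶠ n in atTop, ∫ x, ‖φ x • (v n).fn x - φ x • v₀.fn x‖ ^ critExp N ≤ ε)
    {y z : ℕ → LCrit N Ω} {z₀ : LCrit N Ω} (hy : ∀ n, y n ∈ curlFree N Ω) {M : ℝ}
    (hyM : ∀ n, ‖y n‖ ≤ M)
    (hyw : ∀ θ, ∃ l, Tendsto (fun n => critPairing N Ω (y n) θ) atTop (𝓝 l))
    (hz : Tendsto z atTop (𝓝 z₀)) {s t : ℕ → ℕ} (hs : Tendsto s atTop atTop)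
    (ht : Tendsto t atTop atTop) :
    ∃ g : ℕ → curlFree N Ω, ∀ᶠ k in atTop, ∫ x in Ω, ‖φ x • (((v (s k)).fn x + (y (s k) + z (s k)) x) -
      ((v (t k)).fn x + (y (t k) + z (t k)) x)) - (g k).1 x‖ ^ critExp N ≤
        4 ^ critExp N * ε := by
  have hp := one_lt_critExp N
  have hp0 : 0 < critExp N := by linarith
  -- Both index sequences tend to infinity, so `y (s k)` and `y (t k)` have the same limit in every
  -- pairing and their difference tends weakly to zero.
  obtain ⟨g, hg⟩ := exists_curlFree_tendsto_integral_sub hΩ hR hRR' hball hφ hφs hφ1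
    (w := fun k => y (s k) - y (t k)) (fun k => sub_mem (hy _) (hy _)) (M := M + M)
    (fun k => (norm_sub_le _ _).trans (add_le_add (hyM _) (hyM _))) fun θ => by
      obtain ⟨l, hl⟩ := hyw θ
      have := (hl.comp hs).sub (hl.comp ht)
      rw [sub_self] at this
      refine this.congr fun k => ?_
      rw [map_sub, _root_.sub_apply]
      rfl
  have hzt : Tendsto (fun k => ‖z (s k) - z (t k)‖ ^ critExp N) atTop (𝓝 0) := by
    have := ((hz.comp hs).sub (hz.comp ht)).norm.rpow_const (p := critExp N) (Or.inr hp0.le)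
    rwa [sub_self, norm_zero, Real.zero_rpow hp0.ne'] at this
  refine ⟨g, ?_⟩
  filter_upwards [hs.eventually hv, ht.eventually hv, hg.eventually (ge_mem_nhds hε),
    hzt.eventually (ge_mem_nhds hε)] with k h1 h2 h3 h4
  have hvm : ∀ n, MemLp (fun x => φ x • (v n).fn x - φ x • v₀.fn x) (ENNReal.ofReal (critExp N))
      volume := fun n => (memLp_smul_cutoff hφ.continuous hφ1 (v n).memLp_fn).sub
    (memLp_smul_cutoff hφ.continuous hφ1 v₀.memLp_fn)
  have m3 := memLp_smul_cutoff hφ.continuous hφ1 (Lp.memLp (z (s k) - z (t k)))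
  have m4 : MemLp (fun x => φ x • (y (s k) - y (t k)) x - (g k).1 x)
      (ENNReal.ofReal (critExp N)) (volume.restrict Ω) :=
    (memLp_smul_cutoff hφ.continuous hφ1 (Lp.memLp (y (s k) - y (t k)))).sub (Lp.memLp (g k).1)
  have hb : ∀ n, ∫ x, ‖φ x • (v n).fn x - φ x • v₀.fn x‖ ^ critExp N ≤ ε →
      ∫ x in Ω, ‖φ x • (v n).fn x - φ x • v₀.fn x‖ ^ critExp N ≤ ε := fun n h =>
    (setIntegral_le_integral (MemLp.integrable_norm_rpow_ofReal hp.le (hvm n))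
      (ae_of_all _ fun x => by positivity)).trans h
  have b3 := (integral_norm_cutoff_rpow_le hφ1 (z (s k) - z (t k))).trans h4
  -- Four pieces, each with integral at most `ε`: the two differences of the `v` from `v₀`, the
  -- difference of the convergent `z`, and the error of `g`; hence the factor `4^(2*-1) * 4`.
  have hle := integral_norm_sub_add_add_rpow_le hp.le ((hvm (s k)).restrict Ω)
    ((hvm (t k)).restrict Ω) m3 m4 (f := fun x => φ x • (((v (s k)).fn x + (y (s k) + z (s k)) x) -
      ((v (t k)).fn x + (y (t k) + z (t k)) x)) - (g k).1 x) (by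
    filter_upwards [Lp.coeFn_add (y (s k)) (z (s k)), Lp.coeFn_add (y (t k)) (z (t k)),
      Lp.coeFn_sub (y (s k)) (y (t k)), Lp.coeFn_sub (z (s k)) (z (t k))] with x e1 e2 e3 e4
    rw [e1, e2, e3, e4]
    simp only [Pi.add_apply, Pi.sub_apply]
    module)
  refine hle.trans ?_
  have h44 : (4 : ℝ) ^ critExp N = 4 ^ (critExp N - 1) * 4 := by
    rw [← Real.rpow_add_one (by norm_num)]; ring_nf
  rw [h44, mul_assoc]
  exact mul_le_mul_of_nonneg_left (by linarith [hb _ h1, hb _ h2]) (by positivity)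

/-- Minimisers form a Cauchy sequence in measure on balls. -/
theorem exists_measure_dist_le (hΩ : IsOpen Ω) {F : Vec N → Vec N → ℝ} {b : Vec N → ℝ} {c : ℝ}
    (hF : UniformlyConvexIntegrand (volume.restrict Ω) (critExp N) F b c)
    {S : Submodule ℝ (LCrit N Ω)} (hS : curlFree N Ω ≤ S)
    {v : ℕ → D12 N} {v₀ : D12 N} {ρ : Measure (Vec N)} [IsFiniteMeasure ρ]
    (hae : ∀ᵐ x, Tendsto (fun n => (v n).fn x) atTop (𝓝 (v₀.fn x)))
    (hρ : MeasTendsto (fun n x => ‖(v n).fn x‖ ^ critExp N) ρ)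
    {D : Set (Vec N)} (hD : D.Countable) (hρD : ρ = v₀.fnMeasure + ρ.restrict D)
    {y z : ℕ → LCrit N Ω} {z₀ : LCrit N Ω} (hy : ∀ n, y n ∈ curlFree N Ω) {M : ℝ}
    (hyM : ∀ n, ‖y n‖ ≤ M)
    (hyw : ∀ θ, ∃ l, Tendsto (fun n => critPairing N Ω (y n) θ) atTop (𝓝 l))
    (hz : Tendsto z atTop (𝓝 z₀)) (hyz : ∀ n, y n + z n ∈ S)
    (hmin : ∀ n, ∀ w ∈ S, ∫ x in Ω, F x ((v n).fn x + (y n + z n) x) ≤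
      ∫ x in Ω, F x ((v n).fn x + w x))
    {K : ℝ} (hK : ∀ n, ∫ x in Ω, ‖(v n).fn x + (y n + z n) x‖ ^ critExp N ≤ K)
    {x₀ : Vec N} {r R' : ℝ} (hr : 0 < r) (hrR' : r < R') (hball : Metric.closedBall x₀ R' ⊆ Ω)
    {ε : ℝ} (hε : 0 < ε) :
    ∃ n₀, ∀ n ≥ n₀, ∀ m ≥ n₀, volume.restrict Ω (Metric.closedBall x₀ r ∩
      {x | ε ≤ dist ((v n).fn x + (y n + z n) x) ((v m).fn x + (y m + z m) x)}) ≤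
        ENNReal.ofReal ε := by
  have hp := one_lt_critExp N
  by_contra hcon
  push Not at hcon
  -- The argument is by contradiction because approximate competitors are available only along
  -- sequences of index pairs, not for fixed pairs.
  choose s hs t ht hst using hcon
  have hs' : Tendsto s atTop atTop := tendsto_atTop_mono hs tendsto_id
  have ht' : Tendsto t atTop atTop := tendsto_atTop_mono ht tendsto_id
  have hK0 : 0 ≤ K := (integral_nonneg fun x => by positivity).trans (hK 0)
  have hb0 : 0 ≤ ∫ x in Ω, b x := integral_nonneg hF.bound_nonneg
  -- Order of constants: `δ` is the admissible integrated gap, then `C` is the increment constant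
  -- for which the first error is at most `δ / 2`, and last comes the cutoff tolerance, which makes
  -- `C` times the distance to a competitor at most `δ / 2`.
  obtain ⟨δ, hδ, hmeas⟩ := hF.exists_measure_le_of_integral_gap_le hp.le K hε (half_pos hε)
  obtain ⟨C, hC, hFC⟩ := hF.abs_sub_le (δ / 2 / ((∫ x in Ω, b x) + 2 * K + 1)) (by positivity)
  obtain ⟨R, hrR, hRR'⟩ := exists_between hrR'
  obtain ⟨φ, hφ, hφs, hφ01, hφv, hφu⟩ := D12.exists_cutoff_eventually_integral_le hae hρ hD hρD
    (x₀ := x₀) hrR (ε := min (ε / 2) (δ / 2 / (C + 1) / 4 ^ critExp N)) (by positivity)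
  have hφ1 : ∀ x, |φ x| ≤ 1 := fun x => by
    rw [abs_of_nonneg (hφ01 x).1]
    exact (hφ01 x).2
  obtain ⟨g, hg⟩ := exists_curlFree_eventually_integral_le hΩ (hr.trans hrR) hRR' hball hφ hφs hφ1
    (by positivity) hφu hy hyM hyw hz hs' ht'
  obtain ⟨k, hk⟩ := hg.exists
  refine absurd (hst k) (not_lt.2 ?_)
  have hmem : ∀ n, MemLp (fun x => (v n).fn x + (y n + z n) x) (ENNReal.ofReal (critExp N))
      (volume.restrict Ω) := fun n => ((v n).memLp_fn.restrict Ω).add (Lp.memLp (y n + z n))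
  -- Adding a multiple of the curl-free field `g k` keeps the competitor in `S`.
  have hcomp : ∀ n (a : ℝ), ∫ x in Ω, F x ((v n).fn x + (y n + z n) x) ≤
      ∫ x in Ω, F x ((v n).fn x + (y n + z n) x + a • (g k).1 x) := fun n a => by
    refine (hmin n (y n + z n + a • (g k).1)
      (S.add_mem (hyz n) (S.smul_mem a (hS (g k).2)))).trans (le_of_eq ?_)
    refine integral_congr_ae ?_
    filter_upwards [Lp.coeFn_add (y n + z n) (a • (g k).1), Lp.coeFn_smul a (g k).1] with x e1 e2
    rw [e1, Pi.add_apply, e2, Pi.smul_apply, add_assoc]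
  have hgap := hF.integral_mul_midpointGap_le hp.le (hmem (s k)) (hmem (t k)) (Lp.memLp (g k).1)
    hφ.continuous.aestronglyMeasurable hφ01
    (by simpa only [neg_smul, ← sub_eq_add_neg] using hcomp (s k) (-(1 / 2)))
    (hcomp (t k) (1 / 2)) (by positivity) hC hFC (hK (s k)) (hK (t k))
  have hδ' : δ / 2 / ((∫ x in Ω, b x) + 2 * K + 1) * ((∫ x in Ω, b x) + 2 * K) +
      C * ∫ x in Ω, ‖φ x • (((v (s k)).fn x + (y (s k) + z (s k)) x) -
        ((v (t k)).fn x + (y (t k) + z (t k)) x)) - (g k).1 x‖ ^ critExp N ≤ δ := by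
    have h1 : δ / 2 / ((∫ x in Ω, b x) + 2 * K + 1) * ((∫ x in Ω, b x) + 2 * K) ≤ δ / 2 := by
      rw [div_mul_eq_mul_div, div_le_iff₀ (by positivity)]
      exact mul_le_mul_of_nonneg_left (by linarith) (by positivity)
    have h2 : 4 ^ critExp N * min (ε / 2) (δ / 2 / (C + 1) / 4 ^ critExp N) ≤ δ / 2 / (C + 1) := by
      refine (mul_le_mul_of_nonneg_left (min_le_right _ _) (by positivity)).trans (le_of_eq ?_)
      rw [mul_div_cancel₀]
      positivity
    have h3 : C * (δ / 2 / (C + 1)) ≤ δ / 2 := by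
      rw [mul_div_assoc', div_le_iff₀ (by positivity)]
      nlinarith
    have h4 := mul_le_mul_of_nonneg_left (hk.trans h2) hC
    linarith
  have hm := hmeas _ _ φ (hmem (s k)) (hmem (t k)) (hK (s k)) (hK (t k))
    hφ.continuous.aestronglyMeasurable (fun x => (hφ01 x).1) (fun x => (hφ01 x).2)
    (hgap.trans hδ')
  have hφv' : volume.restrict Ω (Metric.closedBall x₀ r \ {x | φ x = 1}) ≤
      ENNReal.ofReal (ε / 2) :=
    (Measure.restrict_apply_le _ _).trans
      (hφv.trans (ENNReal.ofReal_le_ofReal (min_le_left _ _)))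
  calc volume.restrict Ω _ ≤ volume.restrict Ω ((Metric.closedBall x₀ r \ {x | φ x = 1}) ∪
        ({x | φ x = 1} ∩ _)) := measure_mono (fun x hx => by
          by_cases h : φ x = 1
          · exact Or.inr ⟨h, hx.2⟩
          · exact Or.inl ⟨hx.1, h⟩)
    _ ≤ ENNReal.ofReal (ε / 2) + ENNReal.ofReal (ε / 2) :=
        (measure_union_le _ _).trans (add_le_add hφv' hm)
    _ = ENNReal.ofReal ε := by
        rw [← ENNReal.ofReal_add (by positivity) (by positivity), add_halves]

end Correctors

/-! ### Weak convergence and projections in normed spaces -/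

section WeakConvergence

variable {X : Type*} [NormedAddCommGroup X] [NormedSpace ℝ X]

theorem weakTendsto_iff {u : ℕ → X} {u₀ : X} :
    WeakTendsto u u₀ ↔ ∀ ℓ : X →L[ℝ] ℝ, Tendsto (fun n => ℓ (u n)) atTop (𝓝 (ℓ u₀)) := by
  rw [WeakTendsto]
  refine WeakBilin.tendsto_iff_forall_eval_tendsto (topDualPairing ℝ X).flip fun x y h => ?_
  refine (SeparatingDual.eq_iff_forall_dual_eq (R := ℝ)).2 fun ℓ => ?_
  exact LinearMap.congr_fun h ℓ

theorem WeakTendsto.exists_norm_le {u : ℕ → X} {u₀ : X} (h : WeakTendsto u u₀) :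
    ∃ M, ∀ n, ‖u n‖ ≤ M := by
  obtain ⟨M, hM⟩ := banach_steinhaus (g := fun n => NormedSpace.inclusionInDoubleDual ℝ X (u n))
    fun ℓ => by
      obtain ⟨C, hC⟩ := (weakTendsto_iff.1 h ℓ).norm.bddAbove_range
      exact ⟨C, fun n => hC ⟨n, rfl⟩⟩
  exact ⟨M, fun n => ((NormedSpace.inclusionInDoubleDualLi ℝ).norm_map (u n)).symm.le.trans (hM n)⟩

/-- The projection along a closed subspace onto a finite dimensional one is bounded. -/
theorem exists_norm_le_norm_add {W Z : Submodule ℝ X} (hW : IsClosed (W : Set X))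
    [FiniteDimensional ℝ Z] (hZW : Z ⊓ W = ⊥) :
    ∃ K, 0 ≤ K ∧ ∀ y ∈ W, ∀ z ∈ Z, ‖z‖ ≤ K * ‖y + z‖ := by
  have : IsClosed (W : Set X) := hW
  -- Injective because `Z ⊓ W = ⊥`, hence bounded below on the finite-dimensional `Z`; the quotient
  -- norm of `z` is at most `‖y + z‖` for `y` in `W`.
  set T : Z →ₗ[ℝ] X ⧸ W := W.mkQ.comp Z.subtype with hT
  have hker : LinearMap.ker T = ⊥ := by
    rw [LinearMap.ker_eq_bot']
    intro z hz
    have h1 : (z : X) ∈ W := (Submodule.Quotient.mk_eq_zero W).1 hz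
    have h2 : (z : X) ∈ Z ⊓ W := ⟨z.2, h1⟩
    rw [hZW] at h2
    exact Subtype.ext ((Submodule.mem_bot ℝ).1 h2)
  obtain ⟨K, -, hK⟩ := T.exists_antilipschitzWith hker
  refine ⟨K, K.2, fun y hy z hz => ?_⟩
  have h1 := hK.le_mul_dist ⟨z, hz⟩ 0
  rw [map_zero, dist_zero_right, dist_zero_right] at h1
  have h2 : T ⟨z, hz⟩ = W.mkQ (y + z) := by
    rw [map_add, W.mkQ_apply, (Submodule.Quotient.mk_eq_zero W).2 hy, zero_add]
    rfl
  rw [h2] at h1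
  refine h1.trans (mul_le_mul_of_nonneg_left ?_ K.2)
  exact Submodule.Quotient.norm_mk_le W (y + z)

/-- Bounded sequences of functionals on a separable space have weak-* convergent subsequences. -/
theorem exists_subseq_forall_tendsto [TopologicalSpace.SeparableSpace X] {ℓ : ℕ → X →L[ℝ] ℝ}
    {M : ℝ} (hM : ∀ n, ‖ℓ n‖ ≤ M) :
    ∃ s : ℕ → ℕ, StrictMono s ∧ ∀ x, ∃ l, Tendsto (fun n => ℓ (s n) x) atTop (𝓝 l) := by
  have h := WeakDual.isSeqCompact_closedBall (𝕜 := ℝ) (E := X) 0 M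
  obtain ⟨l, -, s, hs, hl⟩ := h (x := fun n => StrongDual.toWeakDual (ℓ n)) fun n => by
    simpa using hM n
  exact ⟨s, hs, fun x => ⟨l x, tendsto_iff_forall_eval_tendsto_topDualPairing.1 hl x⟩⟩

end WeakConvergence

/-! ### Splitting bounded sequences in W ⊕ Z -/

section Decomposition

variable {N : ℕ} [Fact (3 ≤ N)] {Ω : Set (Vec N)}

/-- L^{2*} acts on the separable space L^q, with q conjugate to 2*, so sequential weak-* compactness
applies. Only convergence of the pairings is needed, not a weak limit in L^{2*}. -/
theorem exists_subseq_forall_tendsto_critPairing {y : ℕ → LCrit N Ω} {M : ℝ}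
    (hM : ∀ n, ‖y n‖ ≤ M) : ∃ s : ℕ → ℕ, StrictMono s ∧
      ∀ θ, ∃ l, Tendsto (fun n => critPairing N Ω (y (s n)) θ) atTop (𝓝 l) := by
  have : Fact (twoStarConj N ≠ ⊤) := ⟨ENNReal.ofReal_ne_top⟩
  exact exists_subseq_forall_tendsto (ℓ := fun n => critPairing N Ω (y n))
    (M := ‖critPairing N Ω‖ * M) fun n => ((critPairing N Ω).le_opNorm (y n)).trans
      (mul_le_mul_of_nonneg_left (hM n) (norm_nonneg (critPairing N Ω)))

/-- Bounded sequences in `W ⊕ Z` split, along a subsequence, into a weakly convergent sequence of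
curl free fields and a convergent sequence. -/
theorem exists_subseq_decomposition {Z : Submodule ℝ (LCrit N Ω)} [FiniteDimensional ℝ Z]
    (hZW : Z ⊓ curlFree N Ω = ⊥) {w : ℕ → LCrit N Ω} (hw : ∀ n, w n ∈ curlFree N Ω ⊔ Z) {M : ℝ}
    (hM : ∀ n, ‖w n‖ ≤ M) : ∃ s : ℕ → ℕ, StrictMono s ∧ ∃ (y z : ℕ → LCrit N Ω) (z₀ : LCrit N Ω)
      (M' : ℝ), (∀ n, y n ∈ curlFree N Ω) ∧ (∀ n, w (s n) = y n + z n) ∧ (∀ n, ‖y n‖ ≤ M') ∧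
      (∀ θ, ∃ l, Tendsto (fun n => critPairing N Ω (y n) θ) atTop (𝓝 l)) ∧
      Tendsto z atTop (𝓝 z₀) := by
  obtain ⟨K, hK0, hK⟩ := exists_norm_le_norm_add (isClosed_curlFree N Ω) hZW
  choose y hy z hz hyz using fun n => Submodule.mem_sup.1 (hw n)
  have hzM : ∀ n, ‖z n‖ ≤ K * M := fun n => by
    have h := hK (y n) (hy n) (z n) (hz n)
    rw [hyz] at h
    exact h.trans (mul_le_mul_of_nonneg_left (hM n) hK0)
  have hyM : ∀ n, ‖y n‖ ≤ M + K * M := fun n => by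
    have h : y n = w n - z n := by rw [← hyz n, add_sub_cancel_right]
    rw [h]
    exact (norm_sub_le (w n) (z n)).trans (add_le_add (hM n) (hzM n))
  obtain ⟨z₀, -, s, hs, hsz⟩ := tendsto_subseq_of_bounded
    (x := fun n => (⟨z n, hz n⟩ : Z)) (s := Metric.closedBall 0 (K * M))
    Metric.isBounded_closedBall fun n => by simpa using hzM n
  obtain ⟨t, ht, hty⟩ := exists_subseq_forall_tendsto_critPairing fun n => hyM (s n)
  refine ⟨s ∘ t, hs.comp ht, fun n => y (s (t n)), fun n => z (s (t n)), z₀, M + K * M,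
    fun n => hy _, fun n => (hyz _).symm, fun n => hyM _, hty, ?_⟩
  exact ((continuous_subtype_val.tendsto _).comp hsz).comp ht.tendsto_atTop

end Decomposition

/-! ### Bounds for minimisers and limits of minimisers -/

namespace UniformlyConvexIntegrand

variable {α : Type*} [MeasurableSpace α] {μ : Measure α} {E : Type*} [NormedAddCommGroup E]
  [NormedSpace ℝ E] {p : ℝ} {F : α → E → ℝ} {b : α → ℝ} {c : ℝ}

/-- Comparison with the competitor 0 bounds the energy, and coercivity turns this into a bound for v
+ w and then for w, uniform over bounded sets of v. -/
theorem exists_norm_minimizer_le [Fact (1 ≤ ENNReal.ofReal p)]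
    (h : UniformlyConvexIntegrand μ p F b c) (hp : 1 ≤ p) (A : ℝ) :
    ∃ K, ∀ (v : α → E) (w : Lp E (ENNReal.ofReal p) μ), MemLp v (ENNReal.ofReal p) μ →
      ∫ x, ‖v x‖ ^ p ∂μ ≤ A → ∫ x, F x (v x + w x) ∂μ ≤ ∫ x, F x (v x) ∂μ →
      ∫ x, ‖v x + w x‖ ^ p ∂μ ≤ K ∧ ‖w‖ ≤ K := by
  obtain ⟨C, hC0, hC⟩ := h.exists_integral_le hp
  have hc := h.coercive_pos
  refine ⟨max ((C + C * A) / c) ((2 ^ (p - 1) * ((C + C * A) / c + A)) ^ p⁻¹),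
    fun v w hv hA hw => ?_⟩
  have hvw : MemLp (fun x => v x + w x) (ENNReal.ofReal p) μ := hv.add (Lp.memLp w)
  have h1 : ∫ x, ‖v x + w x‖ ^ p ∂μ ≤ (C + C * A) / c := by
    refine (h.integral_norm_rpow_le hp hvw).trans (div_le_div_of_nonneg_right ?_ hc.le)
    exact hw.trans ((hC v hv).trans (add_le_add le_rfl (mul_le_mul_of_nonneg_left hA hC0)))
  refine ⟨h1.trans (le_max_left _ _), (Lp.norm_le_rpow_inv hp ?_).trans (le_max_right _ _)⟩
  have i1 := MemLp.integrable_norm_rpow_ofReal hp hvw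
  have i2 := MemLp.integrable_norm_rpow_ofReal hp hv
  calc ∫ x, ‖w x‖ ^ p ∂μ ≤ ∫ x, 2 ^ (p - 1) * (‖v x + w x‖ ^ p + ‖v x‖ ^ p) ∂μ := by
        refine integral_mono (MemLp.integrable_norm_rpow_ofReal hp (Lp.memLp w))
          ((i1.add i2).const_mul _) fun x => ?_
        have := norm_sub_rpow_le hp (v x + w x) (v x)
        rwa [add_sub_cancel_left] at this
    _ = 2 ^ (p - 1) * ((∫ x, ‖v x + w x‖ ^ p ∂μ) + ∫ x, ‖v x‖ ^ p ∂μ) := by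
        rw [integral_const_mul, integral_add i1 i2]
    _ ≤ _ := by gcongr

/-- Almost everywhere limits of minimisers are minimisers. -/
theorem integral_le_of_tendsto_ae [Fact (1 ≤ ENNReal.ofReal p)]
    (h : UniformlyConvexIntegrand μ p F b c) (hp : 1 ≤ p)
    {S : Submodule ℝ (Lp E (ENNReal.ofReal p) μ)} {v : ℕ → α → E} {v₀ : α → E}
    {w : ℕ → Lp E (ENNReal.ofReal p) μ} {w₀ : Lp E (ENNReal.ofReal p) μ}
    (hv : ∀ n, MemLp (v n) (ENNReal.ofReal p) μ) (hv₀ : MemLp v₀ (ENNReal.ofReal p) μ)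
    (hvl : ∀ᵐ x ∂μ, Tendsto (fun n => v n x) atTop (𝓝 (v₀ x)))
    (hwl : ∀ᵐ x ∂μ, Tendsto (fun n => w n x) atTop (𝓝 (w₀ x)))
    (hw : ∀ n, w n ∈ S) (hw₀ : w₀ ∈ S) {K : ℝ} (hK : ∀ n, ∫ x, ‖v n x + w n x‖ ^ p ∂μ ≤ K)
    (hmin : ∀ n, ∀ w' ∈ S, ∫ x, F x (v n x + w n x) ∂μ ≤ ∫ x, F x (v n x + w' x) ∂μ)
    {w' : Lp E (ENNReal.ofReal p) μ} (hw' : w' ∈ S) :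
    ∫ x, F x (v₀ x + w₀ x) ∂μ ≤ ∫ x, F x (v₀ x + w' x) ∂μ := by
  have hu : ∀ n, MemLp (fun x => v n x + w n x) (ENNReal.ofReal p) μ := fun n =>
    (hv n).add (Lp.memLp (w n))
  have hu₀ : MemLp (fun x => v₀ x + w₀ x) (ENNReal.ofReal p) μ := hv₀.add (Lp.memLp w₀)
  have hg := Lp.memLp (w' - w₀)
  have hug : ∀ n, MemLp (fun x => v n x + w n x + (w' - w₀) x) (ENNReal.ofReal p) μ := fun n =>
    (hu n).add hg
  have hug₀ : MemLp (fun x => v₀ x + w₀ x + (w' - w₀) x) (ENNReal.ofReal p) μ := hu₀.add hg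
  have j : ∀ n, Integrable (fun x => F x (v n x + w n x)) μ := fun n => h.integrable_comp hp (hu n)
  have jg : ∀ n, Integrable (fun x => F x (v n x + w n x + (w' - w₀) x)) μ := fun n =>
    h.integrable_comp hp (hug n)
  have j₀ : Integrable (fun x => F x (v₀ x + w₀ x)) μ := h.integrable_comp hp hu₀
  have jg₀ : Integrable (fun x => F x (v₀ x + w₀ x + (w' - w₀) x)) μ := h.integrable_comp hp hug₀
  -- The energies of `v n + w n` may lose mass in the limit, but the difference of energies for the
  -- fixed perturbation `w' - w₀` converges: the increment estimate is exactly the hypothesis of the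
  -- Vitali type theorem. The competitor is `w n + (w' - w₀)`.
  have hlim := tendsto_integral_of_le_mul_add (μ := μ)
    (ψ := fun n x => F x (v n x + w n x + (w' - w₀) x) - F x (v n x + w n x))
    (ψ₀ := fun x => F x (v₀ x + w₀ x + (w' - w₀) x) - F x (v₀ x + w₀ x))
    (G := fun n x => ‖v n x + w n x‖ ^ p) (M := K)
    (fun n => ((jg n).sub (j n)).1) (jg₀.sub j₀) ?_
    (fun n => MemLp.integrable_norm_rpow_ofReal hp (hu n))
    (fun n => ae_of_all _ fun x => by positivity) hK ?_
  · have hn : ∀ n, 0 ≤ ∫ x, (F x (v n x + w n x + (w' - w₀) x) - F x (v n x + w n x)) ∂μ :=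
      fun n => by
        rw [integral_sub (jg n) (j n), sub_nonneg]
        refine (hmin n _ (S.add_mem (hw n) (S.sub_mem hw' hw₀))).trans (le_of_eq ?_)
        refine integral_congr_ae ?_
        filter_upwards [Lp.coeFn_add (w n) (w' - w₀)] with x hx
        rw [hx, Pi.add_apply, add_assoc]
    have h0 := ge_of_tendsto' hlim hn
    rw [integral_sub jg₀ j₀, sub_nonneg] at h0
    refine h0.trans (le_of_eq (integral_congr_ae ?_))
    filter_upwards [Lp.coeFn_sub w' w₀] with x hx
    rw [hx, Pi.sub_apply]
    congr 1
    abel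
  · filter_upwards [hvl, hwl, h.continuous] with x h1 h2 h3
    have h4 := h1.add h2
    exact ((h3.tendsto _).comp (h4.add_const _)).sub ((h3.tendsto _).comp h4)
  · intro ε hε
    obtain ⟨C, hC, hb⟩ := h.abs_sub_le ε hε
    refine ⟨fun x => ε * b x + C * ‖(w' - w₀) x‖ ^ p, (h.integrable_bound.const_mul ε).add
      ((MemLp.integrable_norm_rpow_ofReal hp hg).const_mul C), fun n => ?_⟩
    filter_upwards [hb] with x hx
    refine (hx _ _).trans (le_of_eq ?_)
    ring

end UniformlyConvexIntegrand

theorem exists_seq_closedBall_cover {N : ℕ} {Ω : Set (Vec N)} (hΩ : IsOpen Ω) (hne : Ω.Nonempty) :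
    ∃ (x : ℕ → Vec N) (r : ℕ → ℝ), (∀ i, 0 < r i) ∧
      (∀ i, Metric.closedBall (x i) (2 * r i) ⊆ Ω) ∧ Ω ⊆ ⋃ i, Metric.closedBall (x i) (r i) := by
  have h : ∀ x : Vec N, ∃ r > 0, x ∈ Ω → Metric.closedBall x (2 * r) ⊆ Ω := fun x => by
    by_cases hx : x ∈ Ω
    · obtain ⟨ε, hε, hb⟩ := Metric.nhds_basis_closedBall.mem_iff.1 (hΩ.mem_nhds hx)
      refine ⟨ε / 2, half_pos hε, fun _ => ?_⟩
      rwa [mul_div_cancel₀ _ two_ne_zero]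
    · exact ⟨1, one_pos, fun h => absurd h hx⟩
  choose r hr hrΩ using h
  obtain ⟨t, htΩ, htc, ht⟩ := TopologicalSpace.countable_cover_nhdsWithin
    (s := Ω) (f := fun x => Metric.closedBall x (r x))
    fun x _ => mem_nhdsWithin_of_mem_nhds (Metric.closedBall_mem_nhds x (hr x))
  have htne : t.Nonempty := by
    rw [Set.nonempty_iff_ne_empty]
    rintro rfl
    obtain ⟨x, hx⟩ := hne
    simpa using ht hx
  obtain ⟨g, rfl⟩ := htc.exists_eq_range htne
  refine ⟨g, fun i => r (g i), fun i => hr _, fun i => hrΩ _ (htΩ ⟨i, rfl⟩), ?_⟩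
  simpa using ht

/-! ### Almost everywhere convergence of correctors -/

section Correctors

variable {N : ℕ} [Fact (3 ≤ N)] {Ω : Set (Vec N)}

theorem isClosed_curlFree_sup (Z : Submodule ℝ (LCrit N Ω)) [FiniteDimensional ℝ Z] :
    IsClosed ((curlFree N Ω ⊔ Z : Submodule ℝ (LCrit N Ω)) : Set (LCrit N Ω)) :=
  Submodule.isClosed_sup_finiteDimensional _ _ (isClosed_curlFree N Ω)

/-- Minimisers converge almost everywhere along a subsequence. -/
theorem exists_subseq_tendsto_minimizer (hΩ : IsOpen Ω) (hne : Ω.Nonempty)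
    {F : Vec N → Vec N → ℝ} {b : Vec N → ℝ} {c : ℝ}
    (hF : UniformlyConvexIntegrand (volume.restrict Ω) (critExp N) F b c)
    {Z : Submodule ℝ (LCrit N Ω)} [FiniteDimensional ℝ Z] (hZW : Z ⊓ curlFree N Ω = ⊥)
    {v : ℕ → D12 N} {v₀ : D12 N} {ρ : Measure (Vec N)} [IsFiniteMeasure ρ]
    (hae : ∀ᵐ x, Tendsto (fun n => (v n).fn x) atTop (𝓝 (v₀.fn x)))
    (hρ : MeasTendsto (fun n x => ‖(v n).fn x‖ ^ critExp N) ρ)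
    {D : Set (Vec N)} (hD : D.Countable) (hρD : ρ = v₀.fnMeasure + ρ.restrict D)
    {w : ℕ → LCrit N Ω} {K : ℝ} (hw : ∀ n, w n ∈ curlFree N Ω ⊔ Z)
    (hK : ∀ n, ∫ x in Ω, ‖(v n).fn x + w n x‖ ^ critExp N ≤ K ∧ ‖w n‖ ≤ K)
    (hmin : ∀ n, ∀ w' ∈ curlFree N Ω ⊔ Z, ∫ x in Ω, F x ((v n).fn x + w n x) ≤
      ∫ x in Ω, F x ((v n).fn x + w' x)) :
    ∃ s : ℕ → ℕ, StrictMono s ∧ ∃ w₀ ∈ curlFree N Ω ⊔ Z,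
      (∀ᵐ x ∂volume.restrict Ω, Tendsto (fun n => w (s n) x) atTop (𝓝 (w₀ x))) ∧
      ∀ w' ∈ curlFree N Ω ⊔ Z, ∫ x in Ω, F x (v₀.fn x + w₀ x) ≤
        ∫ x in Ω, F x (v₀.fn x + w' x) := by
  have hp := one_lt_critExp N
  have : Fact (1 ≤ ENNReal.ofReal (critExp N)) := one_le_twoStar N
  obtain ⟨s, hs, y, z, z₀, M, hy, hyz, hyM, hyw, hz⟩ :=
    exists_subseq_decomposition hZW hw fun n => (hK n).2
  have hae' : ∀ᵐ x, Tendsto (fun n => (v (s n)).fn x) atTop (𝓝 (v₀.fn x)) :=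
    hae.mono fun x hx => hx.comp hs.tendsto_atTop
  have hρ' : MeasTendsto (fun n x => ‖(v (s n)).fn x‖ ^ critExp N) ρ := fun φ =>
    (hρ φ).comp hs.tendsto_atTop
  obtain ⟨x₀, r, hr, hrΩ, hcov⟩ := exists_seq_closedBall_cover hΩ hne
  -- Countably many balls with doubled balls inside `Ω` exhaust `Ω`, and a single diagonal
  -- subsequence serves all of them.
  obtain ⟨t, ht, htl⟩ := exists_seq_tendsto_ae_of_cauchy_in_measure (μ := volume.restrict Ω)
    (A := fun i => Metric.closedBall (x₀ i) (r i))
    (f := fun n x => (v (s n)).fn x + (y n + z n) x) fun i ε hε =>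
      exists_measure_dist_le hΩ hF le_sup_left hae' hρ' hD hρD hy hyM hyw hz
        (fun n => hyz n ▸ hw (s n)) (fun n w' hw' => hyz n ▸ hmin (s n) w' hw')
        (fun n => hyz n ▸ (hK (s n)).1) (hr i) (by linarith [hr i]) (hrΩ i) hε
  have hst : StrictMono (s ∘ t) := hs.comp ht
  have haeΩ : ∀ᵐ x ∂volume.restrict Ω,
      Tendsto (fun n => (v (s (t n))).fn x) atTop (𝓝 (v₀.fn x)) :=
    ae_restrict_of_ae (hae'.mono fun x hx => hx.comp ht.tendsto_atTop)
  have hlim : ∀ᵐ x ∂volume.restrict Ω, ∃ l, Tendsto (fun n => w (s (t n)) x) atTop (𝓝 l) := by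
    filter_upwards [htl, haeΩ, ae_restrict_mem hΩ.measurableSet] with x h1 h2 hx
    obtain ⟨i, hi⟩ := Set.mem_iUnion.1 (hcov hx)
    obtain ⟨l, hl⟩ := h1 i hi
    refine ⟨l - v₀.fn x, (hl.sub h2).congr fun n => ?_⟩
    rw [hyz, add_sub_cancel_left]
  have hKw : ∀ n, ‖w (s (t n))‖ ≤ (K.toNNReal : ℝ) := fun n => (hK _).2.trans (Real.le_coe_toNNReal K)
  obtain ⟨w₀, -, hw₀⟩ := Lp.exists_tendsto_ae hKw hlim
  have hw₀S : w₀ ∈ curlFree N Ω ⊔ Z := Lp.mem_of_tendsto_ae hp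
    (isClosed_curlFree_sup Z) hKw hw₀ fun n => hw _
  exact ⟨s ∘ t, hst, w₀, hw₀S, hw₀, fun w' hw' => hF.integral_le_of_tendsto_ae hp.le
    (fun n => (v (s (t n))).memLp_fn.restrict Ω) (v₀.memLp_fn.restrict Ω) haeΩ hw₀
    (fun n => hw _) hw₀S (fun n => (hK _).1) (fun n => hmin _) hw'⟩

end Correctors

theorem exists_sum_dirac_eq_restrict {N : ℕ} (μ : Measure (Vec N)) [IsFiniteMeasure μ] {D : Set (Vec N)}
    (hD : D.Countable) : ∃ m : D → ℝ≥0,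
      Measure.sum (fun x : D => m x • Measure.dirac (x : Vec N)) = μ.restrict D := by
  refine ⟨fun x => (μ {(x : Vec N)}).toNNReal, ?_⟩
  rw [restrict_eq_sum_dirac μ hD]
  congr 1
  ext1 x
  refine Measure.ext fun s _ => ?_
  simp only [Measure.smul_apply, ENNReal.smul_def, ENNReal.coe_toNNReal (measure_ne_top μ _)]

/-! ### From almost everywhere convergence to the theorem -/

section MainTheorem

variable {N : ℕ} [Fact (3 ≤ N)] {Ω : Set (Vec N)}

theorem WeakTendsto.tendsto_inner_grad {V : Submodule ℝ (D12 N)} {v : ℕ → V} {v₀ : V}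
    (h : WeakTendsto v v₀) (G : Lp (Mat N) 2 (volume : Measure (Vec N))) :
    Tendsto (fun n => inner ℝ (v n).1.grad G) atTop (𝓝 (inner ℝ v₀.1.grad G)) := by
  have key := weakTendsto_iff.1 h (LinearMap.mkContinuous
    ((innerₛₗ ℝ G).comp (D12.grad.comp V.subtype)) ‖G‖
    fun u => norm_inner_le_norm (𝕜 := ℝ) G u.1.grad)
  simp only [real_inner_comm G]
  exact key

/-- A functional on the subspace extends to L^{2*} by Hahn–Banach, where bounded a.e. convergence
implies weak convergence. -/
theorem weakTendsto_of_tendsto_ae {S : Submodule ℝ (LCrit N Ω)} {w : ℕ → S} {w₀ : S} {M : ℝ}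
    (hM : ∀ n, ‖(w n).1‖ ≤ M)
    (hlim : ∀ᵐ x ∂volume.restrict Ω, Tendsto (fun n => (w n).1 x) atTop (𝓝 (w₀.1 x))) :
    WeakTendsto w w₀ := by
  have : Fact (1 ≤ ENNReal.ofReal (critExp N)) := one_le_twoStar N
  refine weakTendsto_iff.2 fun ℓ => ?_
  obtain ⟨g, hg, -⟩ := exists_extension_norm_eq S ℓ
  have h := Lp.tendsto_apply_of_tendsto_ae (one_lt_critExp N) hM hlim g
  rw [← hg w₀]
  exact h.congr fun n => hg (w n)

theorem tendsto_eLpNorm_sub_of_tendsto_ae {w : ℕ → LCrit N Ω} {w₀ : LCrit N Ω} {M : ℝ}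
    (hM : ∀ n, ‖w n‖ ≤ M)
    (hlim : ∀ᵐ x ∂volume.restrict Ω, Tendsto (fun n => w n x) atTop (𝓝 (w₀ x)))
    {p : ℝ≥0∞} (hp1 : 1 ≤ p) (hp : p < twoStar N) {K : Set (Vec N)} (hK : IsCompact K)
    (hKΩ : K ⊆ Ω) :
    Tendsto (fun n => eLpNorm (fun x => w n x - w₀ x) p (volume.restrict K)) atTop (𝓝 0) := by
  have hc := one_lt_critExp N
  obtain ⟨q, rfl⟩ : ∃ q : ℝ, p = ENNReal.ofReal q := ⟨p.toReal, (ENNReal.ofReal_toReal hp.ne_top).symm⟩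
  have hq1 : 1 ≤ q := by simpa using hp1
  have hq : q < critExp N := (ENNReal.ofReal_lt_ofReal_iff (by linarith)).1 hp
  have hfin : IsFiniteMeasure (volume.restrict K) := ⟨by simpa using hK.measure_lt_top⟩
  have hle : volume.restrict K ≤ volume.restrict Ω := Measure.restrict_mono hKΩ le_rfl
  have hd : ∀ n, MemLp (fun x => w n x - w₀ x) (ENNReal.ofReal (critExp N)) (volume.restrict Ω) :=
    fun n => (Lp.memLp (w n)).sub (Lp.memLp w₀)
  have hdM : ∀ n, ∫ x in K, ‖w n x - w₀ x‖ ^ critExp N ≤ (M + ‖w₀‖) ^ critExp N := fun n => by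
    have h1 : ∫ x in K, ‖w n x - w₀ x‖ ^ critExp N ≤ ∫ x in Ω, ‖w n x - w₀ x‖ ^ critExp N :=
      integral_mono_measure hle (ae_of_all _ fun x => by positivity)
        (MemLp.integrable_norm_rpow_ofReal hc.le (hd n))
    have h2 : ∫ x in Ω, ‖w n x - w₀ x‖ ^ critExp N = ‖w n - w₀‖ ^ critExp N := by
      refine Eq.trans (integral_congr_ae ?_) (Lp.norm_rpow_eq_integral hc.le (w n - w₀)).symm
      filter_upwards [Lp.coeFn_sub (w n) w₀] with x hx
      rw [hx, Pi.sub_apply]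
    rw [h2] at h1
    exact h1.trans (Real.rpow_le_rpow (norm_nonneg (w n - w₀))
      ((norm_sub_le (w n) w₀).trans (add_le_add (hM n) le_rfl)) (by linarith))
  have h := tendsto_integral_norm_rpow_of_tendsto_ae (μ := volume.restrict K) hc.le
    (by linarith) hq (f := fun n x => w n x - w₀ x) (fun n => (hd n).mono_measure hle) hdM
    (by
      filter_upwards [ae_mono hle hlim] with x hx
      simpa using hx.sub_const (w₀ x))
  have hr := ENNReal.tendsto_ofReal (h.rpow_const (p := q⁻¹) (Or.inr (by positivity)))
  rw [Real.zero_rpow (by positivity), ENNReal.ofReal_zero] at hr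
  refine hr.congr fun n => ?_
  rw [eLpNorm_ofReal_eq hq1 (((hd n).mono_measure hle).mono_exponent
    (ENNReal.ofReal_le_ofReal hq.le))]

theorem IsCorrector.corrector {F : Vec N → Vec N → ℝ} {S : Submodule ℝ (LCrit N Ω)} {v : D12 N}
    (h : ∃ w, IsCorrector Ω F S v w) : IsCorrector Ω F S v (corrector Ω F S v) :=
  Classical.epsilon_spec h

end MainTheorem

theorem theorem3p1 (N : ℕ) [Fact (3 ≤ N)]
    (Ω : Set (Vec N)) (hΩ : IsOpen Ω) (hΩc : IsConnected Ω)
    (V : Submodule ℝ (D12 N)) (hV : IsClosed (V : Set (D12 N)))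
    (Z : Submodule ℝ (LCrit N Ω)) (hZ : FiniteDimensional ℝ Z) (hZW : Z ⊓ curlFree N Ω = ⊥)
    (F : Vec N → Vec N → ℝ) (hF1 : CondF1 Ω F) (hF2 : CondF2 Ω F) (hF3 : CondF3 Ω F) :
    -- the correctors are well defined
    (∀ v ∈ V, ∃! w : ↥(curlFree N Ω ⊔ Z), IsCorrector Ω F (curlFree N Ω ⊔ Z) v w) ∧
    ∀ (v : ℕ → V) (v₀ : V) (μ ρ : Measure (Vec N)) [IsFiniteMeasure μ] [IsFiniteMeasure ρ],
      WeakTendsto v v₀ →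
      (∀ᵐ x : Vec N, Tendsto (fun n => (v n).1.fn x) atTop (𝓝 (v₀.1.fn x))) →
      MeasTendsto (fun n x => ‖(v n).1.grad x‖ ^ 2) μ →
      MeasTendsto (fun n x => ‖(v n).1.fn x‖ ^ critExp N) ρ →
      -- the limit measures
      (∃ (I : Set (Vec N)) (μw ρw : I → ℝ≥0), I.Countable ∧
        volume.withDensity (fun x => ENNReal.ofReal (‖v₀.1.grad x‖ ^ 2))
          + Measure.sum (fun x : I => μw x • Measure.dirac (x : Vec N)) ≤ μ ∧
        ρ = volume.withDensity (fun x => ENNReal.ofReal (‖v₀.1.fn x‖ ^ critExp N))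
          + Measure.sum (fun x : I => ρw x • Measure.dirac (x : Vec N))) ∧
      -- convergence of the correctors along a subsequence
      ∃ s : ℕ → ℕ, StrictMono s ∧
        WeakTendsto (fun n => corrector Ω F (curlFree N Ω ⊔ Z) (v (s n)).1)
          (corrector Ω F (curlFree N Ω ⊔ Z) v₀.1) ∧
        (∀ᵐ x ∂volume.restrict Ω,
          Tendsto (fun n => (corrector Ω F (curlFree N Ω ⊔ Z) (v (s n)).1).1 x) atTop
            (𝓝 ((corrector Ω F (curlFree N Ω ⊔ Z) v₀.1).1 x))) ∧
        ∀ p : ℝ≥0∞, 1 ≤ p → p < twoStar N → ∀ K : Set (Vec N), IsCompact K → K ⊆ Ω →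
          Tendsto (fun n => eLpNorm (fun x =>
              (corrector Ω F (curlFree N Ω ⊔ Z) (v (s n)).1).1 x
                - (corrector Ω F (curlFree N Ω ⊔ Z) v₀.1).1 x) p (volume.restrict K))
            atTop (𝓝 0) := by
  have hp := one_lt_critExp N
  have : Fact (1 ≤ ENNReal.ofReal (critExp N)) := one_le_twoStar N
  obtain ⟨b, c, hF⟩ := exists_uniformlyConvexIntegrand hΩ.measurableSet hF1 hF2 hF3
  have hex : ∀ v : D12 N, ∃! w : ↥(curlFree N Ω ⊔ Z), IsCorrector Ω F (curlFree N Ω ⊔ Z) v w :=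
    fun v => hF.existsUnique_minimizer hp (isClosed_curlFree_sup Z)
      (v.memLp_fn.restrict Ω)
  have hcor : ∀ v : D12 N, IsCorrector Ω F (curlFree N Ω ⊔ Z) v
      (corrector Ω F (curlFree N Ω ⊔ Z) v) := fun v => IsCorrector.corrector (hex v).exists
  refine ⟨fun v _ => hex v, ?_⟩
  intro v v₀ μ ρ _ _ hweak hae hμ hρ
  obtain ⟨M, hM⟩ := hweak.exists_norm_le
  obtain ⟨D, hD, hμD, hρD⟩ := D12.exists_countable_concentration (u := fun n => (v n).1)
    (u₀ := v₀.1) (M := M) hM hweak.tendsto_inner_grad hae hμ hρ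
  refine ⟨?_, ?_⟩
  · obtain ⟨μw, hμw⟩ := exists_sum_dirac_eq_restrict μ hD
    obtain ⟨ρw, hρw⟩ := exists_sum_dirac_eq_restrict ρ hD
    refine ⟨D, μw, ρw, hD, ?_, ?_⟩
    · rw [hμw]
      exact hμD
    · rw [hρw]
      exact hρD
  obtain ⟨C, hC0, hC⟩ := D12.exists_norm_fn_le (N := N)
  obtain ⟨K, hK⟩ := hF.exists_norm_minimizer_le hp.le ((C * M) ^ critExp N)
  have hvM : ∀ n, ∫ x in Ω, ‖(v n).1.fn x‖ ^ critExp N ≤ (C * M) ^ critExp N := fun n => by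
    refine (setIntegral_le_integral (v n).1.integrable_norm_fn_rpow
      (ae_of_all _ fun x => by positivity)).trans ?_
    refine (le_of_eq (Lp.norm_rpow_eq_integral hp.le (v n).1.fn).symm).trans ?_
    exact Real.rpow_le_rpow (norm_nonneg (v n).1.fn)
      ((hC _).trans (mul_le_mul_of_nonneg_left (hM n) hC0)) (by linarith)
  have hwK : ∀ n, ∫ x in Ω, ‖(v n).1.fn x + (corrector Ω F (curlFree N Ω ⊔ Z) (v n).1).1 x‖ ^
      critExp N ≤ K ∧ ‖(corrector Ω F (curlFree N Ω ⊔ Z) (v n).1).1‖ ≤ K := fun n => by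
    -- The energy of the corrector is compared with that of the competitor 0.
    refine hK _ _ ((v n).1.memLp_fn.restrict Ω) (hvM n) ((hcor (v n).1 0).trans (le_of_eq ?_))
    refine integral_congr_ae ?_
    filter_upwards [Lp.coeFn_zero (Vec N) (twoStar N) (volume.restrict Ω)] with x hx
    rw [Submodule.coe_zero, hx, Pi.zero_apply, add_zero]
  obtain ⟨s, hs, w₀, hw₀, hlim, hmin⟩ := exists_subseq_tendsto_minimizer hΩ hΩc.nonempty hF hZW
    hae hρ hD hρD (fun n => (corrector Ω F (curlFree N Ω ⊔ Z) (v n).1).2) hwK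
    fun n w' hw' => hcor (v n).1 ⟨w', hw'⟩
  -- The a.e. limit is a minimiser for `v₀`, so uniqueness identifies it with the corrector.
  have hw₀eq : corrector Ω F (curlFree N Ω ⊔ Z) v₀.1 = ⟨w₀, hw₀⟩ :=
    (hex v₀.1).unique (hcor v₀.1) fun w' => hmin w'.1 w'.2
  rw [hw₀eq]
  exact ⟨s, hs, weakTendsto_of_tendsto_ae (fun n => (hwK (s n)).2) hlim, hlim,
    fun p hp1 hp2 K' hK' hKΩ => tendsto_eLpNorm_sub_of_tendsto_ae (fun n => (hwK (s n)).2) hlim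
      hp1 hp2 hK' hKΩ⟩
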